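/- Let $(M,L)$ be a (smooth, Hausdorff) Finsler manifold of dimension $n\ge 3$ with Finsler metric $g=\tfrac12\,\partial^2L^2/\partial y\,\partial y$, and let $\nabla$ be its Cartan connection, i.e. the regular linear connection on the pullback bundle $\pi^{-1}(TM)$ over the slit tangent bundle $\mathcal TM$ that is metric, has vanishing (h)h-torsion and has (h)hv-torsion $T$ with $g(T(X,Y),Z)=g(T(X,Z),Y)$. Let $\beta$ be its horizontal map, $\overset{h}{\nabla}_X=\nabla_{\beta X}$ its $h$-covariant derivative, $R(X,Y)Z=-\nabla_{\beta X}\nabla_{\beta Y}Z+\nabla_{\beta Y}\nabla_{\beta X}Z+\nabla_{[\beta X,\beta Y]}Z$ its $h$-curvature, $\mathrm{Ric}(X,Y)=\mathrm{Tr}\{Z\mapsto R(X,Z)Y\}$ its horizontal Ricci tensor, $r=g^{ij}\mathrm{Ric}_{ij}$ its horizontal scalar curvature, and put $$G(X,Y)Z=g(X,Z)Y-g(Y,Z)X,\qquad C=R-\frac{r}{n(n-1)}\,G .$$ A *form* below is a smooth scalar $\pi$-form on $\mathcal TM$, of type $(0,1)$ or $(0,2)$, positively homogeneous of degree $0$ in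 $y$; *nonzero* means not identically zero. Suppose that $C\neq0$ and that $$\overset{h}{\nabla}C=A\otimes C+B\otimes G$$ for forms $A\neq 0$ and $B$ of type $(0,1)$. Let $$\alpha(V,W)=(\overset{h}{\nabla}_VA)(W)+A(V)A(W),\qquad \mu(V,W)=(\overset{h}{\nabla}_VB)(W)+A(W)B(V)$$ (that is, $\alpha=\overset{h}{\nabla}A+A\otimes A$ and $\mu=\overset{h}{\nabla}B+A\otimes B$), and let $$B_1=B-\frac{rA}{n(n-1)}+\frac{\overset{h}{\nabla}r}{n(n-1)} .$$ Then: (a) $\overset{h}{\nabla}\overset{h}{\nabla}C=\alpha\otimes C+\mu\otimes G$. If moreover $\alpha\ne0$ and $\mu\neq0$, then $(M,L)$ is generalized 2-concircularly recurrent with recurrence forms $\alpha,\mu$; that is, $C\ne0$, the identity just stated holds, and $\alpha,\mu$ are nonzero forms of type $(0,2)$. (b) $\overset{h}{\nabla}R=A\otimes R+B_1\otimes G$ and $\overset{h}{\nabla}\mathrm{Ric}=A\otimes\mathrm{Ric}+(n-1)B_1\otimes g$. If moreover $B_1\neq0$, then $(M,L)$ is generalized recurrent with recurrence forms $A,B_1$,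 and generalized Ricci recurrent with recurrence forms $A,(n-1)B_1$; that is, $R\neq0$, $\mathrm{Ric}\neq0$, the two identities just stated hold, and $A$, $B_1$, $(n-1)B_1$ are nonzero forms of type $(0,1)$. -/

import Mathlib

open Bundle Set
open scoped Manifold ContDiff Topology

noncomputable section

namespace Finsler

/-! ### The pullback bundle over the slit tangent bundle

`M` is a smooth manifold of dimension `n`. Objects on the slit tangent bundle (the open set of
nonzero tangent vectors) are written as functions on the whole tangent bundle of which only the
values and germs on `slit n M` matter. -/

section Bundle

variable (n : ℕ) (M : Type*) [TopologicalSpace M] [ChartedSpace (EuclideanSpace ℝ (Fin n)) M]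
  [IsManifold (𝓡 n) ∞ M]

/-- The tangent bundle of `M`. -/
abbrev TM : Type _ := TangentBundle (𝓡 n) M

/-- The projection of the tangent bundle onto `M`. -/
def proj : C^∞⟮(𝓡 n).tangent, TM n M; 𝓡 n, M⟯ :=
  ⟨fun u => u.proj, contMDiff_proj (TangentSpace (𝓡 n))⟩

/-- The pullback bundle `π⁻¹(TM)`, whose fibre at `u` is the tangent space of `M` at `π u`. -/
abbrev PB : TM n M → Type _ := (proj n M) *ᵖ (TangentSpace (𝓡 n) : M → Type _)

instance (u : TM n M) : AddCommGroup (PB n M u) :=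
  inferInstanceAs (AddCommGroup (TangentSpace (𝓡 n) u.proj))

instance (u : TM n M) : IsTopologicalAddGroup (PB n M u) :=
  inferInstanceAs (IsTopologicalAddGroup (TangentSpace (𝓡 n) u.proj))

instance (u : TM n M) : ContinuousSMul ℝ (PB n M u) :=
  inferInstanceAs (ContinuousSMul ℝ (TangentSpace (𝓡 n) u.proj))

/-- The slit tangent bundle: the nonzero tangent vectors. -/
def slit : Set (TM n M) := {u | u.snd ≠ 0}

/-- π-vector fields: sections of the pullback bundle (no smoothness). -/
abbrev PiField : Type _ := Π u : TM n M, PB n M u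

/-- Vector fields on the manifold `TM` (no smoothness). -/
abbrev VField : Type _ := Π u : TM n M, TangentSpace (𝓡 n).tangent u

/-- Candidates for a linear connection on the pullback bundle: `D Z u w` is `D_w Z`. -/
abbrev Conn : Type _ :=
  PiField n M → Π u : TM n M, TangentSpace (𝓡 n).tangent u →L[ℝ] PB n M u

/-- Scalar π-forms of degree one (no smoothness). -/
abbrev OneForm : Type _ := Π u : TM n M, PB n M u →L[ℝ] ℝ

/-- Scalar π-forms of type `(0,2)`, not necessarily skew (no smoothness). -/
abbrev TwoForm : Type _ := Π u : TM n M, PB n M u →L[ℝ] PB n M u →L[ℝ] ℝ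

end Bundle

variable {n : ℕ} {M : Type*} [TopologicalSpace M] [ChartedSpace (EuclideanSpace ℝ (Fin n)) M]
  [IsManifold (𝓡 n) ∞ M]

/-- The π-vector field `X` is smooth on the slit tangent bundle. -/
def IsSmoothField (X : PiField n M) : Prop :=
  ContMDiffOn (𝓡 n).tangent ((𝓡 n).tangent.prod 𝓘(ℝ, EuclideanSpace ℝ (Fin n))) ∞
    (fun u => (⟨u, X u⟩ : TotalSpace (EuclideanSpace ℝ (Fin n)) (PB n M))) (slit n M)

/-- The real function `f` is smooth on the slit tangent bundle. -/
def IsSmoothFun (f : TM n M → ℝ) : Prop :=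
  ContMDiffOn (𝓡 n).tangent 𝓘(ℝ, ℝ) ∞ f (slit n M)

/-- The fibre of the pullback bundle at `u` is the model space `ℝⁿ` (in Mathlib a tangent space is the
model vector space itself; it is the coordinate space of the preferred chart). -/
def fib (u : TM n M) : EuclideanSpace ℝ (Fin n) ≃L[ℝ] PB n M u :=
  ContinuousLinearEquiv.refl ℝ (EuclideanSpace ℝ (Fin n))

/-- The fundamental π-vector field `η(u) = (u, u)`. -/
def eta : PiField n M := fun u => u.snd

/-- The bundle map `ρ : T(TM) → π⁻¹(TM)`, i.e. the differential of the projection. -/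
def rho (u : TM n M) : TangentSpace (𝓡 n).tangent u →L[ℝ] PB n M u :=
  mfderiv (𝓡 n).tangent (𝓡 n) (proj n M) u

/-- The vertical lift `γ : π⁻¹(TM) → T(TM)`: `γ_u X` is the velocity at `t = 0` of the curve
`t ↦ u + t X` in the fibre through `u`. -/
def gamma (u : TM n M) (X : PB n M u) : TangentSpace (𝓡 n).tangent u :=
  mfderiv 𝓘(ℝ, ℝ) (𝓡 n).tangent
    (fun t : ℝ => (⟨u.proj, (u.snd + t • (show TangentSpace (𝓡 n) u.proj from X) : TangentSpace (𝓡 n) u.proj)⟩ : TM n M)) 0 (1 : ℝ)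

/-! ### Finsler structures -/

/-- The Finsler metric `g = ½ ∂²L²/∂y∂y` defined by `L`. -/
def metric (L : TM n M → ℝ) (u : TM n M) (X Y : PB n M u) : ℝ :=
  fderiv ℝ (fderiv ℝ (fun v : EuclideanSpace ℝ (Fin n) =>
    (1 / 2 : ℝ) * L (⟨u.proj, fib u v⟩ : TM n M) ^ 2)) ((fib u).symm u.snd)
      ((fib u).symm X) ((fib u).symm Y)

/-- `(M, L)` is a Finsler manifold. -/
structure IsFinsler (L : TM n M → ℝ) : Prop where
  continuous : Continuous L
  smooth : IsSmoothFun L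
  zero : ∀ x : M, L (⟨x, (0 : TangentSpace (𝓡 n) x)⟩ : TM n M) = 0
  pos : ∀ u ∈ slit n M, 0 < L u
  homogeneous : ∀ (x : M) (y : TangentSpace (𝓡 n) x) (c : ℝ), 0 < c →
    L (⟨x, c • y⟩ : TM n M) = c * L (⟨x, y⟩ : TM n M)
  posDef : ∀ u ∈ slit n M, ∀ X : PB n M u, X ≠ 0 → 0 < metric L u X X

/-! ### Connections on the pullback bundle -/

/-- `D` is a (smooth) linear connection on the pullback bundle over the slit tangent bundle. -/
structure IsLinearConnection (D : Conn n M) : Prop where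
  cov : IsCovariantDerivativeOn (I := (𝓡 n).tangent) (EuclideanSpace ℝ (Fin n)) D (slit n M)
  smooth : ContMDiffCovariantDerivativeOn (I := (𝓡 n).tangent)
    (EuclideanSpace ℝ (Fin n)) ∞ D (slit n M)

/-- The connection map `K w = D_w η`. Its kernel at `u` is the horizontal space. -/
def connMap (D : Conn n M) (u : TM n M) : TangentSpace (𝓡 n).tangent u →L[ℝ] PB n M u :=
  D eta u

/-- `D` is regular: `T_u(TM)` is the direct sum of the vertical and the horizontal space. -/
def IsRegular (D : Conn n M) : Prop :=
  ∀ u ∈ slit n M, IsCompl (LinearMap.ker (rho u).toLinearMap)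
    (LinearMap.ker (connMap D u).toLinearMap)

/-- The horizontal map `β`: for a regular connection, `β_u X` is the unique tangent vector `w` with
`ρ w = X` and `K w = 0`, that is, the preimage of `(X, 0)` under the isomorphism `(ρ, K)`. -/
def beta (D : Conn n M) (u : TM n M) : PB n M u →L[ℝ] TangentSpace (𝓡 n).tangent u :=
  ((rho u).prod (connMap D u)).inverse.comp (ContinuousLinearMap.inl ℝ (PB n M u) (PB n M u))

/-- The horizontal lift `βX` of a π-vector field. -/
def hlift (D : Conn n M) (X : PiField n M) : VField n M := fun u => beta D u (X u)

/-- The vertical lift `γX` of a π-vector field. -/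
def vlift (X : PiField n M) : VField n M := fun u => gamma u (X u)

/-- The classical torsion `T(V, W) = D_V ρW - D_W ρV - ρ[V, W]`. -/
def torsion (D : Conn n M) (V W : VField n M) : PiField n M := fun u =>
  D (fun v => rho v (W v)) u (V u) - D (fun v => rho v (V v)) u (W u)
    - rho u (VectorField.mlieBracket (𝓡 n).tangent V W u)

/-- The (h)h-torsion `Q`. -/
def torsionQ (D : Conn n M) (X Y : PiField n M) : PiField n M :=
  torsion D (hlift D X) (hlift D Y)

/-- The (h)hv-torsion `T`. -/
def torsionT (D : Conn n M) (X Y : PiField n M) : PiField n M :=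
  torsion D (vlift X) (hlift D Y)

/-- `D` is the Cartan connection of `(M, L)`: the regular connection on the pullback bundle which
is metric, has vanishing (h)h-torsion and has symmetric (h)hv-torsion. -/
structure IsCartanConnection (L : TM n M → ℝ) (D : Conn n M) : Prop where
  linear : IsLinearConnection D
  regular : IsRegular D
  metric : ∀ Y Z : PiField n M, IsSmoothField Y → IsSmoothField Z → ∀ u ∈ slit n M,
    ∀ w : TangentSpace (𝓡 n).tangent u,
      mvfderiv (𝓡 n).tangent (fun v => metric L v (Y v) (Z v)) u w
        = metric L u (D Y u w) (Z u) + metric L u (Y u) (D Z u w)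
  torsionQ_eq_zero : ∀ X Y : PiField n M, IsSmoothField X → IsSmoothField Y → ∀ u ∈ slit n M,
    torsionQ D X Y u = 0
  torsionT_symm : ∀ X Y Z : PiField n M, IsSmoothField X → IsSmoothField Y → IsSmoothField Z →
    ∀ u ∈ slit n M,
      Finsler.metric L u (torsionT D X Y u) (Z u) = Finsler.metric L u (torsionT D X Z u) (Y u)

/-! ### Horizontal curvature -/

/-- The classical curvature `K(V, W)Z = -D_V D_W Z + D_W D_V Z + D_[V, W] Z`. The sign is the one for
which constant curvature `k` in the Riemannian case means `R = k G`, with `G` as below. -/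
def classicalCurvature (D : Conn n M) (V W : VField n M) (Z : PiField n M) : PiField n M :=
  fun u => - D (fun v => D Z v (W v)) u (V u) + D (fun v => D Z v (V v)) u (W u)
    + D Z u (VectorField.mlieBracket (𝓡 n).tangent V W u)

/-- The h-curvature tensor `R(X, Y)Z`. -/
def curvR (D : Conn n M) (X Y Z : PiField n M) : PiField n M :=
  classicalCurvature D (hlift D X) (hlift D Y) Z

/-- A π-vector field, smooth near `u`, whose value at `u` is the `i`-th vector of a basis of the
fibre (which is `ℝⁿ`). -/
def frame (u : TM n M) (i : Fin n) : PiField n M :=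
  FiberBundle.extend (EuclideanSpace ℝ (Fin n)) (E := PB n M) (x := u)
    (fib u (EuclideanSpace.single i (1 : ℝ)))

/-- The `i`-th coordinate of a vector in the fibre at `u`, in the basis `i ↦ frame u i u`. -/
def coord (u : TM n M) (i : Fin n) (w : PB n M u) : ℝ :=
  (fib u).symm w i

/-- The horizontal Ricci tensor: `Ric(X, Y)` is the trace of `Z ↦ R(X, Z)Y`. -/
def ricci (D : Conn n M) (X Y : PiField n M) (u : TM n M) : ℝ :=
  ∑ i : Fin n, coord u i (curvR D X (frame u i) Y u)

/-- The horizontal scalar curvature `r = g^{ij} Ric_{ij}`, the `g`-trace of the horizontal Ricci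
tensor. -/
def scalarCurv (L : TM n M → ℝ) (D : Conn n M) (u : TM n M) : ℝ :=
  ((Matrix.of fun i j : Fin n => metric L u (frame u i u) (frame u j u))⁻¹ *
    Matrix.of fun i j : Fin n => ricci D (frame u i) (frame u j) u).trace

/-- `G(X, Y)Z = g(X, Z) Y - g(Y, Z) X`. -/
def tensorG (L : TM n M → ℝ) (X Y Z : PiField n M) : PiField n M := fun u =>
  metric L u (X u) (Z u) • Y u - metric L u (Y u) (Z u) • X u

/-- The concircular curvature tensor `C = R - r / (n (n - 1)) G`. -/
def concircular (L : TM n M → ℝ) (D : Conn n M) (X Y Z : PiField n M) : PiField n M := fun u =>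
  curvR D X Y Z u - (scalarCurv L D u / ((n : ℝ) * ((n : ℝ) - 1))) • tensorG L X Y Z u

/-! ### Horizontal covariant derivatives

The first argument after the tensor is the direction of differentiation. -/

/-- `∇^h_W X = D_{βW} X`. -/
def hD (D : Conn n M) (W X : PiField n M) : PiField n M := fun u => D X u (hlift D W u)

/-- `∇^h f` for a function `f`, as a π-form. -/
def hDFun (D : Conn n M) (f : TM n M → ℝ) : OneForm n M := fun u =>
  (mvfderiv (𝓡 n).tangent f u).comp (beta D u)

/-- `(∇^h_V A)(W)` for a scalar π-form `A`. -/
def hDOneForm (D : Conn n M) (A : OneForm n M) (V W : PiField n M) (u : TM n M) : ℝ :=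
  hDFun D (fun v => A v (W v)) u (V u) - A u (hD D V W u)

/-- `(∇^h_W S)(X, Y)` for a tensor `S` of type `(0,2)`. -/
def hDBilin (D : Conn n M) (S : PiField n M → PiField n M → TM n M → ℝ)
    (W X Y : PiField n M) (u : TM n M) : ℝ :=
  hDFun D (S X Y) u (W u) - S (hD D W X) Y u - S X (hD D W Y) u

/-- `(∇^h_W T)(X, Y, Z)` for a tensor `T` of type `(1,3)`. -/
def hDTensor (D : Conn n M) (T : PiField n M → PiField n M → PiField n M → PiField n M)
    (W X Y Z : PiField n M) : PiField n M := fun u =>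
  hD D W (T X Y Z) u - T (hD D W X) Y Z u - T X (hD D W Y) Z u - T X Y (hD D W Z) u

/-- `(∇^h ∇^h T)(V, W, X, Y, Z) = (∇^h_V (∇^h T))(W, X, Y, Z)` for a tensor `T` of type `(1,3)`. -/
def hDTensor₂ (D : Conn n M) (T : PiField n M → PiField n M → PiField n M → PiField n M)
    (V W X Y Z : PiField n M) : PiField n M := fun u =>
  hD D V (hDTensor D T W X Y Z) u - hDTensor D T (hD D V W) X Y Z u
    - hDTensor D T W (hD D V X) Y Z u - hDTensor D T W X (hD D V Y) Z u
    - hDTensor D T W X Y (hD D V Z) u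

/-! ### Recurrence -/

/-- A smooth scalar π-form, positively homogeneous of degree zero in `y`. -/
structure IsOneForm (A : OneForm n M) : Prop where
  smooth : ∀ X : PiField n M, IsSmoothField X → IsSmoothFun fun u => A u (X u)
  homogeneous : ∀ (x : M) (y : TangentSpace (𝓡 n) x) (c : ℝ), 0 < c → y ≠ 0 →
    ∀ v : TangentSpace (𝓡 n) x, A (⟨x, c • y⟩ : TM n M) v = A (⟨x, y⟩ : TM n M) v

/-- A smooth scalar π-form of type `(0,2)`, positively homogeneous of degree zero in `y`. -/
structure IsTwoForm (α : TwoForm n M) : Prop where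
  smooth : ∀ X Y : PiField n M, IsSmoothField X → IsSmoothField Y →
    IsSmoothFun fun u => α u (X u) (Y u)
  homogeneous : ∀ (x : M) (y : TangentSpace (𝓡 n) x) (c : ℝ), 0 < c → y ≠ 0 →
    ∀ v w : TangentSpace (𝓡 n) x, α (⟨x, c • y⟩ : TM n M) v w = α (⟨x, y⟩ : TM n M) v w

/-- The π-form `A` does not vanish identically. -/
def OneForm.NonZero (A : OneForm n M) : Prop := ∃ u ∈ slit n M, A u ≠ 0

/-- The π-form `α` does not vanish identically. -/
def TwoForm.NonZero (α : TwoForm n M) : Prop := ∃ u ∈ slit n M, α u ≠ 0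

/-- The tensor `S` of type `(0,2)`, given on π-vector fields, does not vanish identically. -/
def BilinNonZero (S : PiField n M → PiField n M → TM n M → ℝ) : Prop :=
  ∃ X Y : PiField n M, IsSmoothField X ∧ IsSmoothField Y ∧ ∃ u ∈ slit n M, S X Y u ≠ 0

/-- The tensor `T` of type `(1,3)`, given on π-vector fields, does not vanish identically. -/
def TensorNonZero (T : PiField n M → PiField n M → PiField n M → PiField n M) : Prop :=
  ∃ X Y Z : PiField n M, IsSmoothField X ∧ IsSmoothField Y ∧ IsSmoothField Z ∧
    ∃ u ∈ slit n M, T X Y Z u ≠ 0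

/-- `∇^h T = A ⊗ T + B ⊗ G`. -/
def RecurrenceEq (L : TM n M → ℝ) (D : Conn n M)
    (T : PiField n M → PiField n M → PiField n M → PiField n M) (A B : OneForm n M) : Prop :=
  ∀ W X Y Z : PiField n M, IsSmoothField W → IsSmoothField X → IsSmoothField Y →
    IsSmoothField Z → ∀ u ∈ slit n M,
      hDTensor D T W X Y Z u = A u (W u) • T X Y Z u + B u (W u) • tensorG L X Y Z u

/-- `∇^h ∇^h T = α ⊗ T + μ ⊗ G`, where the forms `α`, `μ` are given on π-vector fields. -/
def TwoRecurrenceEq (L : TM n M → ℝ) (D : Conn n M)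
    (T : PiField n M → PiField n M → PiField n M → PiField n M)
    (α μ : PiField n M → PiField n M → TM n M → ℝ) : Prop :=
  ∀ V W X Y Z : PiField n M, IsSmoothField V → IsSmoothField W → IsSmoothField X →
    IsSmoothField Y → IsSmoothField Z → ∀ u ∈ slit n M,
      hDTensor₂ D T V W X Y Z u = α V W u • T X Y Z u + μ V W u • tensorG L X Y Z u

/-- `∇^h Ric = A ⊗ Ric + B ⊗ g`. -/
def RicciRecurrenceEq (L : TM n M → ℝ) (D : Conn n M) (A B : OneForm n M) : Prop :=
  ∀ W X Y : PiField n M, IsSmoothField W → IsSmoothField X → IsSmoothField Y → ∀ u ∈ slit n M,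
    hDBilin D (ricci D) W X Y u
      = A u (W u) * ricci D X Y u + B u (W u) * metric L u (X u) (Y u)

/-- `(M, L)`, with Cartan connection `D`, is generalized recurrent with recurrence forms `A`, `B`. -/
structure IsGeneralizedRecurrent (L : TM n M → ℝ) (D : Conn n M) (A B : OneForm n M) :
    Prop where
  curv_ne : TensorNonZero (curvR D)
  formA : IsOneForm A
  formB : IsOneForm B
  neA : A.NonZero
  neB : B.NonZero
  eq : RecurrenceEq L D (curvR D) A B

/-- `(M, L)`, with Cartan connection `D`, is generalized Ricci recurrent with recurrence forms
`A`, `B`. -/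
structure IsGeneralizedRicciRecurrent (L : TM n M → ℝ) (D : Conn n M) (A B : OneForm n M) :
    Prop where
  ricci_ne : BilinNonZero (ricci D)
  formA : IsOneForm A
  formB : IsOneForm B
  neA : A.NonZero
  neB : B.NonZero
  eq : RicciRecurrenceEq L D A B

/-- `(M, L)`, with Cartan connection `D`, is generalized 2-concircularly recurrent with recurrence
forms `α`, `μ`. -/
structure IsGeneralized2ConcircularlyRecurrent (L : TM n M → ℝ) (D : Conn n M)
    (α μ : TwoForm n M) : Prop where
  conc_ne : TensorNonZero (concircular L D)
  formα : IsTwoForm α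
  formμ : IsTwoForm μ
  neα : α.NonZero
  neμ : μ.NonZero
  eq : TwoRecurrenceEq L D (concircular L D)
    (fun V W u => α u (V u) (W u)) (fun V W u => μ u (V u) (W u))

/-- The form `B - r A / (n (n - 1)) + ∇^h r / (n (n - 1))`. -/
def formB₁ (L : TM n M → ℝ) (D : Conn n M) (A B : OneForm n M) : OneForm n M := fun u =>
  B u - (scalarCurv L D u / ((n : ℝ) * ((n : ℝ) - 1))) • A u
    + (1 / ((n : ℝ) * ((n : ℝ) - 1))) • hDFun D (scalarCurv L D) u

/-- `∇^h A + A ⊗ A`, evaluated on `(V, W)` as `(∇^h_V A)(W) + A(V) A(W)`. -/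
def formAlpha (D : Conn n M) (A : OneForm n M) (V W : PiField n M) (u : TM n M) : ℝ :=
  hDOneForm D A V W u + A u (V u) * A u (W u)

/-- `∇^h B + A ⊗ B`, evaluated on `(V, W)`, with `V` the direction of the derivative, as
`(∇^h_V B)(W) + A(W) B(V)`. This is the placement of the arguments that arises when `A ⊗ T` is
differentiated: `∇^h_V` is applied to `A(W) T` and `∇^h_V T` contains `B(V) G`. -/
def formMu (D : Conn n M) (A B : OneForm n M) (V W : PiField n M) (u : TM n M) : ℝ :=
  hDOneForm D B V W u + A u (W u) * B u (V u)

end Finsler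

end

set_option linter.unusedSectionVars false

namespace Finsler

section Related

open VectorField

lemma lieBracket_of_related {E F : Type*} [NormedAddCommGroup E] [NormedSpace ℝ E]
    [NormedAddCommGroup F] [NormedSpace ℝ F] {f : E → F} {x : E} (hf : ContDiffAt ℝ 2 f x)
    {V W : E → E} {V' W' : F → F} (hV : DifferentiableAt ℝ V x) (hW : DifferentiableAt ℝ W x)
    (hV' : DifferentiableAt ℝ V' (f x)) (hW' : DifferentiableAt ℝ W' (f x))
    (h1 : ∀ᶠ y in 𝓝 x, fderiv ℝ f y (V y) = V' (f y))
    (h2 : ∀ᶠ y in 𝓝 x, fderiv ℝ f y (W y) = W' (f y)) :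
    fderiv ℝ f x (lieBracket ℝ V W x) = lieBracket ℝ V' W' (f x) := by
  have hdf : DifferentiableAt ℝ f x := hf.differentiableAt (by norm_num)
  have hddf : DifferentiableAt ℝ (fderiv ℝ f) x :=
    (hf.fderiv_right (m := 1) (by norm_num)).differentiableAt (by norm_num)
  have key : ∀ {U : E → E} {U' : F → F}, DifferentiableAt ℝ U x → DifferentiableAt ℝ U' (f x) →
      (∀ᶠ y in 𝓝 x, fderiv ℝ f y (U y) = U' (f y)) → ∀ v : E,
      fderiv ℝ (fderiv ℝ f) x v (U x) + fderiv ℝ f x (fderiv ℝ U x v)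
        = fderiv ℝ U' (f x) (fderiv ℝ f x v) := by
    intro U U' hU hU' h v
    have e := Filter.EventuallyEq.fderiv_eq (𝕜 := ℝ) (f₁ := fun y => fderiv ℝ f y (U y))
      (f := fun y => U' (f y)) h
    have e1 := (hddf.hasFDerivAt.clm_apply hU.hasFDerivAt).fderiv
    have e2 := (hU'.hasFDerivAt.comp x hdf.hasFDerivAt).fderiv
    have e3 : fderiv ℝ (fun y => U' (f y)) x = (fderiv ℝ U' (f x)).comp (fderiv ℝ f x) := e2
    rw [e1, e3] at e
    have := congrArg (fun T => T v) e
    simp at this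
    rw [← this]; abel
  have hsymm : IsSymmSndFDerivAt ℝ f x := hf.isSymmSndFDerivAt (by simp)
  have a1 := key hV hV' h1 (W x)
  have a2 := key hW hW' h2 (V x)
  rw [lieBracket, lieBracket, map_sub, ← h1.self_of_nhds, ← h2.self_of_nhds, ← a1, ← a2,
    hsymm.eq (W x) (V x)]
  abel

variable {H E M : Type*} [TopologicalSpace H] [NormedAddCommGroup E] [NormedSpace ℝ E]
  [CompleteSpace E] {I : ModelWithCorners ℝ E H} [I.Boundaryless] [TopologicalSpace M]
  [ChartedSpace H M] [IsManifold I 2 M]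
  {H' E' M' : Type*} [TopologicalSpace H'] [NormedAddCommGroup E'] [NormedSpace ℝ E']
  [CompleteSpace E'] {I' : ModelWithCorners ℝ E' H'} [I'.Boundaryless] [TopologicalSpace M']
  [ChartedSpace H' M'] [IsManifold I' 2 M']

lemma mlieBracket_eq_lieBracket_chart (V W : Π y : M, TangentSpace I y) (x : M) :
    mlieBracket I V W x =
      lieBracket ℝ (mpullbackWithin 𝓘(ℝ, E) I (extChartAt I x).symm V univ)
        (mpullbackWithin 𝓘(ℝ, E) I (extChartAt I x).symm W univ) (extChartAt I x x) := by
  have : IsManifold I 1 M := .of_le (n := 2) (by norm_num)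
  have h : ∀ v : E, (mfderiv I 𝓘(ℝ, E) (extChartAt I x) x).inverse v = v := fun v => by
    rw [mfderiv_extChartAt_self]
    exact congrArg (fun T : E →L[ℝ] E => T v) ContinuousLinearMap.inverse_id
  refine (mlieBracketWithin_apply (I := I)).trans ((h _).trans ?_)
  simp only [preimage_univ, I.range_eq_univ, inter_self]
  exact congrFun (lieBracketWithin_univ (𝕜 := ℝ) (E := E)) _

theorem mfderiv_mlieBracket_of_related {f : M → M'} {x : M} (hf : ContMDiffAt I I' 2 f x)
    {V W : Π y : M, TangentSpace I y} {V' W' : Π y : M', TangentSpace I' y}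
    (hV : MDiffAt (T% V) x) (hW : MDiffAt (T% W) x)
    (hV' : MDiffAt (T% V') (f x)) (hW' : MDiffAt (T% W') (f x))
    (h1 : ∀ᶠ y in 𝓝 x, mfderiv I I' f y (V y) = V' (f y))
    (h2 : ∀ᶠ y in 𝓝 x, mfderiv I I' f y (W y) = W' (f y)) :
    mfderiv I I' f x (mlieBracket I V W x) = mlieBracket I' V' W' (f x) := by
  have : IsManifold I 1 M := .of_le (n := 2) (by norm_num)
  have : IsManifold I' 1 M' := .of_le (n := 2) (by norm_num)
  rw [mlieBracket_eq_lieBracket_chart, mlieBracket_eq_lieBracket_chart]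
  set g : E → E' := writtenInExtChartAt I I' x f with hg
  have hgx : g (extChartAt I x x) = extChartAt I' (f x) (f x) := by
    simp [hg, writtenInExtChartAt]
  have hfx : MDifferentiableAt I I' f x := hf.mdifferentiableAt (by norm_num)
  have hD : mfderiv I I' f x = fderiv ℝ g (extChartAt I x x) := by
    rw [hfx.mfderiv, I.range_eq_univ, fderivWithin_univ]
  have hgc : ContDiffAt ℝ 2 g (extChartAt I x x) := by
    have := (contMDiffAt_iff.1 hf).2
    rw [I.range_eq_univ] at this
    exact this.contDiffAt Filter.univ_mem
  have dV := hV.mdifferentiableWithinAt (s := univ)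
    |>.differentiableWithinAt_mpullbackWithin_vectorField
  have dW := hW.mdifferentiableWithinAt (s := univ)
    |>.differentiableWithinAt_mpullbackWithin_vectorField
  have dV' := hV'.mdifferentiableWithinAt (s := univ)
    |>.differentiableWithinAt_mpullbackWithin_vectorField
  have dW' := hW'.mdifferentiableWithinAt (s := univ)
    |>.differentiableWithinAt_mpullbackWithin_vectorField
  simp only [preimage_univ, I.range_eq_univ, I'.range_eq_univ, inter_self] at dV dW dV' dW'
  have key : ∀ {U : Π y : M, TangentSpace I y} {U' : Π y : M', TangentSpace I' y},
      (∀ᶠ y in 𝓝 x, mfderiv I I' f y (U y) = U' (f y)) →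
      ∀ᶠ z in 𝓝 (extChartAt I x x), fderiv ℝ g z
        (mpullbackWithin 𝓘(ℝ, E) I (extChartAt I x).symm U univ z)
        = mpullbackWithin 𝓘(ℝ, E') I' (extChartAt I' (f x)).symm U' univ (g z) := by
    intro U U' h
    have hc : ContinuousAt (extChartAt I x).symm (extChartAt I x x) :=
      continuousAt_extChartAt_symm x
    have hc' : Filter.Tendsto (extChartAt I x).symm (𝓝 (extChartAt I x x)) (𝓝 x) := by
      have := hc.tendsto
      rwa [extChartAt_to_inv] at this
    have hfe : ∀ᶠ y in 𝓝 x, ContMDiffAt I I' 2 f y := (contMDiffAt_iff_contMDiffAt_nhds (by simp)).1 hf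
    have hsrc : ∀ᶠ y in 𝓝 x, f y ∈ (extChartAt I' (f x)).source :=
      hf.continuousAt.eventually (extChartAt_source_mem_nhds (I := I') (f x))
    have htgt : ∀ᶠ z in 𝓝 (extChartAt I x x), z ∈ (extChartAt I x).target := by
      exact extChartAt_target_mem_nhds (I := I) x
    filter_upwards [hc' h, hc' hfe, hc' hsrc, htgt] with z hz hfz hsz hzt
    set p := (extChartAt I x).symm z with hp
    have hpz : extChartAt I x p = z := (extChartAt I x).right_inv hzt
    have inv1 : (mfderiv[univ] (extChartAt I x).symm z).IsInvertible := by
      have := isInvertible_mfderivWithin_extChartAt_symm (I := I) hzt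
      rwa [I.range_eq_univ] at this
    have d1 : MDifferentiableAt 𝓘(ℝ, E) I (extChartAt I x).symm z := by
      have := (contMDiffOn_extChartAt_symm (I := I) (n := 1) x).contMDiffAt
        ((isOpen_extChartAt_target x).mem_nhds hzt)
      exact this.mdifferentiableAt (by norm_num)
    have d2 : MDifferentiableAt I I' f p := hfz.mdifferentiableAt (by norm_num)
    have d3 : MDifferentiableAt I' 𝓘(ℝ, E') (extChartAt I' (f x)) (f p) :=
      (contMDiffAt_extChartAt' (I := I') (n := 1) (by rw [← extChartAt_source (I := I')]; exact hsz)).mdifferentiableAt (by norm_num)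
    have hgz : fderiv ℝ g z = (mfderiv I' 𝓘(ℝ, E') (extChartAt I' (f x)) (f p)).comp
        ((mfderiv I I' f p).comp (mfderiv 𝓘(ℝ, E) I (extChartAt I x).symm z)) := by
      rw [← mfderiv_eq_fderiv]
      have := mfderiv_comp z (g := extChartAt I' (f x)) (f := f ∘ (extChartAt I x).symm) d3
        (d2.comp z d1)
      rw [mfderiv_comp z d2 d1] at this
      exact this
    have inv2 := mfderivWithin_extChartAt_symm_comp_mfderiv_extChartAt' (I := I') (x := f x) (y := f p) hsz
    have inv3 := mfderiv_extChartAt_comp_mfderivWithin_extChartAt_symm' (I := I') (x := f x) (y := f p) hsz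
    rw [I'.range_eq_univ] at inv2 inv3
    rw [hgz, mpullbackWithin_apply, mpullbackWithin_apply]
    have e1 : (mfderiv 𝓘(ℝ, E) I (extChartAt I x).symm z)
        ((mfderiv[univ] (extChartAt I x).symm z).inverse (U p)) = U p := by
      rw [← mfderivWithin_univ]
      exact inv1.self_apply_inverse _
    have hgz' : g z = extChartAt I' (f x) (f p) := rfl
    have e2 : (extChartAt I' (f x)).symm (g z) = f p := by
      rw [hgz']; exact (extChartAt I' (f x)).left_inv hsz
    have e3 : (mfderiv[univ] (extChartAt I' (f x)).symm (g z)).inverse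
        = mfderiv I' 𝓘(ℝ, E') (extChartAt I' (f x)) (f p) := by
      rw [hgz']
      exact ContinuousLinearMap.inverse_eq inv2 inv3
    have e4 : U' ((extChartAt I' (f x)).symm (g z)) = (U' (f p) : E') := by rw [e2]
    have e5 : (mfderiv I' 𝓘(ℝ, E') (extChartAt I' (f x)) (f p)) ((mfderiv I I' f p)
      ((mfderiv 𝓘(ℝ, E) I (extChartAt I x).symm z)
        ((mfderiv[univ] (extChartAt I x).symm z).inverse (U p))))
      = (mfderiv I' 𝓘(ℝ, E') (extChartAt I' (f x)) (f p)) (U' (f p)) :=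
      congrArg _ ((congrArg _ e1).trans hz)
    refine Eq.trans e5 ?_
    exact (congrArg _ e4.symm).trans (congrArg (fun T : E' →L[ℝ] E' =>
      T (U' ((extChartAt I' (f x)).symm (g z)))) e3.symm)
  rw [hD]
  have aV' := differentiableWithinAt_univ.1 dV'
  have aW' := differentiableWithinAt_univ.1 dW'
  rw [← hgx] at aV' aW'
  have := lieBracket_of_related hgc (differentiableWithinAt_univ.1 dV)
    (differentiableWithinAt_univ.1 dW) aV' aW' (key h1) (key h2)
  rw [hgx] at this
  exact this

end Related
end Finsler

noncomputable section
namespace Finsler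

variable {n : ℕ} {M : Type*} [TopologicalSpace M] [ChartedSpace (EuclideanSpace ℝ (Fin n)) M]
  [IsManifold (𝓡 n) ∞ M]

/-- The vector field `V` on `TM` is smooth on the slit tangent bundle. -/
def IsSmoothVField (V : VField n M) : Prop :=
  ContMDiffOn (𝓡 n).tangent (𝓡 n).tangent.tangent ∞
    (fun u => (⟨u, V u⟩ : TangentBundle (𝓡 n).tangent (TM n M))) (slit n M)

lemma contMDiff_projTM : ContMDiff (𝓡 n).tangent (𝓡 n) ∞ (fun u : TM n M => u.proj) :=
  contMDiff_proj (TangentSpace (𝓡 n))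

lemma contMDiffAt_trivializationAt (x₀ : M) {u : TM n M} (hu : u.proj ∈ (chartAt (EuclideanSpace ℝ (Fin n)) x₀).source) :
    ContMDiffAt (𝓡 n).tangent 𝓘(ℝ, EuclideanSpace ℝ (Fin n)) ∞
      (fun v : TM n M => (trivializationAt (EuclideanSpace ℝ (Fin n)) (TangentSpace (𝓡 n)) x₀ v).2) u := by
  set t := trivializationAt (EuclideanSpace ℝ (Fin n)) (TangentSpace (𝓡 n) : M → Type _) x₀
  have h : ContMDiffOn (𝓡 n).tangent ((𝓡 n).prod 𝓘(ℝ, EuclideanSpace ℝ (Fin n))) ∞ t t.source :=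
    t.contMDiffOn
  have hs : u ∈ t.source := by
    rw [t.mem_source]; exact hu
  exact (contMDiffAt_snd (M := M) (N := EuclideanSpace ℝ (Fin n))).comp u
    ((h u hs).contMDiffAt (t.open_source.mem_nhds hs))

lemma isOpen_slit : IsOpen (slit n M) := by
  rw [isOpen_iff_mem_nhds]
  intro u hu
  set t := trivializationAt (EuclideanSpace ℝ (Fin n)) (TangentSpace (𝓡 n) : M → Type _) u.proj with ht
  have hb : t.baseSet = (chartAt (EuclideanSpace ℝ (Fin n)) u.proj).source :=
    TangentBundle.trivializationAt_baseSet _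
  have key : ∀ v : TM n M, v.proj ∈ t.baseSet → ((t v).2 = 0 ↔ v.snd = 0) := by
    intro v hv
    have e : (t v).2 = t.continuousLinearEquivAt ℝ v.proj hv v.snd := rfl
    rw [e]; exact map_eq_zero_iff _ (Trivialization.continuousLinearEquivAt ℝ t v.proj hv).injective
  have hc := (contMDiffAt_trivializationAt (u := u) u.proj (mem_chart_source _ _)).continuousAt
  have h0 : (t u).2 ≠ 0 := fun h => hu ((key u (by rw [hb]; exact mem_chart_source _ _)).1 h)
  have hp : ∀ᶠ v : TM n M in 𝓝 u, v.proj ∈ t.baseSet :=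
    contMDiff_projTM.continuous.continuousAt.eventually
      (t.open_baseSet.mem_nhds (by rw [hb]; exact mem_chart_source _ _))
  filter_upwards [hc.eventually_ne h0, hp] with v hv hv'
  exact fun h => hv ((key v hv').2 h)

lemma slit_mem_nhds {u : TM n M} (hu : u ∈ slit n M) : slit n M ∈ 𝓝 u := isOpen_slit.mem_nhds hu

/-- Smoothness at a point of a π-vector field, read in the trivialization at `x₀`. -/
lemma contMDiffAt_piField_iff (X : PiField n M) (x₀ : M) {u : TM n M}
    (hu : u.proj ∈ (chartAt (EuclideanSpace ℝ (Fin n)) x₀).source) :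
    ContMDiffAt (𝓡 n).tangent ((𝓡 n).tangent.prod 𝓘(ℝ, EuclideanSpace ℝ (Fin n))) ∞
      (fun u => (⟨u, X u⟩ : TotalSpace (EuclideanSpace ℝ (Fin n)) (PB n M))) u ↔
    ContMDiffAt (𝓡 n).tangent 𝓘(ℝ, EuclideanSpace ℝ (Fin n)) ∞
      (fun v : TM n M => (trivializationAt (EuclideanSpace ℝ (Fin n)) (TangentSpace (𝓡 n)) x₀
        (⟨v.proj, X v⟩ : TM n M)).2) u := by
  set t := trivializationAt (EuclideanSpace ℝ (Fin n)) (TangentSpace (𝓡 n) : M → Type _) x₀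
  have : MemTrivializationAtlas (t.pullback (proj n M)) := ⟨⟨t, inferInstance, rfl⟩⟩
  exact Trivialization.contMDiffAt_section_iff (IB := (𝓡 n).tangent) (E := PB n M)
    (t.pullback (proj n M)) hu

lemma IsSmoothField.contMDiffAt {X : PiField n M} (hX : IsSmoothField X) {u : TM n M}
    (hu : u ∈ slit n M) :
    ContMDiffAt (𝓡 n).tangent ((𝓡 n).tangent.prod 𝓘(ℝ, EuclideanSpace ℝ (Fin n))) ∞
      (fun u => (⟨u, X u⟩ : TotalSpace (EuclideanSpace ℝ (Fin n)) (PB n M))) u :=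
  ContMDiffOn.contMDiffAt hX (slit_mem_nhds hu)

lemma IsSmoothField.mdiffAt {X : PiField n M} (hX : IsSmoothField X) {u : TM n M}
    (hu : u ∈ slit n M) :
    MDifferentiableAt (𝓡 n).tangent ((𝓡 n).tangent.prod 𝓘(ℝ, EuclideanSpace ℝ (Fin n)))
      (fun u => (⟨u, X u⟩ : TotalSpace (EuclideanSpace ℝ (Fin n)) (PB n M))) u :=
  (hX.contMDiffAt hu).mdifferentiableAt (by simp)

lemma IsSmoothFun.contMDiffAt {f : TM n M → ℝ} (hf : IsSmoothFun f) {u : TM n M}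
    (hu : u ∈ slit n M) : ContMDiffAt (𝓡 n).tangent 𝓘(ℝ, ℝ) ∞ f u :=
  ContMDiffOn.contMDiffAt hf (slit_mem_nhds hu)

lemma IsSmoothFun.mdiffAt {f : TM n M → ℝ} (hf : IsSmoothFun f) {u : TM n M}
    (hu : u ∈ slit n M) : MDifferentiableAt (𝓡 n).tangent 𝓘(ℝ, ℝ) f u :=
  (hf.contMDiffAt hu).mdifferentiableAt (by simp)

lemma IsSmoothVField.contMDiffAt {V : VField n M} (hV : IsSmoothVField V) {u : TM n M}
    (hu : u ∈ slit n M) :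
    ContMDiffAt (𝓡 n).tangent (𝓡 n).tangent.tangent ∞
      (fun u => (⟨u, V u⟩ : TangentBundle (𝓡 n).tangent (TM n M))) u :=
  ContMDiffOn.contMDiffAt hV (slit_mem_nhds hu)

lemma IsSmoothVField.mdiffAt {V : VField n M} (hV : IsSmoothVField V) {u : TM n M}
    (hu : u ∈ slit n M) :
    MDifferentiableAt (𝓡 n).tangent (𝓡 n).tangent.tangent
      (fun u => (⟨u, V u⟩ : TangentBundle (𝓡 n).tangent (TM n M))) u :=
  (hV.contMDiffAt hu).mdifferentiableAt (by simp)

/-! ### Algebra of smooth fields and functions -/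

lemma IsSmoothField.add {X Y : PiField n M} (hX : IsSmoothField X) (hY : IsSmoothField Y) :
    IsSmoothField (X + Y) := ContMDiffOn.add_section hX hY

lemma IsSmoothField.sub {X Y : PiField n M} (hX : IsSmoothField X) (hY : IsSmoothField Y) :
    IsSmoothField (X - Y) := ContMDiffOn.sub_section hX hY

lemma IsSmoothField.neg {X : PiField n M} (hX : IsSmoothField X) :
    IsSmoothField (-X) := ContMDiffOn.neg_section hX

lemma IsSmoothField.smul {f : TM n M → ℝ} {X : PiField n M} (hf : IsSmoothFun f)
    (hX : IsSmoothField X) : IsSmoothField (f • X) := ContMDiffOn.smul_section hf hX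

lemma IsSmoothField.sum {ι : Type*} {s : Finset ι} {X : ι → PiField n M}
    (hX : ∀ i ∈ s, IsSmoothField (X i)) : IsSmoothField (fun u => ∑ i ∈ s, X i u) :=
  ContMDiffOn.sum_section (t := fun i u => X i u) (fun i hi => hX i hi)

lemma IsSmoothField.congr {X Y : PiField n M} (hX : IsSmoothField X)
    (h : ∀ u ∈ slit n M, Y u = X u) : IsSmoothField Y :=
  ContMDiffOn.congr hX fun u hu => by rw [h u hu]

lemma IsSmoothFun.congr {f g : TM n M → ℝ} (hf : IsSmoothFun f)
    (h : ∀ u ∈ slit n M, g u = f u) : IsSmoothFun g :=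
  ContMDiffOn.congr hf h

lemma IsSmoothFun.const (c : ℝ) : IsSmoothFun (fun _ : TM n M => c) := contMDiffOn_const

lemma IsSmoothFun.add {f g : TM n M → ℝ} (hf : IsSmoothFun f) (hg : IsSmoothFun g) :
    IsSmoothFun (fun u => f u + g u) := ContMDiffOn.add hf hg

lemma IsSmoothFun.sub {f g : TM n M → ℝ} (hf : IsSmoothFun f) (hg : IsSmoothFun g) :
    IsSmoothFun (fun u => f u - g u) := ContMDiffOn.sub hf hg

lemma IsSmoothFun.mul {f g : TM n M → ℝ} (hf : IsSmoothFun f) (hg : IsSmoothFun g) :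
    IsSmoothFun (fun u => f u * g u) := ContMDiffOn.mul hf hg

lemma IsSmoothFun.sum {ι : Type*} {s : Finset ι} {f : ι → TM n M → ℝ}
    (hf : ∀ i ∈ s, IsSmoothFun (f i)) : IsSmoothFun (fun u => ∑ i ∈ s, f i u) :=
  contMDiffOn_finsetSum hf

lemma isSmoothFun_of_local {f : TM n M → ℝ}
    (h : ∀ u ∈ slit n M, ∃ g : TM n M → ℝ, IsSmoothFun g ∧ ∀ᶠ v in 𝓝 u, f v = g v) :
    IsSmoothFun f := by
  intro u hu
  obtain ⟨Y, hY, he⟩ := h u hu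
  exact ((hY.contMDiffAt hu).congr_of_eventuallyEq he).contMDiffWithinAt

/-! ### Basic fields and frames -/

/-- The basic π-vector field induced by a vector field on `M`. -/
def basic (X : Π x : M, TangentSpace (𝓡 n) x) : PiField n M := fun u => X u.proj

lemma isSmoothField_basic {X : Π x : M, TangentSpace (𝓡 n) x}
    (hX : ContMDiff (𝓡 n) (𝓡 n).tangent ∞ (fun x => (⟨x, X x⟩ : TangentBundle (𝓡 n) M))) :
    IsSmoothField (basic X) := by
  intro u _
  refine ContMDiffAt.contMDiffWithinAt ?_
  rw [contMDiffAt_piField_iff _ u.proj (mem_chart_source _ _)]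
  have h := (contMDiffAt_trivializationAt (u := (⟨u.proj, X u.proj⟩ : TM n M)) u.proj
    (mem_chart_source _ _))
  exact ContMDiffAt.comp (g := fun v : TM n M =>
      (trivializationAt (EuclideanSpace ℝ (Fin n)) (TangentSpace (𝓡 n)) u.proj v).2)
    (f := fun v : TM n M => (⟨v.proj, X v.proj⟩ : TM n M)) u h
    ((hX u.proj).comp u (contMDiff_projTM u))

lemma isSmoothField_eta : IsSmoothField (eta : PiField n M) := by
  intro u _
  refine ContMDiffAt.contMDiffWithinAt ?_
  rw [contMDiffAt_piField_iff _ u.proj (mem_chart_source _ _)]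
  exact contMDiffAt_trivializationAt u.proj (mem_chart_source _ _)

section Frames

variable [T2Space M]

/-- A cutoff function around `x₀`. -/
def cutoff (n : ℕ) {M : Type*} [TopologicalSpace M] [ChartedSpace (EuclideanSpace ℝ (Fin n)) M]
    (x₀ : M) : SmoothBumpFunction (𝓡 n) x₀ := Classical.choice inferInstance

/-- A neighbourhood of `x₀` on which the cutoff function is constant one. -/
def dom (n : ℕ) {M : Type*} [TopologicalSpace M] [ChartedSpace (EuclideanSpace ℝ (Fin n)) M]
    (x₀ : M) : Set M := {x | ∀ᶠ y in 𝓝 x, cutoff n x₀ y = 1}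

/-- The coordinate frame around `x₀`, cut off, as vector fields on `M`. -/
def baseFrame (x₀ : M) (i : Fin n) : Π x : M, TangentSpace (𝓡 n) x := fun x =>
  cutoff n x₀ x • (trivializationAt (EuclideanSpace ℝ (Fin n)) (TangentSpace (𝓡 n)) x₀).symmL ℝ x
    (EuclideanSpace.single i (1 : ℝ))

/-- The coordinate frame around `x₀`, cut off, as π-vector fields. -/
def fr (x₀ : M) (i : Fin n) : PiField n M := basic (baseFrame x₀ i)

/-- The dual coframe, cut off. -/
def cofr (x₀ : M) (i : Fin n) : OneForm n M := fun u =>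
  cutoff n x₀ u.proj • (EuclideanSpace.proj i : EuclideanSpace ℝ (Fin n) →L[ℝ] ℝ).comp
    ((trivializationAt (EuclideanSpace ℝ (Fin n)) (TangentSpace (𝓡 n)) x₀).continuousLinearMapAt
      ℝ u.proj)

lemma mem_dom (x₀ : M) : x₀ ∈ dom n x₀ := (cutoff n x₀).eventuallyEq_one

lemma isOpen_dom (x₀ : M) : IsOpen (dom n x₀) := isOpen_setOfPred_eventually_nhds

lemma cutoff_eq_one {x₀ x : M} (hx : x ∈ dom n x₀) : cutoff n x₀ x = 1 :=
  Filter.Eventually.self_of_nhds (p := fun y => cutoff n x₀ y = 1) hx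

lemma dom_subset (x₀ : M) : dom n x₀ ⊆ (chartAt (EuclideanSpace ℝ (Fin n)) x₀).source := by
  intro x hx
  by_contra h
  have := cutoff_eq_one hx
  have h2 : cutoff n x₀ x = 0 := by
    rw [SmoothBumpFunction.coe_def, indicator_of_notMem h]
  rw [h2] at this
  exact zero_ne_one this

lemma fr_of_mem {x₀ : M} {u : TM n M} (hu : u.proj ∈ dom n x₀) (j : Fin n) :
    fr x₀ j u = (trivializationAt (EuclideanSpace ℝ (Fin n)) (TangentSpace (𝓡 n)) x₀).symmL ℝ u.proj
      (EuclideanSpace.single j (1 : ℝ)) := by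
  have h : ∀ w : TangentSpace (𝓡 n) u.proj, cutoff n x₀ u.proj • w = w := fun w => by
    rw [cutoff_eq_one hu, one_smul]
  exact h _

lemma cofr_apply (x₀ : M) (i : Fin n) (u : TM n M) (w : PB n M u) :
    cofr x₀ i u w = cutoff n x₀ u.proj *
      ((trivializationAt (EuclideanSpace ℝ (Fin n)) (TangentSpace (𝓡 n)) x₀).continuousLinearMapAt
        ℝ u.proj w) i := rfl

lemma contMDiff_baseFrame (x₀ : M) (i : Fin n) : ContMDiff (𝓡 n) (𝓡 n).tangent ∞
    (fun x => (⟨x, baseFrame x₀ i x⟩ : TangentBundle (𝓡 n) M)) := by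
  set t := trivializationAt (EuclideanSpace ℝ (Fin n)) (TangentSpace (𝓡 n) : M → Type _) x₀ with ht
  have hb : t.baseSet = (chartAt (EuclideanSpace ℝ (Fin n)) x₀).source :=
    TangentBundle.trivializationAt_baseSet _
  refine ContMDiffOn.smul_section_of_tsupport (u := t.baseSet)
    (ψ := cutoff n x₀) (s := fun x => t.symmL ℝ x (EuclideanSpace.single i (1 : ℝ)))
    (cutoff n x₀).contMDiff.contMDiffOn t.open_baseSet
    (by rw [hb]; exact (cutoff n x₀).tsupport_subset_chartAt_source) ?_
  rw [t.contMDiffOn_section_baseSet_iff]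
  refine (contMDiffOn_const (c := EuclideanSpace.single i (1 : ℝ))).congr ?_
  intro y hy
  have := t.continuousLinearMapAt_symmL (R := ℝ) hy (EuclideanSpace.single i (1 : ℝ))
  exact (t.continuousLinearMapAt_apply_of_mem (R := ℝ) hy _).symm.trans this

lemma isSmoothField_fr (x₀ : M) (i : Fin n) : IsSmoothField (fr x₀ i) :=
  isSmoothField_basic (contMDiff_baseFrame x₀ i)

lemma cofr_fr {x₀ : M} {u : TM n M} (hu : u.proj ∈ dom n x₀) (i j : Fin n) :
    cofr x₀ i u (fr x₀ j u) = if i = j then 1 else 0 := by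
  set t := trivializationAt (EuclideanSpace ℝ (Fin n)) (TangentSpace (𝓡 n) : M → Type _) x₀ with ht
  have h1 := cutoff_eq_one hu
  have hb : u.proj ∈ t.baseSet := dom_subset x₀ hu
  have e : Trivialization.continuousLinearMapAt ℝ t u.proj (Trivialization.symmL ℝ t u.proj (EuclideanSpace.single j (1 : ℝ)))
      = EuclideanSpace.single j (1 : ℝ) := t.continuousLinearMapAt_symmL hb _
  have e1 : fr x₀ j u = Trivialization.symmL ℝ t u.proj (EuclideanSpace.single j (1 : ℝ)) := fr_of_mem hu _
  have e2 : ∀ w, cofr x₀ i u w = (Trivialization.continuousLinearMapAt ℝ t u.proj w) i := by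
    intro w
    rw [cofr_apply, h1, one_mul]
  rw [e2, e1]
  refine (congrArg (fun v : EuclideanSpace ℝ (Fin n) => v i) e).trans ?_
  simp

lemma sum_cofr_smul_fr {x₀ : M} {u : TM n M} (hu : u.proj ∈ dom n x₀) (w : PB n M u) :
    w = ∑ i, cofr x₀ i u w • fr x₀ i u := by
  set t := trivializationAt (EuclideanSpace ℝ (Fin n)) (TangentSpace (𝓡 n) : M → Type _) x₀ with ht
  have h1 := cutoff_eq_one hu
  have hb : u.proj ∈ t.baseSet := dom_subset x₀ hu
  have e1 : ∀ j, fr x₀ j u = Trivialization.symmL ℝ t u.proj (EuclideanSpace.single j (1 : ℝ)) := by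
    intro j
    exact fr_of_mem hu _
  have e2 : ∀ i w, cofr x₀ i u w = (Trivialization.continuousLinearMapAt ℝ t u.proj w) i := by
    intro i w
    rw [cofr_apply, h1, one_mul]
  simp only [e1, e2]
  have e3 : w = Trivialization.symmL ℝ t u.proj (Trivialization.continuousLinearMapAt ℝ t u.proj w) :=
    (t.symmL_continuousLinearMapAt hb w).symm
  have e4 : (Trivialization.continuousLinearMapAt ℝ t u.proj w) = ∑ i, (Trivialization.continuousLinearMapAt ℝ t u.proj w) i •
      EuclideanSpace.single i (1 : ℝ) := by
    have := (EuclideanSpace.basisFun (Fin n) ℝ).sum_repr (Trivialization.continuousLinearMapAt ℝ t u.proj w)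
    simpa using this.symm
  refine e3.trans ?_
  refine (congrArg (Trivialization.symmL ℝ t u.proj) e4).trans ?_
  rw [map_sum]
  simp only [map_smul]
  rfl

lemma contMDiffAt_cofr (x₀ : M) (i : Fin n) {X : PiField n M} {u : TM n M}
    (hX : ContMDiffAt (𝓡 n).tangent ((𝓡 n).tangent.prod 𝓘(ℝ, EuclideanSpace ℝ (Fin n))) ∞
      (fun u => (⟨u, X u⟩ : TotalSpace (EuclideanSpace ℝ (Fin n)) (PB n M))) u) :
    ContMDiffAt (𝓡 n).tangent 𝓘(ℝ, ℝ) ∞ (fun u => cofr x₀ i u (X u)) u := by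
  set t := trivializationAt (EuclideanSpace ℝ (Fin n)) (TangentSpace (𝓡 n) : M → Type _) x₀ with ht
  by_cases hs : u.proj ∈ tsupport (cutoff n x₀)
  · have hsrc := (cutoff n x₀).tsupport_subset_chartAt_source hs
    have h1 := (contMDiffAt_piField_iff X x₀ hsrc).1 hX
    have h2 : ContMDiffAt (𝓡 n).tangent 𝓘(ℝ, ℝ) ∞ (fun v : TM n M => cutoff n x₀ v.proj) u :=
      (cutoff n x₀).contMDiff.contMDiffAt.comp u (contMDiff_projTM u)
    have h3 : ContMDiffAt (𝓡 n).tangent 𝓘(ℝ, ℝ) ∞ (fun v : TM n M =>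
        (t (⟨v.proj, X v⟩ : TM n M)).2 i) u :=
      (EuclideanSpace.proj i : EuclideanSpace ℝ (Fin n) →L[ℝ] ℝ).contMDiff.contMDiffAt.comp u h1
    refine (h2.mul h3).congr_of_eventuallyEq ?_
    have : ∀ᶠ v : TM n M in 𝓝 u, v.proj ∈ (chartAt (EuclideanSpace ℝ (Fin n)) x₀).source :=
      contMDiff_projTM.continuous.continuousAt.eventually
        ((chartAt (EuclideanSpace ℝ (Fin n)) x₀).open_source.mem_nhds hsrc)
    filter_upwards [this] with v hv
    rw [cofr_apply]
    have e := t.continuousLinearMapAt_apply_of_mem (R := ℝ) (b := v.proj) hv (X v)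
    exact congrArg (fun w : EuclideanSpace ℝ (Fin n) => cutoff n x₀ v.proj * w i) e
  · refine (contMDiffAt_const (c := (0 : ℝ))).congr_of_eventuallyEq ?_
    have : ∀ᶠ v : TM n M in 𝓝 u, v.proj ∈ (tsupport (cutoff n x₀))ᶜ :=
      contMDiff_projTM.continuous.continuousAt.eventually
        ((isClosed_tsupport _).isOpen_compl.mem_nhds hs)
    filter_upwards [this] with v hv
    rw [cofr_apply, image_eq_zero_of_notMem_tsupport hv, zero_mul]

lemma isSmoothFun_cofr (x₀ : M) (i : Fin n) {X : PiField n M} (hX : IsSmoothField X) :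
    IsSmoothFun (fun u => cofr x₀ i u (X u)) := fun _ hu =>
  (contMDiffAt_cofr x₀ i (hX.contMDiffAt hu)).contMDiffWithinAt

end Frames

end Finsler
end

noncomputable section
namespace Finsler

variable {n : ℕ} {M : Type*} [TopologicalSpace M] [ChartedSpace (EuclideanSpace ℝ (Fin n)) M]
  [IsManifold (𝓡 n) ∞ M]

/-! ### Fibres and dilations -/

/-- The inclusion of the fibre of `TM` over `x`. -/
def incl (x : M) (v : EuclideanSpace ℝ (Fin n)) : TM n M := ⟨x, v⟩

/-- The dilation of the tangent bundle by the factor `c`. -/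
def dil (c : ℝ) (u : TM n M) : TM n M := ⟨u.proj, c • u.snd⟩

lemma contMDiff_incl (x : M) :
    ContMDiff 𝓘(ℝ, EuclideanSpace ℝ (Fin n)) (𝓡 n).tangent ∞ (incl x : _ → TM n M) := by
  intro v
  rw [contMDiffAt_totalSpace]
  refine ⟨contMDiffAt_const, ?_⟩
  set t := trivializationAt (EuclideanSpace ℝ (Fin n)) (TangentSpace (𝓡 n) : M → Type _) x with ht
  have hx : x ∈ t.baseSet := mem_chart_source _ _
  let T : EuclideanSpace ℝ (Fin n) →L[ℝ] EuclideanSpace ℝ (Fin n) :=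
    Trivialization.continuousLinearMapAt ℝ t x
  have e : (fun w : EuclideanSpace ℝ (Fin n) => (t (incl x w)).2) = T := by
    funext w
    exact (t.continuousLinearMapAt_apply_of_mem (R := ℝ) hx w).symm
  exact e ▸ T.contMDiff.contMDiffAt

lemma contMDiff_dil (c : ℝ) : ContMDiff (𝓡 n).tangent (𝓡 n).tangent ∞ (dil c : TM n M → TM n M) := by
  intro u
  rw [contMDiffAt_totalSpace]
  refine ⟨contMDiff_projTM u, ?_⟩
  set t := trivializationAt (EuclideanSpace ℝ (Fin n)) (TangentSpace (𝓡 n) : M → Type _) u.proj with ht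
  have hx : u.proj ∈ t.baseSet := mem_chart_source _ _
  have h := contMDiffAt_trivializationAt (u := u) u.proj hx
  refine ((contMDiffAt_const (I := (𝓡 n).tangent) (I' := 𝓘(ℝ, ℝ)) (c := c)).smul h).congr_of_eventuallyEq ?_
  have : ∀ᶠ v : TM n M in 𝓝 u, v.proj ∈ t.baseSet :=
    contMDiff_projTM.continuous.continuousAt.eventually (t.open_baseSet.mem_nhds hx)
  filter_upwards [this] with v hv
  have e1 := t.continuousLinearMapAt_apply_of_mem (R := ℝ) (b := v.proj) hv v.snd
  have e2 := t.continuousLinearMapAt_apply_of_mem (R := ℝ) (b := v.proj) hv (c • v.snd)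
  refine e2.symm.trans ((map_smul (Trivialization.continuousLinearMapAt ℝ t v.proj) c _).trans ?_)
  exact congrArg (c • ·) e1

lemma dil_mem_slit {c : ℝ} (hc : c ≠ 0) {u : TM n M} (hu : u ∈ slit n M) : dil c u ∈ slit n M := by
  have : c • u.snd ≠ 0 := smul_ne_zero hc hu
  exact this

/-- The differential of the dilation by `c`. -/
def ddil (c : ℝ) (u : TM n M) :
    TangentSpace (𝓡 n).tangent u →L[ℝ] TangentSpace (𝓡 n).tangent (dil c u) :=
  mfderiv (𝓡 n).tangent (𝓡 n).tangent (dil c) u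

lemma mdiffAt_dil (c : ℝ) (u : TM n M) :
    MDifferentiableAt (𝓡 n).tangent (𝓡 n).tangent (dil c : TM n M → TM n M) u :=
  (contMDiff_dil c u).mdifferentiableAt (by simp)

lemma rho_ddil (c : ℝ) (u : TM n M) (w : TangentSpace (𝓡 n).tangent u) :
    (rho (dil c u) (ddil c u w) : EuclideanSpace ℝ (Fin n)) = rho u w := by
  have h := mfderiv_comp u ((contMDiff_projTM (dil c u)).mdifferentiableAt (by simp)) (mdiffAt_dil c u)
  exact (congrArg (fun T => T w) h).symm

/-- The differential of the inclusion of a fibre. -/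
def dincl (x : M) (v : EuclideanSpace ℝ (Fin n)) :
    EuclideanSpace ℝ (Fin n) →L[ℝ] TangentSpace (𝓡 n).tangent (incl x v : TM n M) :=
  mfderiv 𝓘(ℝ, EuclideanSpace ℝ (Fin n)) (𝓡 n).tangent (incl x) v

lemma mdiffAt_incl (x : M) (v : EuclideanSpace ℝ (Fin n)) :
    MDifferentiableAt 𝓘(ℝ, EuclideanSpace ℝ (Fin n)) (𝓡 n).tangent (incl x : _ → TM n M) v :=
  (contMDiff_incl x v).mdifferentiableAt (by simp)

lemma gamma_eq_dincl (x : M) (v X : EuclideanSpace ℝ (Fin n)) :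
    gamma (incl x v : TM n M) X = dincl x v X := by
  let a : ℝ → EuclideanSpace ℝ (Fin n) := fun t => v + t • X
  have ha : HasDerivAt a X 0 := by
    have h : HasDerivAt a ((1 : ℝ) • X) 0 := ((hasDerivAt_id (0:ℝ)).smul_const X).const_add v
    rwa [one_smul] at h
  have ha0 : a 0 = v := by simp [a]
  have h := mfderiv_comp (0:ℝ) (mdiffAt_incl (n := n) x (a 0)) ha.differentiableAt.mdifferentiableAt
  have h3 : mfderiv 𝓘(ℝ, ℝ) 𝓘(ℝ, EuclideanSpace ℝ (Fin n)) a 0 (1:ℝ) = X := by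
    rw [mfderiv_eq_fderiv]
    exact (fderiv_apply_one_eq_deriv).trans ha.deriv
  have h2 : gamma (incl x v : TM n M) X = dincl x (a 0)
      (mfderiv 𝓘(ℝ, ℝ) 𝓘(ℝ, EuclideanSpace ℝ (Fin n)) a 0 (1:ℝ)) :=
    congrArg (fun T : ℝ →L[ℝ] EuclideanSpace ℝ (Fin n) × EuclideanSpace ℝ (Fin n) => T (1:ℝ)) h
  refine h2.trans ((congrArg _ h3).trans ?_)
  rw [ha0]

lemma gamma_eq (u : TM n M) (X : PB n M u) :
    gamma u X = dincl u.proj ((fib u).symm u.snd) ((fib u).symm X) :=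
  gamma_eq_dincl u.proj _ _

lemma gamma_smul (u : TM n M) (c : ℝ) (X : PB n M u) : gamma u (c • X) = c • gamma u X := by
  rw [gamma_eq, gamma_eq]
  exact map_smul (dincl u.proj _) c _

lemma rho_gamma (u : TM n M) (X : PB n M u) : rho u (gamma u X) = 0 := by
  rw [gamma_eq]
  have h := mfderiv_comp ((fib u).symm u.snd)
    ((contMDiff_projTM (incl u.proj ((fib u).symm u.snd))).mdifferentiableAt (by simp))
    (mdiffAt_incl u.proj ((fib u).symm u.snd))
  have h0 : mfderiv 𝓘(ℝ, EuclideanSpace ℝ (Fin n)) (𝓡 n)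
    ((fun u : TM n M => u.proj) ∘ (incl u.proj : _ → TM n M)) ((fib u).symm u.snd) = 0 :=
    mfderiv_const
  rw [h0] at h
  exact (congrArg (fun T : EuclideanSpace ℝ (Fin n) →L[ℝ] EuclideanSpace ℝ (Fin n) =>
    T ((fib u).symm X)) h).symm

lemma ddil_dincl (c : ℝ) (x : M) (v X : EuclideanSpace ℝ (Fin n)) :
    ddil c (incl x v : TM n M) (dincl x v X) = dincl x (c • v) (c • X) := by
  have h := mfderiv_comp v (mdiffAt_dil c (incl x v : TM n M)) (mdiffAt_incl x v)
  let m : EuclideanSpace ℝ (Fin n) →L[ℝ] EuclideanSpace ℝ (Fin n) := c • ContinuousLinearMap.id ℝ _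
  have h2 := mfderiv_comp v (mdiffAt_incl (n := n) x (m v))
    (m.contMDiff.contMDiffAt.mdifferentiableAt (n := ∞) (by simp))
  have h3 : mfderiv 𝓘(ℝ, EuclideanSpace ℝ (Fin n)) 𝓘(ℝ, EuclideanSpace ℝ (Fin n)) m v = m := by
    rw [mfderiv_eq_fderiv]; exact m.fderiv
  have e : (dil c ∘ (incl x : _ → TM n M)) = (incl x : _ → TM n M) ∘ m := rfl
  rw [e, h2, h3] at h
  exact (congrArg (fun T : EuclideanSpace ℝ (Fin n) →L[ℝ] EuclideanSpace ℝ (Fin n) ×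
    EuclideanSpace ℝ (Fin n) => T X) h).symm

lemma ddil_gamma (c : ℝ) (u : TM n M) (X : PB n M u) :
    ddil c u (gamma u X) = gamma (dil c u) (c • (fib u).symm X) := by
  rw [gamma_eq]
  refine (ddil_dincl c u.proj _ _).trans ?_
  exact (gamma_eq_dincl u.proj _ _).symm

lemma mvfderiv_gamma {f : TM n M → ℝ} {u : TM n M}
    (hf : MDifferentiableAt (𝓡 n).tangent 𝓘(ℝ, ℝ) f u) (X : PB n M u) :
    mvfderiv (𝓡 n).tangent f u (gamma u X) =
      fderiv ℝ (fun v => f (incl u.proj v)) ((fib u).symm u.snd) ((fib u).symm X) := by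
  rw [gamma_eq]
  have h := mfderiv_comp ((fib u).symm u.snd) (g := f) hf (mdiffAt_incl u.proj ((fib u).symm u.snd))
  have h0 := mfderiv_eq_fderiv (𝕜 := ℝ) (f := fun v => f (incl u.proj v)) (x := (fib u).symm u.snd)
  exact (congrArg (fun T : EuclideanSpace ℝ (Fin n) →L[ℝ] ℝ =>
    T ((fib u).symm X)) (h0.symm.trans h)).symm

lemma mvfderiv_dil {f : TM n M → ℝ} {c : ℝ} {u : TM n M}
    (hf : MDifferentiableAt (𝓡 n).tangent 𝓘(ℝ, ℝ) f (dil c u)) (w : TangentSpace (𝓡 n).tangent u) :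
    mvfderiv (𝓡 n).tangent f (dil c u) (ddil c u w) =
      mvfderiv (𝓡 n).tangent (fun v => f (dil c v)) u w :=
  (mvfderiv_comp_apply u hf (mdiffAt_dil c u) w).symm

end Finsler
end

noncomputable section
namespace Finsler

variable {n : ℕ} {M : Type*} [TopologicalSpace M] [ChartedSpace (EuclideanSpace ℝ (Fin n)) M]
  [IsManifold (𝓡 n) ∞ M]

/-! ### The Finsler metric -/

/-- The energy `½ L²` on the fibre over `x`. -/
def energy (L : TM n M → ℝ) (x : M) (v : EuclideanSpace ℝ (Fin n)) : ℝ :=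
  (1 / 2 : ℝ) * L (incl x v) ^ 2

/-- The Finsler metric as a bilinear form on the fibre over `x`. -/
def metricAt (L : TM n M → ℝ) (x : M) (v : EuclideanSpace ℝ (Fin n)) :
    EuclideanSpace ℝ (Fin n) →L[ℝ] EuclideanSpace ℝ (Fin n) →L[ℝ] ℝ :=
  fderiv ℝ (fderiv ℝ (energy L x)) v

lemma metric_eq (L : TM n M → ℝ) (u : TM n M) (X Y : PB n M u) :
    metric L u X Y = metricAt L u.proj ((fib u).symm u.snd) ((fib u).symm X) ((fib u).symm Y) := rfl

variable {L : TM n M → ℝ}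

lemma contDiffAt_energy (hL : IsFinsler L) (x : M) {v : EuclideanSpace ℝ (Fin n)} (hv : v ≠ 0) :
    ContDiffAt ℝ ∞ (energy L x) v := by
  have hu : (incl x v : TM n M) ∈ slit n M := hv
  have h := (IsSmoothFun.contMDiffAt hL.smooth hu).comp v (contMDiff_incl x v)
  exact contDiffAt_const.mul (h.contDiffAt.pow 2)

lemma contDiffAt_fderiv_energy (hL : IsFinsler L) (x : M) {v : EuclideanSpace ℝ (Fin n)}
    (hv : v ≠ 0) : ContDiffAt ℝ ∞ (fderiv ℝ (energy L x)) v :=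
  (contDiffAt_energy hL x hv).fderiv_right (by simp)

lemma contDiffAt_metricAt (hL : IsFinsler L) (x : M) {v : EuclideanSpace ℝ (Fin n)} (hv : v ≠ 0) :
    ContDiffAt ℝ ∞ (metricAt L x) v :=
  (contDiffAt_fderiv_energy hL x hv).fderiv_right (by simp)

lemma minSmoothness_two_le_infty : minSmoothness ℝ 2 ≤ ∞ := by
  rw [minSmoothness_of_isRCLikeNormedField]
  exact WithTop.coe_le_coe.2 (le_top : (2 : ℕ∞) ≤ ⊤)

lemma metricAt_symm (hL : IsFinsler L) (x : M) {v : EuclideanSpace ℝ (Fin n)} (hv : v ≠ 0)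
    (X Y : EuclideanSpace ℝ (Fin n)) : metricAt L x v X Y = metricAt L x v Y X :=
  ((contDiffAt_energy hL x hv).isSymmSndFDerivAt minSmoothness_two_le_infty).eq X Y

/-- The third vertical derivative of the energy. -/
def thirdDeriv (L : TM n M → ℝ) (x : M) (v X Y Z : EuclideanSpace ℝ (Fin n)) : ℝ :=
  fderiv ℝ (metricAt L x) v X Y Z

lemma thirdDeriv_symm_left (hL : IsFinsler L) (x : M) {v : EuclideanSpace ℝ (Fin n)} (hv : v ≠ 0)
    (X Y Z : EuclideanSpace ℝ (Fin n)) : thirdDeriv L x v X Y Z = thirdDeriv L x v Y X Z :=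
  congrArg (fun T => T Z)
    (((contDiffAt_fderiv_energy hL x hv).isSymmSndFDerivAt minSmoothness_two_le_infty).eq X Y)

lemma fderiv_metricAt_apply (hL : IsFinsler L) (x : M) {v : EuclideanSpace ℝ (Fin n)} (hv : v ≠ 0)
    (X Y Z : EuclideanSpace ℝ (Fin n)) :
    fderiv ℝ (fun w => metricAt L x w Y Z) v X = thirdDeriv L x v X Y Z := by
  have hd : DifferentiableAt ℝ (metricAt L x) v :=
    (contDiffAt_metricAt hL x hv).differentiableAt (by simp)
  have h1 := (hd.hasFDerivAt.clm_apply (hasFDerivAt_const Y v)).clm_apply (hasFDerivAt_const Z v)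
  rw [h1.fderiv]
  simp [thirdDeriv]

lemma thirdDeriv_symm_right (hL : IsFinsler L) (x : M) {v : EuclideanSpace ℝ (Fin n)} (hv : v ≠ 0)
    (X Y Z : EuclideanSpace ℝ (Fin n)) : thirdDeriv L x v X Y Z = thirdDeriv L x v X Z Y := by
  rw [← fderiv_metricAt_apply hL x hv, ← fderiv_metricAt_apply hL x hv]
  congr 1
  apply Filter.EventuallyEq.fderiv_eq
  filter_upwards [isOpen_ne.mem_nhds hv] with w hw
  exact metricAt_symm hL x hw Y Z

lemma energy_smul (hL : IsFinsler L) (x : M) (v : EuclideanSpace ℝ (Fin n)) {c : ℝ} (hc : 0 < c) :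
    energy L x (c • v) = c ^ 2 * energy L x v := by
  have h : L (incl x (c • v)) = c * L (incl x v) := hL.homogeneous x v c hc
  rw [energy, energy, h]
  ring

lemma fderiv_smul_of_homogeneous {E F : Type*} [NormedAddCommGroup E] [NormedSpace ℝ E]
    [NormedAddCommGroup F] [NormedSpace ℝ F] {f : E → F} {c d : ℝ} (hc : c ≠ 0)
    (h : ∀ w, f (c • w) = (c * d) • f w) (v : E) : fderiv ℝ f (c • v) = d • fderiv ℝ f v := by
  have h1 : (fun w => f (c • w)) = (c * d) • f := funext h
  have h3 : c • fderiv ℝ f (c • v) = (c * d) • fderiv ℝ f v :=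
    (fderiv_comp_smul c).symm.trans
      ((congrArg (fun f => fderiv ℝ f v) h1).trans (congrFun (fderiv_const_smul_field _) v))
  rw [mul_smul] at h3
  exact smul_right_injective _ hc h3

lemma fderiv_energy_smul (hL : IsFinsler L) (x : M) (v : EuclideanSpace ℝ (Fin n)) {c : ℝ}
    (hc : 0 < c) : fderiv ℝ (energy L x) (c • v) = c • fderiv ℝ (energy L x) v :=
  fderiv_smul_of_homogeneous hc.ne' (fun w => by
    rw [energy_smul hL x w hc, sq, smul_eq_mul]) v

lemma metricAt_smul (hL : IsFinsler L) (x : M) (v : EuclideanSpace ℝ (Fin n)) {c : ℝ}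
    (hc : 0 < c) : metricAt L x (c • v) = metricAt L x v :=
  (fderiv_smul_of_homogeneous (d := 1) hc.ne' (fun w => by
    rw [fderiv_energy_smul hL x w hc, mul_one]) v).trans (one_smul ℝ _)

lemma thirdDeriv_self_left (hL : IsFinsler L) (x : M) {v : EuclideanSpace ℝ (Fin n)} (hv : v ≠ 0)
    (Y Z : EuclideanSpace ℝ (Fin n)) : thirdDeriv L x v v Y Z = 0 := by
  let h : EuclideanSpace ℝ (Fin n) → ℝ := fun w => metricAt L x w Y Z
  have hd : HasFDerivAt h (fderiv ℝ h v) v :=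
    (((contDiffAt_metricAt hL x hv).clm_apply contDiffAt_const).clm_apply
      contDiffAt_const).differentiableAt (by simp) |>.hasFDerivAt
  have ha : HasDerivAt (fun t : ℝ => t • v) v 1 := by
    have h : HasDerivAt (fun t : ℝ => t • v) ((1 : ℝ) • v) 1 := (hasDerivAt_id (1:ℝ)).smul_const v
    rwa [one_smul] at h
  have h1 : HasDerivAt (fun t : ℝ => h (t • v)) (fderiv ℝ h v v) 1 := by
    refine HasFDerivAt.comp_hasDerivAt (1 : ℝ) (l := h) (f := fun t : ℝ => t • v) ?_ ha
    simpa using hd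
  have h2 : HasDerivAt (fun t : ℝ => h (t • v)) 0 1 := by
    refine (hasDerivAt_const (1 : ℝ) (h v)).congr_of_eventuallyEq ?_
    filter_upwards [lt_mem_nhds (zero_lt_one (α := ℝ))] with t ht
    exact congrArg (fun T => T Y Z) (metricAt_smul hL x v ht)
  rw [← fderiv_metricAt_apply hL x hv]
  exact h1.unique h2

lemma metric_symm (hL : IsFinsler L) {u : TM n M} (hu : u ∈ slit n M) (X Y : PB n M u) :
    metric L u X Y = metric L u Y X := metricAt_symm hL u.proj hu X Y

lemma metric_add_left (u : TM n M) (X Y Z : PB n M u) :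
    metric L u (X + Y) Z = metric L u X Z + metric L u Y Z := by
  simp only [metric_eq]
  rw [map_add, map_add]; rfl

lemma metric_add_right (u : TM n M) (X Y Z : PB n M u) :
    metric L u X (Y + Z) = metric L u X Y + metric L u X Z := by
  simp only [metric_eq]
  rw [map_add, map_add]

lemma metric_smul_left (u : TM n M) (c : ℝ) (X Z : PB n M u) :
    metric L u (c • X) Z = c * metric L u X Z := by
  simp only [metric_eq]
  rw [map_smul, map_smul]; rfl

lemma metric_smul_right (u : TM n M) (c : ℝ) (X Z : PB n M u) :
    metric L u X (c • Z) = c * metric L u X Z := by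
  simp only [metric_eq]
  rw [map_smul, map_smul]; rfl

/-- The metric at `u` as a bilinear map. -/
def metricLin (L : TM n M → ℝ) (u : TM n M) : PB n M u →ₗ[ℝ] PB n M u →ₗ[ℝ] ℝ :=
  LinearMap.mk₂ ℝ (metric L u) (metric_add_left u) (metric_smul_left u)
    (metric_add_right u) (metric_smul_right u)

lemma eq_zero_of_metric (hL : IsFinsler L) {u : TM n M} (hu : u ∈ slit n M) {X : PB n M u}
    (h : ∀ Y, metric L u X Y = 0) : X = 0 := by
  by_contra hX
  exact (hL.posDef u hu X hX).ne' (h X)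

lemma metric_dil (hL : IsFinsler L) {c : ℝ} (hc : 0 < c) (u : TM n M) (X Y : PB n M u) :
    metric L (dil c u) X Y = metric L u X Y :=
  congrArg (fun T => T ((fib u).symm X) ((fib u).symm Y)) (metricAt_smul hL u.proj ((fib u).symm u.snd) hc)

/-! Smoothness of the metric. -/

lemma contMDiffAt_fderiv_snd {F : Type*} [NormedAddCommGroup F] [NormedSpace ℝ F]
    {Φ : M → EuclideanSpace ℝ (Fin n) → F} {p : M × EuclideanSpace ℝ (Fin n)}
    (h : ContMDiffAt ((𝓡 n).prod 𝓘(ℝ, EuclideanSpace ℝ (Fin n))) 𝓘(ℝ, F) ∞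
      (fun q : M × EuclideanSpace ℝ (Fin n) => Φ q.1 q.2) p) :
    ContMDiffAt ((𝓡 n).prod 𝓘(ℝ, EuclideanSpace ℝ (Fin n)))
      𝓘(ℝ, EuclideanSpace ℝ (Fin n) →L[ℝ] F) ∞
      (fun q : M × EuclideanSpace ℝ (Fin n) => fderiv ℝ (Φ q.1) q.2) p := by
  have h1 := ContMDiffAt.mfderiv (I := 𝓘(ℝ, EuclideanSpace ℝ (Fin n))) (I' := 𝓘(ℝ, F)) (m := ∞) (n := ∞)
    (fun (q : M × EuclideanSpace ℝ (Fin n)) (v : EuclideanSpace ℝ (Fin n)) => Φ q.1 v)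
    (fun q => q.2) (x₀ := p) (J := (𝓡 n).prod 𝓘(ℝ, EuclideanSpace ℝ (Fin n))) ?_ contMDiffAt_snd (by simp)
  · refine h1.congr_of_eventuallyEq (Filter.Eventually.of_forall fun q => ?_)
    have e := congrFun (inTangentCoordinates_model_space (I := 𝓘(ℝ, EuclideanSpace ℝ (Fin n)))
      (I' := 𝓘(ℝ, F)) (fun q : M × EuclideanSpace ℝ (Fin n) => q.2) (fun q => Φ q.1 q.2)
      (fun q => mfderiv 𝓘(ℝ, EuclideanSpace ℝ (Fin n)) 𝓘(ℝ, F) (Φ q.1) q.2) p) q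
    exact (e.trans mfderiv_eq_fderiv).symm
  · exact ContMDiffAt.comp (x := (p, p.2)) (f := fun z : (M × EuclideanSpace ℝ (Fin n)) × EuclideanSpace ℝ (Fin n) => (z.1.1, z.2))
      (g := fun q : M × EuclideanSpace ℝ (Fin n) => Φ q.1 q.2) h
      ((contMDiffAt_fst.comp _ contMDiffAt_fst).prodMk contMDiffAt_snd)

lemma fderiv_fderiv_comp_equiv {E F : Type*} [NormedAddCommGroup E] [NormedSpace ℝ E]
    [NormedAddCommGroup F] [NormedSpace ℝ F] (τ : E ≃L[ℝ] F) (f : F → ℝ) (y X Y : E)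
    (hf : ContDiffAt ℝ 2 f (τ y)) :
    fderiv ℝ (fderiv ℝ (fun z => f (τ z))) y X Y = fderiv ℝ (fderiv ℝ f) (τ y) (τ X) (τ Y) := by
  have h1 : (fderiv ℝ (fun z => f (τ z))) = fun z => (fderiv ℝ f (τ z)).comp (τ : E →L[ℝ] F) := by
    funext z
    exact τ.comp_right_fderiv
  have hd : DifferentiableAt ℝ (fderiv ℝ f) (τ y) :=
    (hf.fderiv_right (m := 1) (by norm_num)).differentiableAt (by norm_num)
  have h2 : HasFDerivAt (fun z => fderiv ℝ f (τ z)) ((fderiv ℝ (fderiv ℝ f) (τ y)).comp (τ : E →L[ℝ] F)) y :=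
    hd.hasFDerivAt.comp y τ.hasFDerivAt
  rw [h1, (h2.clm_comp (hasFDerivAt_const (τ : E →L[ℝ] F) y)).fderiv]
  simp

lemma isSmoothFun_metric (hL : IsFinsler L) {X Y : PiField n M} (hX : IsSmoothField X)
    (hY : IsSmoothField Y) : IsSmoothFun (fun u => metric L u (X u) (Y u)) := by
  intro u hu
  refine ContMDiffAt.contMDiffWithinAt ?_
  set t := trivializationAt (EuclideanSpace ℝ (Fin n)) (TangentSpace (𝓡 n) : M → Type _) u.proj with ht
  have hx : u.proj ∈ t.baseSet := mem_chart_source _ _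
  let Φ : M → EuclideanSpace ℝ (Fin n) → ℝ := fun x v =>
    (1 / 2 : ℝ) * L (t.toOpenPartialHomeomorph.symm (x, v)) ^ 2
  let Φ2 : M → EuclideanSpace ℝ (Fin n) → _ := fun x v => fderiv ℝ (fderiv ℝ (Φ x)) v
  have hΦ : ∀ q : M × EuclideanSpace ℝ (Fin n), q.1 ∈ t.baseSet →
      t.toOpenPartialHomeomorph.symm q ∈ slit n M →
      ContMDiffAt ((𝓡 n).prod 𝓘(ℝ, EuclideanSpace ℝ (Fin n))) 𝓘(ℝ, ℝ) ∞
      (fun q : M × EuclideanSpace ℝ (Fin n) => Φ q.1 q.2) q := by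
    intro q hq hq'
    have h1 : ContMDiffAt ((𝓡 n).prod 𝓘(ℝ, EuclideanSpace ℝ (Fin n))) (𝓡 n).tangent ∞
        t.toOpenPartialHomeomorph.symm q :=
      (t.contMDiffOn_symm (IB := 𝓡 n) (n := ∞)).contMDiffAt
        (t.open_target.mem_nhds (t.mem_target.2 hq))
    have h2 := (IsSmoothFun.contMDiffAt hL.smooth hq').comp q h1
    exact contMDiffAt_const.mul (h2.pow 2)
  have hsymm : ∀ v : TM n M, v.proj ∈ t.baseSet → t.toOpenPartialHomeomorph.symm (v.proj, (t v).2) = v := by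
    intro v hv
    have := t.symm_apply_mk_proj (x := v) (t.mem_source.2 hv)
    exact this
  have hΦu := hΦ (u.proj, (t u).2) hx (by rw [hsymm u hx]; exact hu)
  have h2 := contMDiffAt_fderiv_snd (Φ := fun x v => fderiv ℝ (Φ x) v) (contMDiffAt_fderiv_snd hΦu)
  have hproj : ContMDiffAt (𝓡 n).tangent ((𝓡 n).prod 𝓘(ℝ, EuclideanSpace ℝ (Fin n))) ∞
      (fun v : TM n M => (v.proj, (t v).2)) u :=
    (contMDiff_projTM u).prodMk (contMDiffAt_trivializationAt u.proj hx)
  have h3 := ContMDiffAt.comp u h2 hproj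
  have hXc := (contMDiffAt_piField_iff X u.proj hx).1 (hX.contMDiffAt hu)
  have hYc := (contMDiffAt_piField_iff Y u.proj hx).1 (hY.contMDiffAt hu)
  refine ((h3.clm_apply hXc).clm_apply hYc).congr_of_eventuallyEq ?_
  have : ∀ᶠ v : TM n M in 𝓝 u, v.proj ∈ t.baseSet :=
    contMDiff_projTM.continuous.continuousAt.eventually (t.open_baseSet.mem_nhds hx)
  filter_upwards [this, slit_mem_nhds hu] with v hv hvs
  let τ : EuclideanSpace ℝ (Fin n) ≃L[ℝ] EuclideanSpace ℝ (Fin n) :=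
    Trivialization.continuousLinearEquivAt ℝ t v.proj hv
  have e1 : energy L v.proj = fun z => Φ v.proj (τ z) := by
    funext z
    have := hsymm (incl v.proj z) hv
    change _ = (1 / 2 : ℝ) * L (t.toOpenPartialHomeomorph.symm (v.proj, (t (incl v.proj z)).2)) ^ 2
    exact congrArg (fun w => (1 / 2 : ℝ) * L w ^ 2) this.symm
  rw [metric_eq, metricAt, e1]
  refine fderiv_fderiv_comp_equiv τ (Φ v.proj) _ _ _ ?_
  have hΦv := hΦ (v.proj, (t v).2) hv (by rw [hsymm v hv]; exact hvs)
  have h4 : ContMDiffAt 𝓘(ℝ, EuclideanSpace ℝ (Fin n)) 𝓘(ℝ, ℝ) ∞ (Φ v.proj) (t v).2 :=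
    ContMDiffAt.comp (t v).2 (g := fun q : M × EuclideanSpace ℝ (Fin n) => Φ q.1 q.2)
      (f := fun w => (v.proj, w)) hΦv (contMDiffAt_const.prodMk contMDiffAt_id)
  exact h4.contDiffAt.of_le (WithTop.coe_le_coe.2 (le_top : (2 : ℕ∞) ≤ ⊤))

end Finsler
end

noncomputable section
namespace Finsler

variable {n : ℕ} {M : Type*} [TopologicalSpace M] [ChartedSpace (EuclideanSpace ℝ (Fin n)) M]
  [IsManifold (𝓡 n) ∞ M]

/-! ### Linear connections on the pullback bundle -/

variable {D : Conn n M}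

lemma IsSmoothField.mdiffAt_congr {X Y : PiField n M} (hX : IsSmoothField X) {u : TM n M}
    (hu : u ∈ slit n M) (h : ∀ᶠ v in 𝓝 u, Y v = X v) :
    MDifferentiableAt (𝓡 n).tangent ((𝓡 n).tangent.prod 𝓘(ℝ, EuclideanSpace ℝ (Fin n)))
      (fun u => (⟨u, Y u⟩ : TotalSpace (EuclideanSpace ℝ (Fin n)) (PB n M))) u := by
  refine (hX.mdiffAt hu).congr_of_eventuallyEq ?_
  filter_upwards [h] with v hv
  rw [hv]

lemma conn_congr (hD : IsLinearConnection D) {X Y : PiField n M} (hX : IsSmoothField X)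
    {u : TM n M} (hu : u ∈ slit n M) (h : ∀ᶠ v in 𝓝 u, Y v = X v) : D Y u = D X u :=
  hD.cov.congr_of_eventuallyEq (hX.mdiffAt_congr hu h) (hX.mdiffAt hu) (slit_mem_nhds hu) h

lemma conn_add (hD : IsLinearConnection D) {X Y : PiField n M} (hX : IsSmoothField X)
    (hY : IsSmoothField Y) {u : TM n M} (hu : u ∈ slit n M)
    (w : TangentSpace (𝓡 n).tangent u) : D (X + Y) u w = D X u w + D Y u w :=
  congrArg (fun T => T w) (hD.cov.add (hX.mdiffAt hu) (hY.mdiffAt hu) hu)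

lemma conn_smul (hD : IsLinearConnection D) {f : TM n M → ℝ} {X : PiField n M}
    (hf : IsSmoothFun f) (hX : IsSmoothField X) {u : TM n M} (hu : u ∈ slit n M)
    (w : TangentSpace (𝓡 n).tangent u) :
    D (f • X) u w = f u • D X u w + mvfderiv (𝓡 n).tangent f u w • X u :=
  congrArg (fun T => T w) (hD.cov.leibniz (hX.mdiffAt hu) (hf.mdiffAt hu) hu)

lemma conn_zero (hD : IsLinearConnection D) {u : TM n M} (hu : u ∈ slit n M)
    (w : TangentSpace (𝓡 n).tangent u) : D 0 u w = 0 :=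
  congrArg (fun T => T w) (hD.cov.zero hu)

lemma conn_neg (hD : IsLinearConnection D) {X : PiField n M} (hX : IsSmoothField X)
    {u : TM n M} (hu : u ∈ slit n M) (w : TangentSpace (𝓡 n).tangent u) :
    D (-X) u w = - D X u w := by
  have h := conn_add hD hX hX.neg hu w
  rw [add_neg_cancel, conn_zero hD hu w] at h
  exact (neg_eq_of_add_eq_zero_right h.symm).symm

lemma conn_sub (hD : IsLinearConnection D) {X Y : PiField n M} (hX : IsSmoothField X)
    (hY : IsSmoothField Y) {u : TM n M} (hu : u ∈ slit n M)
    (w : TangentSpace (𝓡 n).tangent u) : D (X - Y) u w = D X u w - D Y u w := by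
  rw [sub_eq_add_neg, conn_add hD hX hY.neg hu, conn_neg hD hY hu, sub_eq_add_neg]

lemma IsSmoothField.zero : IsSmoothField (0 : PiField n M) :=
  (isSmoothField_eta.sub isSmoothField_eta).congr (by simp)

lemma IsSmoothField.sum' {ι : Type*} {s : Finset ι} {X : ι → PiField n M}
    (hX : ∀ i ∈ s, IsSmoothField (X i)) : IsSmoothField (∑ i ∈ s, X i) := by
  have := IsSmoothField.sum hX
  refine this.congr fun u _ => ?_
  rw [Finset.sum_apply]

lemma conn_sum (hD : IsLinearConnection D) {ι : Type*} {s : Finset ι} {X : ι → PiField n M}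
    (hX : ∀ i, IsSmoothField (X i)) {u : TM n M} (hu : u ∈ slit n M)
    (w : TangentSpace (𝓡 n).tangent u) : D (∑ i ∈ s, X i) u w = ∑ i ∈ s, D (X i) u w := by
  classical
  induction s using Finset.induction_on with
  | empty => simp only [Finset.sum_empty]; exact conn_zero hD hu w
  | insert a s ha ih =>
    rw [Finset.sum_insert ha, Finset.sum_insert ha,
      conn_add hD (hX a) (IsSmoothField.sum' fun i _ => hX i) hu, ih]

lemma IsSmoothField.conn (hD : IsLinearConnection D) {Z : PiField n M} (hZ : IsSmoothField Z)
    {V : VField n M} (hV : IsSmoothVField V) : IsSmoothField (fun u => D Z u (V u)) := by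
  have h := hD.smooth.contMDiff (σ := Z) hZ
  exact ContMDiffOn.clm_bundle_apply (IB := (𝓡 n).tangent)
    (E₁ := (TangentSpace (𝓡 n).tangent : TM n M → Type _)) (E₂ := PB n M) h hV

section

variable [T2Space M]

lemma cutoff_sq_smul (x₀ : M) (X : PiField n M) :
    (fun u : TM n M => cutoff n x₀ u.proj ^ 2) • X = ∑ i, (fun u => cofr x₀ i u (X u)) • fr x₀ i := by
  funext u
  rw [Finset.sum_apply]
  change cutoff n x₀ u.proj ^ 2 • X u = ∑ i, cofr x₀ i u (X u) • fr x₀ i u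
  set t := trivializationAt (EuclideanSpace ℝ (Fin n)) (TangentSpace (𝓡 n) : M → Type _) x₀ with ht
  by_cases hb : u.proj ∈ (chartAt (EuclideanSpace ℝ (Fin n)) x₀).source
  · have e1 : ∀ j, fr x₀ j u = cutoff n x₀ u.proj •
        Trivialization.symmL ℝ t u.proj (EuclideanSpace.single j (1 : ℝ)) := fun j => rfl
    have e2 : ∀ i, cofr x₀ i u (X u) = cutoff n x₀ u.proj *
        (Trivialization.continuousLinearMapAt ℝ t u.proj (X u)) i := fun i => rfl
    have e3 : X u = Trivialization.symmL ℝ t u.proj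
        (Trivialization.continuousLinearMapAt ℝ t u.proj (X u)) :=
      (t.symmL_continuousLinearMapAt hb (X u)).symm
    have e4 : (Trivialization.continuousLinearMapAt ℝ t u.proj (X u)) =
        ∑ i, (Trivialization.continuousLinearMapAt ℝ t u.proj (X u)) i •
        EuclideanSpace.single i (1 : ℝ) := by
      have := (EuclideanSpace.basisFun (Fin n) ℝ).sum_repr
        (Trivialization.continuousLinearMapAt ℝ t u.proj (X u))
      simpa using this.symm
    have e5 : X u = ∑ i, (Trivialization.continuousLinearMapAt ℝ t u.proj (X u)) i •
        Trivialization.symmL ℝ t u.proj (EuclideanSpace.single i (1 : ℝ)) := by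
      refine (e3.trans (congrArg (Trivialization.symmL ℝ t u.proj) e4)).trans ?_
      rw [map_sum]
      simp only [map_smul]
      rfl
    simp only [e1, e2]
    refine (congrArg (fun w => cutoff n x₀ u.proj ^ 2 • w) e5).trans ?_
    have e6 : ∀ w : Fin n → EuclideanSpace ℝ (Fin n), ∀ a : Fin n → ℝ, ∀ c : ℝ,
        c ^ 2 • ∑ i, a i • w i = ∑ i, (c * a i) • c • w i := by
      intro w a c
      rw [Finset.smul_sum]
      refine Finset.sum_congr rfl fun i _ => ?_
      rw [smul_smul, smul_smul]; congr 1; ring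
    exact e6 _ _ _
  · have h0 : cutoff n x₀ u.proj = 0 := by
      rw [SmoothBumpFunction.coe_def, indicator_of_notMem hb]
    have e2 : ∀ i, cofr x₀ i u (X u) = 0 := fun i => by rw [cofr_apply, h0, zero_mul]
    simp only [e2, h0, zero_smul, Finset.sum_const_zero]
    rw [zero_pow two_ne_zero, zero_smul]

lemma eventually_dom {x₀ : M} {u : TM n M} (hx : u.proj ∈ dom n x₀) :
    ∀ᶠ v : TM n M in 𝓝 u, v.proj ∈ dom n x₀ :=
  contMDiff_projTM.continuous.continuousAt.eventually ((isOpen_dom x₀).mem_nhds hx)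

lemma conn_expand (hD : IsLinearConnection D) {Z : PiField n M} (hZ : IsSmoothField Z) {x₀ : M}
    {u : TM n M} (hu : u ∈ slit n M) (hx : u.proj ∈ dom n x₀)
    (w : TangentSpace (𝓡 n).tangent u) :
    D Z u w = ∑ i, (cofr x₀ i u (Z u) • D (fr x₀ i) u w +
      mvfderiv (𝓡 n).tangent (fun v => cofr x₀ i v (Z v)) u w • fr x₀ i u) := by
  have hs : ∀ i, IsSmoothField ((fun v => cofr x₀ i v (Z v)) • fr x₀ i) := fun i =>
    (isSmoothField_fr x₀ i).smul (isSmoothFun_cofr x₀ i hZ)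
  have h : D Z u = D (∑ i, (fun v => cofr x₀ i v (Z v)) • fr x₀ i) u := by
    refine conn_congr hD (IsSmoothField.sum' fun i _ => hs i) hu ?_
    filter_upwards [eventually_dom hx] with v hv
    rw [Finset.sum_apply]
    exact sum_cofr_smul_fr hv (Z v)
  rw [h, conn_sum hD hs hu]
  exact Finset.sum_congr rfl fun i _ => conn_smul hD (isSmoothFun_cofr x₀ i hZ) (isSmoothField_fr x₀ i) hu w

end

/-! ### The horizontal map -/

lemma inverse_of_injective {E : Type*} [NormedAddCommGroup E] [NormedSpace ℝ E]
    [FiniteDimensional ℝ E] (f : E × E →L[ℝ] E × E) (hf : Function.Injective f) :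
    f.IsInvertible := by
  let e : (E × E) ≃ₗ[ℝ] (E × E) := LinearEquiv.ofInjectiveEndo f.toLinearMap hf
  exact ⟨e.toContinuousLinearEquiv, by ext <;> rfl⟩

lemma prod_injective (hr : IsRegular D) {u : TM n M} (hu : u ∈ slit n M) :
    Function.Injective ((rho u).prod (connMap D u)) := by
  intro a b hab
  have h1 : rho u a = rho u b := congrArg Prod.fst hab
  have h2 : connMap D u a = connMap D u b := congrArg Prod.snd hab
  have h := (hr u hu).disjoint
  rw [Submodule.disjoint_def] at h
  have := h (a - b) (by simp [h1]) (by simp [h2])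
  exact sub_eq_zero.1 this

lemma prod_isInvertible (hr : IsRegular D) {u : TM n M} (hu : u ∈ slit n M) :
    ((rho u).prod (connMap D u)).IsInvertible :=
  inverse_of_injective (E := EuclideanSpace ℝ (Fin n)) ((rho u).prod (connMap D u)) (prod_injective hr hu)

lemma prod_beta (hr : IsRegular D) {u : TM n M} (hu : u ∈ slit n M) (X : PB n M u) :
    (rho u).prod (connMap D u) (beta D u X) = (X, 0) :=
  congrArg (fun T => T (X, 0)) (prod_isInvertible hr hu).self_comp_inverse

lemma rho_beta (hr : IsRegular D) {u : TM n M} (hu : u ∈ slit n M) (X : PB n M u) :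
    rho u (beta D u X) = X := congrArg Prod.fst (prod_beta hr hu X)

lemma connMap_beta (hr : IsRegular D) {u : TM n M} (hu : u ∈ slit n M) (X : PB n M u) :
    connMap D u (beta D u X) = 0 := congrArg Prod.snd (prod_beta hr hu X)

lemma eq_of_rho_connMap (hr : IsRegular D) {u : TM n M} (hu : u ∈ slit n M)
    {a b : TangentSpace (𝓡 n).tangent u} (h1 : rho u a = rho u b)
    (h2 : connMap D u a = connMap D u b) : a = b :=
  prod_injective hr hu (Prod.ext h1 h2)

/-! ### Smoothness of horizontal lifts -/

lemma contMDiffAt_conn (hD : IsLinearConnection D) {Z : PiField n M} (hZ : IsSmoothField Z)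
    {V : VField n M} {u : TM n M} (hu : u ∈ slit n M)
    (hV : ContMDiffAt (𝓡 n).tangent (𝓡 n).tangent.tangent ∞
      (fun u => (⟨u, V u⟩ : TangentBundle (𝓡 n).tangent (TM n M))) u) :
    ContMDiffAt (𝓡 n).tangent ((𝓡 n).tangent.prod 𝓘(ℝ, EuclideanSpace ℝ (Fin n))) ∞
      (fun u => (⟨u, D Z u (V u)⟩ : TotalSpace (EuclideanSpace ℝ (Fin n)) (PB n M))) u := by
  have h := (hD.smooth.contMDiff (σ := Z) hZ).contMDiffAt (slit_mem_nhds hu)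
  exact ContMDiffAt.clm_bundle_apply (IB := (𝓡 n).tangent)
    (E₁ := (TangentSpace (𝓡 n).tangent : TM n M → Type _)) (E₂ := PB n M) h hV

lemma contMDiffAt_rho {V : VField n M} {u : TM n M}
    (hV : ContMDiffAt (𝓡 n).tangent (𝓡 n).tangent.tangent ∞
      (fun u => (⟨u, V u⟩ : TangentBundle (𝓡 n).tangent (TM n M))) u) :
    ContMDiffAt (𝓡 n).tangent ((𝓡 n).tangent.prod 𝓘(ℝ, EuclideanSpace ℝ (Fin n))) ∞
      (fun u => (⟨u, rho u (V u)⟩ : TotalSpace (EuclideanSpace ℝ (Fin n)) (PB n M))) u := by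
  rw [contMDiffAt_piField_iff _ u.proj (mem_chart_source _ _)]
  have h1 : ContMDiff (𝓡 n).tangent.tangent (𝓡 n).tangent ∞
      (tangentMap (𝓡 n).tangent (𝓡 n) (fun u : TM n M => u.proj)) :=
    contMDiff_projTM.contMDiff_tangentMap (by simp)
  have h2 := (h1 _).comp u hV
  exact ContMDiffAt.comp (g := fun v : TM n M =>
      (trivializationAt (EuclideanSpace ℝ (Fin n)) (TangentSpace (𝓡 n)) u.proj v).2)
    (f := fun v : TM n M => (⟨v.proj, rho v (V v)⟩ : TM n M)) u
    (contMDiffAt_trivializationAt (u := (⟨u.proj, rho u (V u)⟩ : TM n M)) u.proj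
      (mem_chart_source _ _)) h2

lemma contMDiffAt_matrix_inv {ι : Type*} [Fintype ι] [DecidableEq ι]
    {E H N : Type*} [NormedAddCommGroup E] [NormedSpace ℝ E] [TopologicalSpace H]
    {I : ModelWithCorners ℝ E H} [TopologicalSpace N] [ChartedSpace H N]
    {P : N → Matrix ι ι ℝ} {x : N} (h : ∀ i j, ContMDiffAt I 𝓘(ℝ, ℝ) ∞ (fun y => P y i j) x)
    (hdet : (P x).det ≠ 0) (i j : ι) :
    ContMDiffAt I 𝓘(ℝ, ℝ) ∞ (fun y => (P y)⁻¹ i j) x := by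
  have hd : ∀ Q : N → Matrix ι ι ℝ, (∀ i j, ContMDiffAt I 𝓘(ℝ, ℝ) ∞ (fun y => Q y i j) x) →
      ContMDiffAt I 𝓘(ℝ, ℝ) ∞ (fun y => (Q y).det) x := by
    intro Q hQ
    simp only [Matrix.det_apply]
    refine contMDiffAt_finsetSum fun σ _ => ?_
    have := contMDiffAt_finsetProd (t := Finset.univ) (fun i _ => hQ (σ i) i)
    exact (contMDiffAt_const (c := ((Equiv.Perm.sign σ : ℤ) : ℝ))).mul this |>.congr_of_eventuallyEq
      (Filter.Eventually.of_forall fun y =>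
        (Units.smul_def _ _).trans (zsmul_eq_mul _ _))
  have e : (fun y => (P y)⁻¹ i j) = fun y => (P y).det⁻¹ * (P y).adjugate i j := by
    funext y
    rw [Matrix.inv_def, Matrix.smul_apply, Ring.inverse_eq_inv', smul_eq_mul]
  rw [e]
  refine ((hd P h).inv₀ hdet).mul ?_
  simp only [Matrix.adjugate_apply]
  refine hd _ fun a b => ?_
  simp only [Matrix.updateRow_apply]
  split_ifs
  · exact contMDiffAt_const
  · exact h a b

section

variable [T2Space M]

lemma IsSmoothField.hlift (hD : IsLinearConnection D) (hr : IsRegular D) {X : PiField n M}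
    (hX : IsSmoothField X) : IsSmoothVField (hlift D X) := by
  intro u hu
  refine ContMDiffAt.contMDiffWithinAt ?_
  set t := trivializationAt (EuclideanSpace ℝ (Fin n) × EuclideanSpace ℝ (Fin n))
    (TangentSpace (𝓡 n).tangent : TM n M → Type _) u with ht
  have hut : u ∈ t.baseSet := FiberBundle.mem_baseSet_trivializationAt' u
  let b := (EuclideanSpace.basisFun (Fin n) ℝ).toBasis.prod (EuclideanSpace.basisFun (Fin n) ℝ).toBasis
  let V : Fin n ⊕ Fin n → VField n M := t.localFrame b
  have hV : ∀ a, ContMDiffAt (𝓡 n).tangent (𝓡 n).tangent.tangent ∞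
      (fun u => (⟨u, V a u⟩ : TangentBundle (𝓡 n).tangent (TM n M))) u := fun a =>
    contMDiffAt_localFrame_of_mem (I := (𝓡 n).tangent) ∞ t b a hut
  let x₀ := u.proj
  let P : TM n M → Matrix (Fin n ⊕ Fin n) (Fin n ⊕ Fin n) ℝ := fun v => Matrix.of fun i a =>
    Sum.elim (fun i => cofr x₀ i v (rho v (V a v))) (fun i => cofr x₀ i v (connMap D v (V a v))) i
  have hP : ∀ i a, ContMDiffAt (𝓡 n).tangent 𝓘(ℝ, ℝ) ∞ (fun v => P v i a) u := by
    rintro (i | i) a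
    · exact contMDiffAt_cofr x₀ i (contMDiffAt_rho (hV a))
    · exact contMDiffAt_cofr x₀ i (contMDiffAt_conn hD isSmoothField_eta hu (hV a))
  have key : ∀ v, v ∈ slit n M → v.proj ∈ dom n x₀ → ∀ (c : Fin n ⊕ Fin n → ℝ)
      (w : TangentSpace (𝓡 n).tangent v),
      (∀ i, (P v).mulVec c i = Sum.elim (fun i => cofr x₀ i v (rho v w))
        (fun i => cofr x₀ i v (connMap D v w)) i) → ∑ a, c a • V a v = w := by
    intro v hv hvx c w h
    refine eq_of_rho_connMap hr hv ?_ ?_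
    · rw [sum_cofr_smul_fr hvx (rho v w), sum_cofr_smul_fr hvx (rho v (∑ a, c a • V a v))]
      refine Finset.sum_congr rfl fun i _ => ?_
      congr 1
      rw [map_sum, map_sum]
      refine Eq.trans ?_ (h (Sum.inl i))
      simp only [Matrix.mulVec, dotProduct]
      refine Finset.sum_congr rfl fun a _ => ?_
      rw [map_smul, map_smul, smul_eq_mul, mul_comm]
      rfl
    · rw [sum_cofr_smul_fr hvx (connMap D v w), sum_cofr_smul_fr hvx (connMap D v (∑ a, c a • V a v))]
      refine Finset.sum_congr rfl fun i _ => ?_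
      congr 1
      rw [map_sum, map_sum]
      refine Eq.trans ?_ (h (Sum.inr i))
      simp only [Matrix.mulVec, dotProduct]
      refine Finset.sum_congr rfl fun a _ => ?_
      rw [map_smul, map_smul, smul_eq_mul, mul_comm]
      rfl
  have hdet : ∀ v, v ∈ slit n M → v.proj ∈ dom n x₀ → v ∈ t.baseSet → IsUnit (P v).det := by
    intro v hv hvx hvt
    rw [← Matrix.isUnit_iff_isUnit_det, ← Matrix.mulVec_injective_iff_isUnit]
    have hinj : ∀ c, (P v).mulVec c = 0 → c = 0 := by
      intro c hc
      have h0 := key v hv hvx c 0 (fun i => by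
        rw [hc]; rcases i with i | i <;> simp)
      have hb : ∀ a, V a v = t.basisAt b hvt a := fun a => t.localFrame_apply_of_mem_baseSet b hvt
      simp only [hb] at h0
      funext a
      exact Fintype.linearIndependent_iff.1 (t.basisAt b hvt).linearIndependent c h0 a
    intro c d hcd
    have := hinj (c - d) (by rw [Matrix.mulVec_sub, sub_eq_zero]; exact hcd)
    exact sub_eq_zero.1 this
  have hux : u.proj ∈ dom n x₀ := mem_dom _
  have hinv := contMDiffAt_matrix_inv hP (hdet u hu hux hut).ne_zero
  have hc : ∀ a, ContMDiffAt (𝓡 n).tangent 𝓘(ℝ, ℝ) ∞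
      (fun v => ∑ i, (P v)⁻¹ a (Sum.inl i) * cofr x₀ i v (X v)) u := fun a =>
    contMDiffAt_finsetSum fun i _ => (hinv a (Sum.inl i)).mul
      (contMDiffAt_cofr x₀ i (hX.contMDiffAt hu))
  have hsum := ContMDiffAt.sum_section (I := (𝓡 n).tangent)
    (F := EuclideanSpace ℝ (Fin n) × EuclideanSpace ℝ (Fin n))
    (V := (TangentSpace (𝓡 n).tangent : TM n M → Type _)) (s := Finset.univ)
    (t := fun a v => (∑ i, (P v)⁻¹ a (Sum.inl i) * cofr x₀ i v (X v)) • V a v)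
    (fun a _ => (hc a).smul_section (hV a))
  refine hsum.congr_of_eventuallyEq ?_
  filter_upwards [slit_mem_nhds hu, eventually_dom hux, t.open_baseSet.mem_nhds hut] with v hv hvx hvt
  have := key v hv hvx (fun a => ∑ i, (P v)⁻¹ a (Sum.inl i) * cofr x₀ i v (X v)) (beta D v (X v)) ?_
  · exact congrArg _ this.symm
  · intro i
    rw [rho_beta hr hv, connMap_beta hr hv]
    have e : (fun a => ∑ i, (P v)⁻¹ a (Sum.inl i) * cofr x₀ i v (X v)) =
        ((P v)⁻¹).mulVec (Sum.elim (fun i => cofr x₀ i v (X v)) (fun i => cofr x₀ i v 0)) := by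
      funext a
      simp [Matrix.mulVec, dotProduct]
    rw [e, Matrix.mulVec_mulVec, Matrix.mul_nonsing_inv _ (hdet v hv hvx hvt), Matrix.one_mulVec]

end

/-! ### Derivatives of functions and brackets -/

lemma IsSmoothFun.mvfderiv {f : TM n M → ℝ} (hf : IsSmoothFun f) {V : VField n M}
    (hV : IsSmoothVField V) :
    IsSmoothFun (fun u => mvfderiv (𝓡 n).tangent f u (V u)) := by
  intro u hu
  refine ContMDiffAt.contMDiffWithinAt ?_
  have h1 := (hf.contMDiffAt hu).mfderiv_const (m := ∞) (by simp)
  have h2 := ContMDiffAt.clm_apply_of_inCoordinates (b₁ := fun v : TM n M => v) (b₂ := f)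
    (F₁ := EuclideanSpace ℝ (Fin n) × EuclideanSpace ℝ (Fin n)) (F₂ := ℝ)
    (E₁ := (TangentSpace (𝓡 n).tangent : TM n M → Type _))
    (E₂ := (TangentSpace 𝓘(ℝ, ℝ) : ℝ → Type _)) h1 (hV.contMDiffAt hu) (hf.contMDiffAt hu)
  exact (contMDiff_snd_tangentBundle_modelSpace ℝ 𝓘(ℝ, ℝ)).contMDiffAt.comp u h2

lemma IsSmoothVField.mlieBracket {V W : VField n M} (hV : IsSmoothVField V)
    (hW : IsSmoothVField W) :
    IsSmoothVField (VectorField.mlieBracket (𝓡 n).tangent V W) := by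
  intro u hu
  refine ContMDiffAt.contMDiffWithinAt ?_
  have : IsManifold (𝓡 n).tangent (((⊤ : ℕ∞) : ℕ∞ω) + 1) (TM n M) :=
    inferInstanceAs (IsManifold (𝓡 n).tangent ∞ (TM n M))
  have : IsManifold (𝓡 n).tangent (minSmoothness ℝ 2) (TM n M) :=
    IsManifold.of_le (n := ∞) minSmoothness_two_le_infty
  refine ContMDiffAt.mlieBracket_vectorField (m := ⊤) (n := ⊤) (hV.contMDiffAt hu)
    (hW.contMDiffAt hu) ?_
  rw [minSmoothness_of_isRCLikeNormedField]
  exact le_rfl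

end Finsler
end

noncomputable section
namespace Finsler

variable {n : ℕ} {M : Type*} [TopologicalSpace M] [ChartedSpace (EuclideanSpace ℝ (Fin n)) M]
  [IsManifold (𝓡 n) ∞ M]

/-! ### Vertical derivatives of basic fields -/

/-- A smooth vector field on the base manifold. -/
def IsSmoothBase (X : Π x : M, TangentSpace (𝓡 n) x) : Prop :=
  ContMDiff (𝓡 n) (𝓡 n).tangent ∞ (fun x => (⟨x, X x⟩ : TangentBundle (𝓡 n) M))

lemma IsSmoothBase.mdiffAt {X : Π x : M, TangentSpace (𝓡 n) x} (hX : IsSmoothBase X) (x : M) :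
    MDifferentiableAt (𝓡 n) (𝓡 n).tangent (fun x => (⟨x, X x⟩ : TangentBundle (𝓡 n) M)) x :=
  ContMDiff.mdifferentiableAt hX (by simp)

lemma exists_base [T2Space M] (u : TM n M) (w : PB n M u) :
    ∃ X : Π x : M, TangentSpace (𝓡 n) x, IsSmoothBase X ∧ basic X u = w := by
  refine ⟨fun x => ∑ i, cofr u.proj i u w • baseFrame u.proj i x, ?_, ?_⟩
  · exact ContMDiff.sum_section (t := fun i x => cofr u.proj i u w • baseFrame u.proj i x)
      fun i _ => (contMDiff_baseFrame u.proj i).const_smul_section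
  · exact (sum_cofr_smul_fr (mem_dom _) w).symm

lemma mk_tangent_congr {p u : TM n M} (h : p = u)
    (w : EuclideanSpace ℝ (Fin n) × EuclideanSpace ℝ (Fin n)) :
    (⟨p, w⟩ : TangentBundle (𝓡 n).tangent (TM n M)) = ⟨u, w⟩ := by
  subst h; rfl

lemma IsSmoothField.vlift {X : PiField n M} (hX : IsSmoothField X) :
    IsSmoothVField (vlift X) := by
  intro u hu
  refine ContMDiffAt.contMDiffWithinAt ?_
  let f : TM n M → ℝ → TM n M := fun v s =>
    ⟨v.proj, (v.snd + s • (show TangentSpace (𝓡 n) v.proj from X v) : TangentSpace (𝓡 n) v.proj)⟩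
  have hf0 : ∀ v, f v 0 = v := fun v => by
    have : (v.snd + (0 : ℝ) • (show TangentSpace (𝓡 n) v.proj from X v) : TangentSpace (𝓡 n) v.proj)
      = v.snd := by rw [zero_smul, add_zero]
    exact congrArg (fun w => (⟨v.proj, w⟩ : TM n M)) this
  set t := trivializationAt (EuclideanSpace ℝ (Fin n)) (TangentSpace (𝓡 n) : M → Type _) u.proj with ht
  have hx : u.proj ∈ t.baseSet := mem_chart_source _ _
  have hf : ContMDiffAt ((𝓡 n).tangent.prod 𝓘(ℝ, ℝ)) (𝓡 n).tangent ∞ (Function.uncurry f) (u, 0) := by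
    rw [contMDiffAt_totalSpace]
    refine ⟨ContMDiffAt.comp (g := fun v : TM n M => v.proj) (f := Prod.fst) (u, (0:ℝ))
      (contMDiff_projTM u) contMDiffAt_fst, ?_⟩
    have h1 := contMDiffAt_trivializationAt (u := u) u.proj hx
    have h2 := (contMDiffAt_piField_iff X u.proj hx).1 (hX.contMDiffAt hu)
    have h1' := h1.comp (u, (0:ℝ)) (contMDiffAt_fst (I := (𝓡 n).tangent) (J := 𝓘(ℝ, ℝ)))
    have h2' := h2.comp (u, (0:ℝ)) (contMDiffAt_fst (I := (𝓡 n).tangent) (J := 𝓘(ℝ, ℝ)))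
    refine (h1'.add ((contMDiffAt_snd (I := (𝓡 n).tangent) (J := 𝓘(ℝ, ℝ))).smul h2')).congr_of_eventuallyEq ?_
    have : ∀ᶠ p : TM n M × ℝ in 𝓝 (u, 0), p.1.proj ∈ t.baseSet :=
      (contMDiff_projTM.continuous.comp continuous_fst).continuousAt.eventually
        (t.open_baseSet.mem_nhds hx)
    filter_upwards [this] with p hp
    have e := fun w => t.continuousLinearMapAt_apply_of_mem (R := ℝ) (b := p.1.proj) hp w
    have e1 := e (p.1.snd + p.2 • (show TangentSpace (𝓡 n) p.1.proj from X p.1))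
    rw [map_add, map_smul] at e1
    refine e1.symm.trans ?_
    exact congrArg₂ (fun a b => a + p.2 • b) (e p.1.snd) (e (X p.1))
  have h1 := ContMDiffAt.mfderiv (m := ∞) (n := ∞) f (fun _ => (0 : ℝ)) hf contMDiffAt_const (by simp)
  have h3 : ContMDiffAt (𝓡 n).tangent (𝓡 n).tangent ∞ (fun v => f v 0) u := by
    simp only [hf0]; exact contMDiffAt_id
  have hone : ContMDiffAt (𝓡 n).tangent 𝓘(ℝ, ℝ).tangent ∞
      (fun _ : TM n M => (⟨(0 : ℝ), (1 : ℝ)⟩ : TangentBundle 𝓘(ℝ, ℝ) ℝ)) u := contMDiffAt_const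
  have h2 := ContMDiffAt.clm_apply_of_inCoordinates (b₁ := fun _ : TM n M => (0 : ℝ))
    (b₂ := fun v => f v 0) (v := fun _ => (1 : ℝ))
    (F₂ := EuclideanSpace ℝ (Fin n) × EuclideanSpace ℝ (Fin n)) (F₁ := ℝ)
    (E₂ := (TangentSpace (𝓡 n).tangent : TM n M → Type _))
    (E₁ := (TangentSpace 𝓘(ℝ, ℝ) : ℝ → Type _)) h1 hone h3
  refine h2.congr_of_eventuallyEq (Filter.Eventually.of_forall fun v => ?_)
  exact (mk_tangent_congr (hf0 v) _).symm

variable {L : TM n M → ℝ} {D : Conn n M}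

lemma rho_mlieBracket_vlift [T2Space M] (hD : IsLinearConnection D) (hr : IsRegular D)
    {X : PiField n M} (hX : IsSmoothField X) {Y : Π x : M, TangentSpace (𝓡 n) x}
    (hY : IsSmoothBase Y) {u : TM n M} (hu : u ∈ slit n M) :
    rho u (VectorField.mlieBracket (𝓡 n).tangent (vlift X) (hlift D (basic Y)) u) = 0 := by
  have : IsManifold (𝓡 n) 2 M := IsManifold.of_le (n := ∞) (WithTop.coe_le_coe.2 (le_top : (2 : ℕ∞) ≤ ⊤))
  have : IsManifold (𝓡 n).tangent 2 (TM n M) :=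
    IsManifold.of_le (n := ∞) (WithTop.coe_le_coe.2 (le_top : (2 : ℕ∞) ≤ ⊤))
  have h := mfderiv_mlieBracket_of_related (I := (𝓡 n).tangent) (I' := 𝓡 n)
    (f := fun v : TM n M => v.proj) (x := u) (V := vlift X) (W := hlift D (basic Y))
    (V' := 0) (W' := Y)
    ((contMDiff_projTM u).of_le (WithTop.coe_le_coe.2 (le_top : (2 : ℕ∞) ≤ ⊤)))
    (hX.vlift.mdiffAt hu) (((isSmoothField_basic hY).hlift hD hr).mdiffAt hu)
    (mdifferentiableAt_zeroSection ..) (hY.mdiffAt u.proj)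
    (Filter.Eventually.of_forall fun v => rho_gamma v (X v))
    (by filter_upwards [slit_mem_nhds hu] with v hv using rho_beta hr hv _)
  rw [VectorField.mlieBracket_zero_left] at h
  exact h

lemma rho_mlieBracket_hlift [T2Space M] (hD : IsLinearConnection D) (hr : IsRegular D)
    {X Y : Π x : M, TangentSpace (𝓡 n) x} (hX : IsSmoothBase X)
    (hY : IsSmoothBase Y) {u : TM n M} (hu : u ∈ slit n M) :
    rho u (VectorField.mlieBracket (𝓡 n).tangent (hlift D (basic X)) (hlift D (basic Y)) u)
      = VectorField.mlieBracket (𝓡 n) X Y u.proj := by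
  have : IsManifold (𝓡 n) 2 M := IsManifold.of_le (n := ∞) (WithTop.coe_le_coe.2 (le_top : (2 : ℕ∞) ≤ ⊤))
  have : IsManifold (𝓡 n).tangent 2 (TM n M) :=
    IsManifold.of_le (n := ∞) (WithTop.coe_le_coe.2 (le_top : (2 : ℕ∞) ≤ ⊤))
  exact mfderiv_mlieBracket_of_related (I := (𝓡 n).tangent) (I' := 𝓡 n)
    (f := fun v : TM n M => v.proj) (x := u)
    ((contMDiff_projTM u).of_le (WithTop.coe_le_coe.2 (le_top : (2 : ℕ∞) ≤ ⊤)))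
    (((isSmoothField_basic hX).hlift hD hr).mdiffAt hu)
    (((isSmoothField_basic hY).hlift hD hr).mdiffAt hu)
    (hX.mdiffAt u.proj) (hY.mdiffAt u.proj)
    (by filter_upwards [slit_mem_nhds hu] with v hv using rho_beta hr hv _)
    (by filter_upwards [slit_mem_nhds hu] with v hv using rho_beta hr hv _)

lemma conn_rho_hlift (hD : IsLinearConnection D) (hr : IsRegular D)
    {Y : PiField n M} (hY : IsSmoothField Y) {u : TM n M} (hu : u ∈ slit n M) :
    D (fun v => rho v (hlift D Y v)) u = D Y u :=
  conn_congr hD hY hu (by filter_upwards [slit_mem_nhds hu] with v hv using rho_beta hr hv _)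

lemma torsionT_basic [T2Space M] (hD : IsLinearConnection D) (hr : IsRegular D)
    {X : PiField n M} (hX : IsSmoothField X) {Y : Π x : M, TangentSpace (𝓡 n) x}
    (hY : IsSmoothBase Y) {u : TM n M} (hu : u ∈ slit n M) :
    torsionT D X (basic Y) u = D (basic Y) u (gamma u (X u)) := by
  have h1 : D (fun v => rho v (vlift X v)) u = D 0 u :=
    conn_congr hD IsSmoothField.zero hu (Filter.Eventually.of_forall fun v => rho_gamma v (X v))
  rw [torsionT, torsion, rho_mlieBracket_vlift hD hr hX hY hu,
    conn_rho_hlift hD hr (isSmoothField_basic hY) hu, h1, conn_zero hD hu, sub_zero, sub_zero]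
  rfl

lemma conn_basic_comm [T2Space M] (hC : IsCartanConnection L D)
    {X Y : Π x : M, TangentSpace (𝓡 n) x} (hX : IsSmoothBase X)
    (hY : IsSmoothBase Y) {u : TM n M} (hu : u ∈ slit n M) :
    D (basic Y) u (beta D u (basic X u)) - D (basic X) u (beta D u (basic Y u))
      = VectorField.mlieBracket (𝓡 n) X Y u.proj := by
  have h := hC.torsionQ_eq_zero _ _ (isSmoothField_basic hX) (isSmoothField_basic hY) u hu
  rw [torsionQ, torsion, rho_mlieBracket_hlift hC.linear hC.regular hX hY hu,
    conn_rho_hlift hC.linear hC.regular (isSmoothField_basic hY) hu,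
    conn_rho_hlift hC.linear hC.regular (isSmoothField_basic hX) hu] at h
  exact sub_eq_zero.1 h

lemma metric_conn_vertical [T2Space M] (hL : IsFinsler L) (hC : IsCartanConnection L D)
    {u : TM n M} (hu : u ∈ slit n M) (x z : PB n M u)
    {Y : Π x : M, TangentSpace (𝓡 n) x} (hY : IsSmoothBase Y) :
    2 * metric L u (D (basic Y) u (gamma u x)) z =
      thirdDeriv L u.proj ((fib u).symm u.snd) ((fib u).symm x) ((fib u).symm (basic Y u))
        ((fib u).symm z) := by
  obtain ⟨X, hX, rfl⟩ := exists_base u x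
  obtain ⟨Z, hZ, rfl⟩ := exists_base u z
  have hXs := isSmoothField_basic hX
  have hYs := isSmoothField_basic hY
  have hZs := isSmoothField_basic hZ
  have h1 := hC.torsionT_symm _ _ _ hXs hYs hZs u hu
  rw [torsionT_basic hC.linear hC.regular hXs hY hu,
    torsionT_basic hC.linear hC.regular hXs hZ hu] at h1
  have h2 := hC.metric _ _ hYs hZs u hu (gamma u (basic X u))
  rw [metric_symm hL hu (basic Y u), ← h1,
    mvfderiv_gamma ((isSmoothFun_metric hL hYs hZs).mdiffAt hu)] at h2
  rw [two_mul, ← h2]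
  exact fderiv_metricAt_apply hL u.proj (v := (fib u).symm u.snd) hu ((fib u).symm (basic X u))
    ((fib u).symm (basic Y u)) ((fib u).symm (basic Z u))

lemma connMap_gamma [T2Space M] (hL : IsFinsler L) (hC : IsCartanConnection L D)
    {u : TM n M} (hu : u ∈ slit n M) (x : PB n M u) : connMap D u (gamma u x) = x := by
  have hx := mem_dom (n := n) u.proj
  have h := conn_expand hC.linear isSmoothField_eta hu hx (gamma u x)
  rw [Finset.sum_add_distrib] at h
  have h1 : ∑ i, cofr u.proj i u (eta u) • D (fr u.proj i) u (gamma u x) = 0 := by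
    refine eq_zero_of_metric hL hu fun z => ?_
    have e : metric L u (∑ i, cofr u.proj i u (eta u) • D (fr u.proj i) u (gamma u x)) z =
        ∑ i, cofr u.proj i u (eta u) * metric L u (D (fr u.proj i) u (gamma u x)) z := by
      have := congrArg (fun T => T z) (map_sum (metricLin L u)
        (fun i => cofr u.proj i u (eta u) • D (fr u.proj i) u (gamma u x)) Finset.univ)
      refine this.trans ?_
      rw [LinearMap.sum_apply]
      exact Finset.sum_congr rfl fun i _ => metric_smul_left u _ _ _
    have e2 : ∀ i, metric L u (D (fr u.proj i) u (gamma u x)) z =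
        2⁻¹ * thirdDeriv L u.proj ((fib u).symm u.snd) ((fib u).symm x)
          ((fib u).symm (fr u.proj i u)) ((fib u).symm z) := fun i => by
      have := metric_conn_vertical hL hC hu x z (contMDiff_baseFrame u.proj i)
      rw [eq_inv_mul_iff_mul_eq₀ two_ne_zero]
      exact this
    rw [e]
    simp only [e2]
    have e3 : ∑ i, cofr u.proj i u (eta u) * (2⁻¹ * thirdDeriv L u.proj ((fib u).symm u.snd)
        ((fib u).symm x) ((fib u).symm (fr u.proj i u)) ((fib u).symm z)) =
        2⁻¹ * thirdDeriv L u.proj ((fib u).symm u.snd)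
        ((fib u).symm x) (∑ i, cofr u.proj i u (eta u) • (fib u).symm (fr u.proj i u)) ((fib u).symm z) := by
      rw [thirdDeriv, map_sum, sum_apply, Finset.mul_sum]
      refine Finset.sum_congr rfl fun i _ => ?_
      rw [map_smul, smul_apply, smul_eq_mul, thirdDeriv]
      ring
    have e4 : (∑ i, cofr u.proj i u (eta u) • (fib u).symm (fr u.proj i u)) = (fib u).symm u.snd :=
      (sum_cofr_smul_fr hx (eta u)).symm
    rw [e3, e4, thirdDeriv_symm_left hL u.proj (v := (fib u).symm u.snd) hu,
      thirdDeriv_self_left hL u.proj (v := (fib u).symm u.snd) hu, mul_zero]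
  rw [h1, zero_add] at h
  refine h.trans ?_
  refine Eq.trans (Finset.sum_congr rfl fun i _ => ?_) (sum_cofr_smul_fr hx x).symm
  congr 1
  rw [mvfderiv_gamma ((isSmoothFun_cofr u.proj i isSmoothField_eta).mdiffAt hu)]
  let T : EuclideanSpace ℝ (Fin n) →L[ℝ] ℝ := cofr u.proj i u
  exact congrArg (fun S : EuclideanSpace ℝ (Fin n) →L[ℝ] ℝ => S ((fib u).symm x)) T.fderiv

lemma eq_gamma_of_rho_eq_zero [T2Space M] (hL : IsFinsler L) (hC : IsCartanConnection L D)
    {u : TM n M} (hu : u ∈ slit n M) {w : TangentSpace (𝓡 n).tangent u} (hw : rho u w = 0) :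
    w = gamma u (connMap D u w) :=
  eq_of_rho_connMap hC.regular hu (by rw [hw, rho_gamma]) (by rw [connMap_gamma hL hC hu])

end Finsler
end

noncomputable section
namespace Finsler

variable {n : ℕ} {M : Type*} [TopologicalSpace M] [ChartedSpace (EuclideanSpace ℝ (Fin n)) M]
  [IsManifold (𝓡 n) ∞ M]

/-! ### Homogeneity of the Cartan connection -/

lemma eq_zero_of_skew {E : Type*} [AddCommGroup E] (g : E → E → ℝ) (F : E → E → E)
    (t : E → E → E → ℝ) (e : E) (hg : ∀ X, (∀ Z, g X Z = 0) → X = 0)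
    (skew : ∀ X Y Z, g (F X Y) Z = - g (F X Z) Y) (ht₀ : ∀ Y Z, t 0 Y Z = 0)
    (ht₁ : ∀ X Z, t X e Z = 0) (ht₂ : ∀ X Y, t X Y e = 0)
    (h : ∀ X Y Z, g (F X Y) Z - g (F Y X) Z = t (F X e) Y Z - t (F Y e) X Z) (X Y : E) :
    F X Y = 0 := by
  have h1 : F e e = 0 := hg _ fun Z => by
    have a := h Z e e
    rw [ht₁, ht₂] at a
    have b := skew Z e e
    have c := skew e Z e
    linarith
  have h2 : ∀ X, F X e = 0 := fun X => hg _ fun Z => by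
    have a := h X e Z
    rw [h1, ht₁, ht₀] at a
    have a' := h Z e X
    rw [h1, ht₁, ht₀] at a'
    have b := h X Z e
    rw [ht₂, ht₂] at b
    have c := skew X e Z
    have d := skew Z e X
    have d' := skew e X Z
    linarith
  have h3 : ∀ X Y Z, g (F X Y) Z = g (F Y X) Z := fun X Y Z => by
    have a := h X Y Z
    rw [h2, h2, ht₀, ht₀] at a
    linarith
  refine hg _ fun Z => ?_
  have a1 := h3 X Y Z
  have a2 := h3 Y Z X
  have a3 := h3 Z X Y
  have b1 := skew X Y Z
  have b2 := skew Y Z X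
  have b3 := skew Z X Y
  linarith

lemma mvfderiv_congr {f g : TM n M → ℝ} {u : TM n M} (h : ∀ᶠ v in 𝓝 u, f v = g v) :
    mvfderiv (𝓡 n).tangent f u = mvfderiv (𝓡 n).tangent g u :=
  Filter.EventuallyEq.mfderiv_eq h

lemma mvfderiv_mul_apply {f g : TM n M → ℝ} {u : TM n M} (hf : IsSmoothFun f) (hg : IsSmoothFun g)
    (hu : u ∈ slit n M) (w : TangentSpace (𝓡 n).tangent u) :
    mvfderiv (𝓡 n).tangent (fun v => f v * g v) u w =
      f u * mvfderiv (𝓡 n).tangent g u w + g u * mvfderiv (𝓡 n).tangent f u w :=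
  congrArg (fun T => T w) (mvfderiv_mul (hf.mdiffAt hu) (hg.mdiffAt hu))

lemma mvfderiv_const_mul {f : TM n M → ℝ} {u : TM n M} (hf : IsSmoothFun f) (c : ℝ)
    (hu : u ∈ slit n M) (w : TangentSpace (𝓡 n).tangent u) :
    mvfderiv (𝓡 n).tangent (fun v => c * f v) u w = c * mvfderiv (𝓡 n).tangent f u w := by
  have h := mvfderiv_mul_apply (IsSmoothFun.const c) hf hu w
  have h0 : mvfderiv (𝓡 n).tangent (fun _ : TM n M => c) u w = 0 :=
    congrArg (fun T => T w) (mvfderiv_const c)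
  rw [h, h0, mul_zero, add_zero]

variable {L : TM n M → ℝ} {D : Conn n M}

/-- The failure of the connection to commute with the dilation by `c`. -/
def dilDefect (D : Conn n M) (c : ℝ) (u : TM n M) (w : TangentSpace (𝓡 n).tangent u)
    (Y : PiField n M) : EuclideanSpace ℝ (Fin n) :=
  (fib (dil c u)).symm (D Y (dil c u) (ddil c u w)) - (fib u).symm (D Y u w)

lemma dilDefect_add (c : ℝ) (u : TM n M) (w w' : TangentSpace (𝓡 n).tangent u)
    (Y : PiField n M) : dilDefect D c u (w + w') Y = dilDefect D c u w Y + dilDefect D c u w' Y := by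
  simp only [dilDefect, map_add]
  abel

lemma metric_dil' (hL : IsFinsler L) {c : ℝ} (hc : 0 < c) (u : TM n M) (X Y : PB n M (dil c u)) :
    metric L (dil c u) X Y = metric L u ((fib (dil c u)).symm X) ((fib (dil c u)).symm Y) :=
  metric_dil hL hc u _ _

variable [T2Space M]

/-- The covariant derivative at a dilated point of a homogeneous field. -/
lemma conn_dil_expand (hD : IsLinearConnection D) {Z : PiField n M} (hZ : IsSmoothField Z)
    {c k : ℝ} (hc : c ≠ 0)
    (hk : ∀ v ∈ slit n M, (fib (dil c v)).symm (Z (dil c v)) = k • (fib v).symm (Z v))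
    {u : TM n M} (hu : u ∈ slit n M) (w : TangentSpace (𝓡 n).tangent u) :
    (fib (dil c u)).symm (D Z (dil c u) (ddil c u w)) = k • ((fib u).symm (D Z u w) +
      ∑ i, cofr u.proj i u (Z u) • dilDefect D c u w (fr u.proj i)) := by
  have hu' := dil_mem_slit hc hu
  have hx := mem_dom (n := n) u.proj
  have h1 := conn_expand hD hZ (u := dil c u) hu' hx (ddil c u w)
  have h2 := conn_expand hD hZ hu hx w
  have hcf : ∀ i, ∀ v ∈ slit n M, cofr u.proj i (dil c v) (Z (dil c v)) = k * cofr u.proj i v (Z v) := by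
    intro i v hv
    let T : EuclideanSpace ℝ (Fin n) →L[ℝ] ℝ := cofr u.proj i v
    have := congrArg T (hk v hv)
    rw [map_smul] at this
    exact this
  have hd : ∀ i, mvfderiv (𝓡 n).tangent (fun v => cofr u.proj i v (Z v)) (dil c u) (ddil c u w)
      = k * mvfderiv (𝓡 n).tangent (fun v => cofr u.proj i v (Z v)) u w := by
    intro i
    have hs := isSmoothFun_cofr u.proj i hZ
    rw [mvfderiv_dil (hs.mdiffAt hu'), ← mvfderiv_const_mul hs k hu]
    refine congrArg (fun T => T w) (mvfderiv_congr ?_)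
    filter_upwards [slit_mem_nhds hu] with v hv using hcf i v hv
  have e1 := congrArg (fib (dil c u)).symm h1
  have e2 := congrArg (fib u).symm h2
  rw [map_sum] at e1 e2
  refine e1.trans ?_
  rw [e2, ← Finset.sum_add_distrib, Finset.smul_sum]
  refine Finset.sum_congr rfl fun i _ => ?_
  rw [map_add, map_add, map_smul, map_smul, map_smul, map_smul, hcf i u hu, hd i, dilDefect]
  have e3 : (fib (dil c u)).symm (fr u.proj i (dil c u)) = (fib u).symm (fr u.proj i u) := rfl
  rw [e3]
  generalize (fib (dil c u)).symm (D (fr u.proj i) (dil c u) (ddil c u w)) = A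
  module

lemma dilDefect_basic (hD : IsLinearConnection D) {Y : Π x : M, TangentSpace (𝓡 n) x}
    (hY : IsSmoothBase Y) {c : ℝ} (hc : c ≠ 0) {u : TM n M} (hu : u ∈ slit n M)
    (w : TangentSpace (𝓡 n).tangent u) :
    dilDefect D c u w (basic Y) =
      ∑ i, cofr u.proj i u (basic Y u) • dilDefect D c u w (fr u.proj i) := by
  have h := conn_dil_expand hD (isSmoothField_basic hY) (k := 1) hc
    (fun v _ => (one_smul ℝ _).symm) hu w
  rw [one_smul] at h
  rw [dilDefect, h, add_sub_cancel_left]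

lemma dilDefect_skew (hL : IsFinsler L) (hC : IsCartanConnection L D)
    {Y Z : Π x : M, TangentSpace (𝓡 n) x} (hY : IsSmoothBase Y) (hZ : IsSmoothBase Z)
    {c : ℝ} (hc : 0 < c) {u : TM n M} (hu : u ∈ slit n M) (w : TangentSpace (𝓡 n).tangent u) :
    metric L u (dilDefect D c u w (basic Y)) (basic Z u) =
      - metric L u (dilDefect D c u w (basic Z)) (basic Y u) := by
  have hu' := dil_mem_slit hc.ne' hu
  have hYs := isSmoothField_basic hY
  have hZs := isSmoothField_basic hZ
  have h1 := hC.metric _ _ hYs hZs _ hu' (ddil c u w)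
  have h2 := hC.metric _ _ hYs hZs u hu w
  rw [mvfderiv_dil ((isSmoothFun_metric hL hYs hZs).mdiffAt hu')] at h1
  have h3 : (fun v : TM n M => metric L (dil c v) (basic Y (dil c v)) (basic Z (dil c v))) =
      fun v => metric L v (basic Y v) (basic Z v) := by
    funext v; exact metric_dil hL hc v _ _
  rw [h3, h2, metric_dil' hL hc, metric_dil' hL hc] at h1
  rw [dilDefect, dilDefect]
  have e : ∀ a b d : EuclideanSpace ℝ (Fin n), metric L u (a - b : EuclideanSpace ℝ (Fin n)) d = metric L u a d - metric L u b d := by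
    intro a b d
    exact congrArg (fun T => T d) (map_sub (metricLin L u) a b)
  have e' := metric_symm hL hu
  refine (e _ _ _).trans ?_
  refine Eq.trans ?_ (congrArg Neg.neg (e _ _ _)).symm
  have f1 := e' ((fib (dil c u)).symm (D (basic Z) (dil c u) (ddil c u w))) (basic Y u)
  have f2 := e' ((fib u).symm (D (basic Z) u w)) (basic Y u)
  rw [f1, f2]
  have h1' : metric L u (D (basic Y) u w) (basic Z u) + metric L u (basic Y u) (D (basic Z) u w) =
    metric L u ((fib (dil c u)).symm (D (basic Y) (dil c u) (ddil c u w))) (basic Z u) +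
    metric L u (basic Y u) ((fib (dil c u)).symm (D (basic Z) (dil c u) (ddil c u w))) := h1
  have g1 : metric L u ((fib u).symm (D (basic Y) u w)) (basic Z u) = metric L u (D (basic Y) u w) (basic Z u) := rfl
  have g2 : metric L u (basic Y u) ((fib u).symm (D (basic Z) u w)) = metric L u (basic Y u) (D (basic Z) u w) := rfl
  rw [g1, g2]
  linarith

lemma thirdDeriv_dil (hL : IsFinsler L) (x : M) {c : ℝ} (hc : 0 < c)
    (v X Y Z : EuclideanSpace ℝ (Fin n)) :
    thirdDeriv L x (c • v) (c • X) Y Z = thirdDeriv L x v X Y Z := by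
  have h := fderiv_smul_of_homogeneous (f := metricAt L x) (d := c⁻¹) hc.ne'
    (fun w => by rw [mul_inv_cancel₀ hc.ne', one_smul, metricAt_smul hL x w hc]) v
  have h2 : thirdDeriv L x (c • v) (c • X) Y Z = c⁻¹ * thirdDeriv L x v (c • X) Y Z :=
    congrArg (fun T => T (c • X) Y Z) h
  have h3 : thirdDeriv L x v (c • X) Y Z = c * thirdDeriv L x v X Y Z :=
    congrArg (fun T => T Y Z) (ContinuousLinearMap.map_smul (fderiv ℝ (metricAt L x) v) c X)
  rw [h2, h3, inv_mul_cancel_left₀ hc.ne']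

lemma dilDefect_gamma (hL : IsFinsler L) (hC : IsCartanConnection L D)
    {Y : Π x : M, TangentSpace (𝓡 n) x} (hY : IsSmoothBase Y) 
    {c : ℝ} (hc : 0 < c) {u : TM n M} (hu : u ∈ slit n M) (x : PB n M u) :
    dilDefect D c u (gamma u x) (basic Y) = 0 := by
  have hu' := dil_mem_slit hc.ne' hu
  refine eq_zero_of_metric hL hu (X := fib u _) fun z => ?_
  have h1 := metric_conn_vertical hL hC hu x z hY
  have h2 := metric_conn_vertical hL hC hu' (c • (fib u).symm x) ((fib u).symm z) hY
  have h2' : 2 * metric L u ((fib (dil c u)).symm (D (basic Y) (dil c u) (ddil c u (gamma u x)))) z =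
      thirdDeriv L u.proj (c • (fib u).symm u.snd) (c • (fib u).symm x) ((fib u).symm (basic Y u))
        ((fib u).symm z) := by
    rw [ddil_gamma]
    exact (congrArg (2 * ·) (metric_dil' hL hc _ _ _)).symm.trans h2
  have h3 := thirdDeriv_dil hL u.proj hc ((fib u).symm u.snd) ((fib u).symm x) ((fib u).symm (basic Y u))
    ((fib u).symm z)
  have h4 := (h2'.trans h3).trans h1.symm
  have h5 := mul_left_cancel₀ two_ne_zero h4
  have e := congrArg (fun T => T z) (map_sub (metricLin L u)
    ((fib (dil c u)).symm (D (basic Y) (dil c u) (ddil c u (gamma u x)))) (D (basic Y) u (gamma u x)))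
  exact e.trans (sub_eq_zero.2 h5)

/-- The defect in a horizontal direction, as a function of vectors. -/
def horDefect (D : Conn n M) (c : ℝ) (u : TM n M) (x y : EuclideanSpace ℝ (Fin n)) :
    EuclideanSpace ℝ (Fin n) :=
  ∑ i, cofr u.proj i u y • dilDefect D c u (beta D u x) (fr u.proj i)

lemma beta_dil_aux (hL : IsFinsler L) (hC : IsCartanConnection L D)
    {c : ℝ} (hc : 0 < c) {u : TM n M} (hu : u ∈ slit n M) (x : PB n M u) :
    beta D (dil c u) x =
      ddil c u (beta D u x + gamma u (- horDefect D c u x u.snd : EuclideanSpace ℝ (Fin n))) := by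
  have hu' := dil_mem_slit hc.ne' hu
  have h := conn_dil_expand hC.linear isSmoothField_eta (c := c) (k := c) hc.ne'
    (fun v _ => rfl) hu (beta D u x)
  have hK : (fib u).symm (D eta u (beta D u x)) = 0 := by
    exact connMap_beta hC.regular hu x
  rw [hK, zero_add] at h
  have hK' : connMap D (dil c u) (ddil c u (beta D u x)) = c • horDefect D c u x u.snd := h
  have e1 : ddil c u (gamma u (- horDefect D c u x u.snd : EuclideanSpace ℝ (Fin n))) =
      gamma (dil c u) (c • (- horDefect D c u x u.snd) : EuclideanSpace ℝ (Fin n)) := ddil_gamma _ _ _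
  rw [map_add, e1]
  change beta D (dil c u) (fib (dil c u) ((fib u).symm x)) = _
  refine eq_of_rho_connMap hC.regular hu' ?_ ?_
  · rw [rho_beta hC.regular hu', map_add]
    have e2 := rho_gamma (dil c u)
      (fib (dil c u) (c • (- horDefect D c u x u.snd) : EuclideanSpace ℝ (Fin n)))
    have e3 : ∀ a b y : EuclideanSpace ℝ (Fin n), a = y → b = 0 → y = a + b := by
      rintro a b y rfl rfl; rw [add_zero]
    exact e3 _ _ _ ((rho_ddil c u _).trans (rho_beta hC.regular hu x)) e2
  · rw [connMap_beta hC.regular hu', map_add, hK']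
    have e2 := connMap_gamma hL hC hu'
      (fib (dil c u) (c • (- horDefect D c u x u.snd) : EuclideanSpace ℝ (Fin n)))
    have e3 : ∀ a b : EuclideanSpace ℝ (Fin n), b = c • (-a) → 0 = c • a + b := by
      rintro a b rfl; rw [smul_neg, add_neg_cancel]
    exact e3 _ _ e2

lemma horDefect_eq_zero (hL : IsFinsler L) (hC : IsCartanConnection L D)
    {c : ℝ} (hc : 0 < c) {u : TM n M} (hu : u ∈ slit n M) (x y : EuclideanSpace ℝ (Fin n)) :
    horDefect D c u x y = 0 := by
  have hu' := dil_mem_slit hc.ne' hu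
  have hF : ∀ (x : EuclideanSpace ℝ (Fin n)) (Y : Π x : M, TangentSpace (𝓡 n) x), IsSmoothBase Y →
      horDefect D c u x (basic Y u) = dilDefect D c u (beta D u x) (basic Y) := fun x Y hY =>
    (dilDefect_basic hC.linear hY hc.ne' hu _).symm
  set v := (fib u).symm u.snd with hv
  have hv0 : v ≠ 0 := hu
  refine eq_zero_of_skew (fun a b => metric L u (fib u a) (fib u b)) (horDefect D c u)
    (fun a b d => 2⁻¹ * thirdDeriv L u.proj v a b d) v ?_ ?_ ?_ ?_ ?_ ?_ x y
  · intro X h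
    exact eq_zero_of_metric hL hu (X := fib u X) h
  · intro X y z
    obtain ⟨Y, hY, hYy⟩ := exists_base u (fib u y)
    obtain ⟨Z, hZ, hZz⟩ := exists_base u (fib u z)
    have e1 : horDefect D c u X y = dilDefect D c u (beta D u X) (basic Y) :=
      (congrArg (horDefect D c u X) hYy.symm).trans (hF X Y hY)
    have e2 : horDefect D c u X z = dilDefect D c u (beta D u X) (basic Z) :=
      (congrArg (horDefect D c u X) hZz.symm).trans (hF X Z hZ)
    have h := dilDefect_skew hL hC hY hZ hc hu (beta D u X)
    rw [hYy, hZz] at h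
    simp only [e1, e2]
    exact h
  · intro Y Z
    have : thirdDeriv L u.proj v 0 Y Z = 0 :=
      congrArg (fun T => T Y Z) (ContinuousLinearMap.map_zero (fderiv ℝ (metricAt L u.proj) v))
    rw [this, mul_zero]
  · intro X Z
    rw [thirdDeriv_symm_left hL u.proj hv0, thirdDeriv_self_left hL u.proj hv0, mul_zero]
  · intro X Y
    rw [thirdDeriv_symm_right hL u.proj hv0, thirdDeriv_symm_left hL u.proj hv0,
      thirdDeriv_self_left hL u.proj hv0, mul_zero]
  · intro x y z
    obtain ⟨X, hX, hXx⟩ := exists_base u (fib u x)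
    obtain ⟨Y, hY, hYy⟩ := exists_base u (fib u y)
    have key : ∀ (x y : EuclideanSpace ℝ (Fin n)) (X Y : Π x : M, TangentSpace (𝓡 n) x), IsSmoothBase X →
        IsSmoothBase Y → basic X u = fib u x → basic Y u = fib u y →
        (fib (dil c u)).symm (D (basic Y) (dil c u) (beta D (dil c u) (basic X (dil c u)))) =
          (fib u).symm (D (basic Y) u (beta D u (basic X u))) + (horDefect D c u x y
          - (fib u).symm (D (basic Y) u (gamma u (fib u (horDefect D c u x v))))) := by
      intro x y X Y hX hY hXx hYy
      have e0 : horDefect D c u x y = dilDefect D c u (beta D u (basic X u)) (basic Y) := by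
        rw [hXx]
        exact (congrArg (horDefect D c u x) hYy.symm).trans (hF x Y hY)
      have e1 : beta D (dil c u) (basic X (dil c u)) =
        ddil c u (beta D u (basic X u) + gamma u (- horDefect D c u (basic X u) u.snd : EuclideanSpace ℝ (Fin n))) :=
        beta_dil_aux hL hC hc hu (basic X u)
      have e2 : horDefect D c u (basic X u) u.snd = horDefect D c u x v := by rw [hXx]; rfl
      have e3 := dilDefect_gamma hL hC hY hc hu (fib u (- horDefect D c u x v))
      have e4 := dilDefect_add (D := D) c u (beta D u (basic X u)) (gamma u (fib u (- horDefect D c u x v)))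
        (basic Y)
      rw [e3, add_zero, ← e0] at e4
      have e5 := sub_eq_iff_eq_add.1 e4
      rw [e2] at e1
      have e6 : gamma u (fib u (-horDefect D c u x v)) = - gamma u (fib u (horDefect D c u x v)) := by
        have := gamma_smul u (-1) (fib u (horDefect D c u x v))
        rw [neg_one_smul, neg_one_smul] at this
        rw [map_neg]; exact this
      rw [e1]
      refine e5.trans ?_
      rw [map_add, map_add, e6, map_neg, map_neg]
      abel
    have k1 := key x y X Y hX hY hXx hYy
    have k2 := key y x Y X hY hX hYy hXx
    have t1 := conn_basic_comm hC hX hY hu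
    have t2 := conn_basic_comm hC hX hY hu'
    have t1' := congrArg (fib u).symm t1
    have t2' := congrArg (fib (dil c u)).symm t2
    rw [map_sub] at t1' t2'
    rw [k1, k2] at t2'
    have t3 := t2'.trans (show _ = (fib u).symm (VectorField.mlieBracket (𝓡 n) X Y u.proj) from rfl)
    rw [← t1'] at t3
    have t4 : horDefect D c u x y - horDefect D c u y x =
        (fib u).symm (D (basic Y) u (gamma u (fib u (horDefect D c u x v)))) -
        (fib u).symm (D (basic X) u (gamma u (fib u (horDefect D c u y v)))) := by
      rw [← sub_eq_zero] at t3 ⊢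
      rw [← t3]
      abel
    have m1 := metric_conn_vertical hL hC hu (fib u (horDefect D c u x v)) (fib u z) hY
    have m2 := metric_conn_vertical hL hC hu (fib u (horDefect D c u y v)) (fib u z) hX
    rw [hYy] at m1
    rw [hXx] at m2
    have e : ∀ a b d : EuclideanSpace ℝ (Fin n), metric L u (fib u (a - b)) (fib u d) =
        metric L u (fib u a) (fib u d) - metric L u (fib u b) (fib u d) := by
      intro a b d
      rw [map_sub]
      exact congrArg (fun T => T (fib u d)) (map_sub (metricLin L u) (fib u a) (fib u b))
    have t5 := congrArg (fun a => metric L u (fib u a) (fib u z)) t4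
    simp only [e] at t5
    rw [t5]
    have m1' : metric L u (fib u ((fib u).symm (D (basic Y) u (gamma u (fib u (horDefect D c u x v)))))) (fib u z) =
      2⁻¹ * thirdDeriv L u.proj v (horDefect D c u x v) y z := by
      rw [eq_inv_mul_iff_mul_eq₀ two_ne_zero]
      exact m1
    have m2' : metric L u (fib u ((fib u).symm (D (basic X) u (gamma u (fib u (horDefect D c u y v)))))) (fib u z) =
      2⁻¹ * thirdDeriv L u.proj v (horDefect D c u y v) x z := by
      rw [eq_inv_mul_iff_mul_eq₀ two_ne_zero]
      exact m2
    rw [m1', m2']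

/-- The horizontal map is equivariant under dilations. -/
lemma beta_dil (hL : IsFinsler L) (hC : IsCartanConnection L D)
    {c : ℝ} (hc : 0 < c) {u : TM n M} (hu : u ∈ slit n M) (x : PB n M u) :
    beta D (dil c u) x = ddil c u (beta D u x) := by
  have h := beta_dil_aux hL hC hc hu x
  have h0 := horDefect_eq_zero hL hC hc hu x u.snd
  rw [h0] at h
  have e : gamma u (-(0 : EuclideanSpace ℝ (Fin n)) : EuclideanSpace ℝ (Fin n)) = 0 := by
    have := gamma_smul u 0 (0 : PB n M u)
    rw [zero_smul, zero_smul] at this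
    rw [neg_zero]; exact this
  rw [e, add_zero] at h
  exact h

lemma dilDefect_eq_zero (hL : IsFinsler L) (hC : IsCartanConnection L D)
    {Y : Π x : M, TangentSpace (𝓡 n) x} (hY : IsSmoothBase Y)
    {c : ℝ} (hc : 0 < c) {u : TM n M} (hu : u ∈ slit n M) (w : TangentSpace (𝓡 n).tangent u) :
    dilDefect D c u w (basic Y) = 0 := by
  have h1 : w = beta D u (rho u w) + gamma u (connMap D u (w - beta D u (rho u w))) := by
    rw [← eq_gamma_of_rho_eq_zero hL hC hu, add_sub_cancel]
    rw [map_sub, rho_beta hC.regular hu, sub_self]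
  rw [h1, dilDefect_add, dilDefect_gamma hL hC hY hc hu, add_zero,
    dilDefect_basic hC.linear hY hc.ne' hu]
  exact horDefect_eq_zero hL hC hc hu _ _

/-- The covariant derivative of a homogeneous field is homogeneous. -/
lemma conn_dil (hL : IsFinsler L) (hC : IsCartanConnection L D) {Z : PiField n M}
    (hZ : IsSmoothField Z) {c k : ℝ} (hc : 0 < c)
    (hk : ∀ v ∈ slit n M, (fib (dil c v)).symm (Z (dil c v)) = k • (fib v).symm (Z v))
    {u : TM n M} (hu : u ∈ slit n M) (w : TangentSpace (𝓡 n).tangent u) :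
    (fib (dil c u)).symm (D Z (dil c u) (ddil c u w)) = k • (fib u).symm (D Z u w) := by
  rw [conn_dil_expand hC.linear hZ hc.ne' hk hu, Finset.sum_eq_zero, add_zero]
  intro i _
  have := dilDefect_eq_zero hL hC (contMDiff_baseFrame u.proj i) hc hu w
  exact (congrArg (cofr u.proj i u (Z u) • ·) this).trans (smul_zero _)

end Finsler
end

noncomputable section
namespace Finsler

variable {n : ℕ} {M : Type*} [TopologicalSpace M] [ChartedSpace (EuclideanSpace ℝ (Fin n)) M]
  [IsManifold (𝓡 n) ∞ M]

/-! ### Brackets acting on functions -/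

lemma IsSmoothVField.smul {f : TM n M → ℝ} {V : VField n M} (hf : IsSmoothFun f)
    (hV : IsSmoothVField V) : IsSmoothVField (f • V) := ContMDiffOn.smul_section hf hV

instance isManifold_tangent_minSmoothness_three :
    IsManifold (𝓡 n).tangent (minSmoothness ℝ 3) (TM n M) :=
  IsManifold.of_le (n := ∞) (by
    rw [minSmoothness_of_isRCLikeNormedField]
    exact WithTop.coe_le_coe.2 (le_top : (3 : ℕ∞) ≤ ⊤))

lemma mlieBracket_smul_right' {f : TM n M → ℝ} {V W : VField n M} (hf : IsSmoothFun f)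
    (hW : IsSmoothVField W) {u : TM n M} (hu : u ∈ slit n M) :
    (VectorField.mlieBracket (𝓡 n).tangent V (f • W)) u = mvfderiv (𝓡 n).tangent f u (V u) • W u + f u • (VectorField.mlieBracket (𝓡 n).tangent V W) u :=
  VectorField.mlieBracket_smul_right (hf.mdiffAt hu) (hW.mdiffAt hu)

lemma mlieBracket_smul_left' {f : TM n M → ℝ} {V W : VField n M} (hf : IsSmoothFun f)
    (hV : IsSmoothVField V) {u : TM n M} (hu : u ∈ slit n M) :
    (VectorField.mlieBracket (𝓡 n).tangent (f • V) W) u = - mvfderiv (𝓡 n).tangent f u (W u) • V u + f u • (VectorField.mlieBracket (𝓡 n).tangent V W) u :=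
  VectorField.mlieBracket_smul_left (hf.mdiffAt hu) (hV.mdiffAt hu)

lemma mlieBracket_congr_right {V W W' : VField n M} {u : TM n M} (hu : u ∈ slit n M)
    (h : ∀ v ∈ slit n M, W v = W' v) : (VectorField.mlieBracket (𝓡 n).tangent V W) u = (VectorField.mlieBracket (𝓡 n).tangent V W') u :=
  Filter.EventuallyEq.mlieBracket_vectorField_eq Filter.EventuallyEq.rfl
    (by filter_upwards [slit_mem_nhds hu] with v hv using h v hv)

/-- The bracket of two vector fields, as a derivation. -/
lemma mvfderiv_mlieBracket {V W U : VField n M} {f : TM n M → ℝ} (hV : IsSmoothVField V)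
    (hW : IsSmoothVField W) (hU : IsSmoothVField U) (hf : IsSmoothFun f) {u : TM n M}
    (hu : u ∈ slit n M) (hne : U u ≠ 0) :
    mvfderiv (𝓡 n).tangent f u ((VectorField.mlieBracket (𝓡 n).tangent V W) u) = mvfderiv (𝓡 n).tangent (fun v => mvfderiv (𝓡 n).tangent f v (W v)) u (V u) - mvfderiv (𝓡 n).tangent (fun v => mvfderiv (𝓡 n).tangent f v (V v)) u (W u) := by
  have hle : minSmoothness ℝ 2 ≤ ∞ := minSmoothness_two_le_infty
  have key : ∀ {V W : VField n M}, IsSmoothVField V → IsSmoothVField W →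
      (VectorField.mlieBracket (𝓡 n).tangent V (VectorField.mlieBracket (𝓡 n).tangent W (f • U))) u = (mvfderiv (𝓡 n).tangent (fun v => mvfderiv (𝓡 n).tangent f v (W v)) u (V u) • U u
        + mvfderiv (𝓡 n).tangent f u (W u) • (VectorField.mlieBracket (𝓡 n).tangent V U) u) + (mvfderiv (𝓡 n).tangent f u (V u) • (VectorField.mlieBracket (𝓡 n).tangent W U) u + f u • (VectorField.mlieBracket (𝓡 n).tangent V (VectorField.mlieBracket (𝓡 n).tangent W U)) u) := by
    intro V W hV hW
    have hg := hf.mvfderiv hW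
    have hWU := hW.mlieBracket hU
    rw [mlieBracket_congr_right (W' := (fun v => mvfderiv (𝓡 n).tangent f v (W v)) • U + f • (VectorField.mlieBracket (𝓡 n).tangent W U)) hu
      (fun v hv => mlieBracket_smul_right' hf hU hv),
      VectorField.mlieBracket_add_right ((hU.smul hg).mdiffAt hu) ((hWU.smul hf).mdiffAt hu),
      mlieBracket_smul_right' hg hU hu, mlieBracket_smul_right' hf hWU hu]
  have h1 := VectorField.leibniz_identity_mlieBracket_apply
    ((hV.contMDiffAt hu).of_le hle) ((hW.contMDiffAt hu).of_le hle)
    (((hU.smul hf).contMDiffAt hu).of_le hle)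
  have h2 := VectorField.leibniz_identity_mlieBracket_apply
    ((hV.contMDiffAt hu).of_le hle) ((hW.contMDiffAt hu).of_le hle)
    ((hU.contMDiffAt hu).of_le hle)
  rw [key hV hW, key hW hV, mlieBracket_smul_right' hf hU hu, h2] at h1
  have h3 : (mvfderiv (𝓡 n).tangent f u ((VectorField.mlieBracket (𝓡 n).tangent V W) u) - (mvfderiv (𝓡 n).tangent (fun v => mvfderiv (𝓡 n).tangent f v (W v)) u (V u) -
      mvfderiv (𝓡 n).tangent (fun v => mvfderiv (𝓡 n).tangent f v (V v)) u (W u))) • U u = 0 := by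
    generalize mvfderiv (𝓡 n).tangent f u ((VectorField.mlieBracket (𝓡 n).tangent V W) u) = a at *
    generalize mvfderiv (𝓡 n).tangent (fun v => mvfderiv (𝓡 n).tangent f v (W v)) u (V u) = b at *
    generalize mvfderiv (𝓡 n).tangent (fun v => mvfderiv (𝓡 n).tangent f v (V v)) u (W u) = b' at *
    rw [← sub_eq_zero] at h1
    rw [← neg_eq_zero, ← h1]
    module
  exact sub_eq_zero.1 ((smul_eq_zero.1 h3).resolve_right hne)

/-! ### The classical curvature -/

variable {L : TM n M → ℝ} {D : Conn n M}

section Classical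

variable {V V' W : VField n M} {Z Z' : PiField n M} {u : TM n M}

lemma classicalCurvature_swap (V W : VField n M) (Z : PiField n M) (u : TM n M) :
    classicalCurvature D V W Z u = - classicalCurvature D W V Z u := by
  rw [classicalCurvature, classicalCurvature, VectorField.mlieBracket_swap_apply, map_neg]
  abel

lemma IsSmoothField.classicalCurvature (hD : IsLinearConnection D) (hZ : IsSmoothField Z)
    (hV : IsSmoothVField V) (hW : IsSmoothVField W) : IsSmoothField (classicalCurvature D V W Z) :=
  (((hZ.conn hD hW).conn hD hV).neg.add ((hZ.conn hD hV).conn hD hW)).add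
    (hZ.conn hD (hV.mlieBracket hW))

lemma classicalCurvature_add_left (hD : IsLinearConnection D) (hZ : IsSmoothField Z)
    (hV : IsSmoothVField V) (hV' : IsSmoothVField V') (hu : u ∈ slit n M) :
    classicalCurvature D (V + V') W Z u =
      classicalCurvature D V W Z u + classicalCurvature D V' W Z u := by
  have h : (fun v => D Z v ((V + V') v)) = (fun v => D Z v (V v)) + fun v => D Z v (V' v) := by
    funext v
    exact map_add (D Z v) _ _
  have e : (V + V') u = V u + V' u := rfl
  simp only [classicalCurvature]
  rw [h, conn_add hD (hZ.conn hD hV) (hZ.conn hD hV') hu,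
    VectorField.mlieBracket_add_left (hV.mdiffAt hu) (hV'.mdiffAt hu), map_add, e, map_add]
  abel

lemma classicalCurvature_smul_left (hD : IsLinearConnection D) {f : TM n M → ℝ}
    (hf : IsSmoothFun f) (hZ : IsSmoothField Z)
    (hV : IsSmoothVField V) (hu : u ∈ slit n M) :
    classicalCurvature D (f • V) W Z u = f u • classicalCurvature D V W Z u := by
  have h : (fun v => D Z v ((f • V) v)) = f • (fun v => D Z v (V v)) := by
    funext v
    exact map_smul (D Z v) _ _
  have e : (f • V) u = f u • V u := rfl
  simp only [classicalCurvature]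
  rw [h, conn_smul hD hf (hZ.conn hD hV) hu, mlieBracket_smul_left' hf hV hu, map_add, e, map_smul,
    map_smul, map_smul]
  module

lemma classicalCurvature_add (hD : IsLinearConnection D) (hZ : IsSmoothField Z)
    (hZ' : IsSmoothField Z') (hV : IsSmoothVField V) (hW : IsSmoothVField W) (hu : u ∈ slit n M) :
    classicalCurvature D V W (Z + Z') u =
      classicalCurvature D V W Z u + classicalCurvature D V W Z' u := by
  have h : ∀ {V : VField n M}, IsSmoothVField V → D (fun v => D (Z + Z') v (V v)) u =
      D ((fun v => D Z v (V v)) + fun v => D Z' v (V v)) u := by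
    intro V hV
    refine conn_congr hD ((hZ.conn hD hV).add (hZ'.conn hD hV)) hu ?_
    filter_upwards [slit_mem_nhds hu] with v hv using conn_add hD hZ hZ' hv _
  simp only [classicalCurvature]
  rw [h hV, h hW, conn_add hD (hZ.conn hD hV) (hZ'.conn hD hV) hu,
    conn_add hD (hZ.conn hD hW) (hZ'.conn hD hW) hu, conn_add hD hZ hZ' hu]
  abel

lemma classicalCurvature_smul (hD : IsLinearConnection D) {f : TM n M → ℝ}
    (hf : IsSmoothFun f) (hZ : IsSmoothField Z) (hV : IsSmoothVField V) (hW : IsSmoothVField W)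
    {U : VField n M} (hU : IsSmoothVField U) (hu : u ∈ slit n M) (hne : U u ≠ 0) :
    classicalCurvature D V W (f • Z) u = f u • classicalCurvature D V W Z u := by
  have h : ∀ {V : VField n M}, IsSmoothVField V → D (fun v => D (f • Z) v (V v)) u =
      D (f • (fun v => D Z v (V v)) + (fun v => mvfderiv (𝓡 n).tangent f v (V v)) • Z) u := by
    intro V hV
    refine conn_congr hD ((hZ.conn hD hV).smul hf |>.add (hZ.smul (hf.mvfderiv hV))) hu ?_
    filter_upwards [slit_mem_nhds hu] with v hv using conn_smul hD hf hZ hv _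
  have h2 : ∀ {V : VField n M}, IsSmoothVField V → ∀ w, D (fun v => D (f • Z) v (V v)) u w =
      (f u • D (fun v => D Z v (V v)) u w + mvfderiv (𝓡 n).tangent f u w • D Z u (V u)) +
      (mvfderiv (𝓡 n).tangent f u (V u) • D Z u w + mvfderiv (𝓡 n).tangent (fun v => mvfderiv (𝓡 n).tangent f v (V v)) u w • Z u) := by
    intro V hV w
    rw [h hV, conn_add hD ((hZ.conn hD hV).smul hf) (hZ.smul (hf.mvfderiv hV)) hu,
      conn_smul hD hf (hZ.conn hD hV) hu, conn_smul hD (hf.mvfderiv hV) hZ hu]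
  simp only [classicalCurvature]
  rw [h2 hV, h2 hW, conn_smul hD hf hZ hu, mvfderiv_mlieBracket hV hW hU hf hu hne]
  module

lemma classicalCurvature_congr (hD : IsLinearConnection D) {W' : VField n M}
    (hZ : IsSmoothField Z) (hV : IsSmoothVField V) (hW : IsSmoothVField W)
    (hu : u ∈ slit n M) (hZe : ∀ᶠ v in 𝓝 u, Z' v = Z v) (hVe : ∀ᶠ v in 𝓝 u, V' v = V v)
    (hWe : ∀ᶠ v in 𝓝 u, W' v = W v) :
    classicalCurvature D V' W' Z' u = classicalCurvature D V W Z u := by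
  have h : ∀ᶠ v in 𝓝 u, D Z' v = D Z v := by
    filter_upwards [slit_mem_nhds hu, hZe.eventually_nhds] with v hv he using conn_congr hD hZ hv he
  have h1 : D (fun v => D Z' v (V' v)) u = D (fun v => D Z v (V v)) u :=
    conn_congr hD (hZ.conn hD hV) hu (by filter_upwards [h, hVe] with v h1 h2; rw [h1, h2])
  have h2 : D (fun v => D Z' v (W' v)) u = D (fun v => D Z v (W v)) u :=
    conn_congr hD (hZ.conn hD hW) hu (by filter_upwards [h, hWe] with v h1 h2; rw [h1, h2])
  have h3 : (VectorField.mlieBracket (𝓡 n).tangent V' W') u = (VectorField.mlieBracket (𝓡 n).tangent V W) u := Filter.EventuallyEq.mlieBracket_vectorField_eq hVe hWe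
  rw [classicalCurvature, classicalCurvature, h1, h2, h3, h.self_of_nhds, hVe.self_of_nhds,
    hWe.self_of_nhds]

end Classical

/-! ### Tensors on π-vector fields -/

/-- A tensor field of type `(1,3)`, as an operator on π-vector fields. -/
structure IsTensorField (T : PiField n M → PiField n M → PiField n M → PiField n M) : Prop where
  smooth : ∀ X Y Z, IsSmoothField X → IsSmoothField Y → IsSmoothField Z → IsSmoothField (T X Y Z)
  add₁ : ∀ X X' Y Z, IsSmoothField X → IsSmoothField X' → IsSmoothField Y → IsSmoothField Z →
    ∀ u ∈ slit n M, T (X + X') Y Z u = T X Y Z u + T X' Y Z u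
  add₂ : ∀ X Y Y' Z, IsSmoothField X → IsSmoothField Y → IsSmoothField Y' → IsSmoothField Z →
    ∀ u ∈ slit n M, T X (Y + Y') Z u = T X Y Z u + T X Y' Z u
  add₃ : ∀ X Y Z Z', IsSmoothField X → IsSmoothField Y → IsSmoothField Z → IsSmoothField Z' →
    ∀ u ∈ slit n M, T X Y (Z + Z') u = T X Y Z u + T X Y Z' u
  smul₁ : ∀ f X Y Z, IsSmoothFun f → IsSmoothField X → IsSmoothField Y → IsSmoothField Z →
    ∀ u ∈ slit n M, T (f • X) Y Z u = f u • T X Y Z u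
  smul₂ : ∀ f X Y Z, IsSmoothFun f → IsSmoothField X → IsSmoothField Y → IsSmoothField Z →
    ∀ u ∈ slit n M, T X (f • Y) Z u = f u • T X Y Z u
  smul₃ : ∀ f X Y Z, IsSmoothFun f → IsSmoothField X → IsSmoothField Y → IsSmoothField Z →
    ∀ u ∈ slit n M, T X Y (f • Z) u = f u • T X Y Z u

lemma IsSmoothFun.comp_proj {f : M → ℝ} (hf : ContMDiff (𝓡 n) 𝓘(ℝ, ℝ) ∞ f) :
    IsSmoothFun (fun u : TM n M => f u.proj) := (hf.comp contMDiff_projTM).contMDiffOn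

section

variable [T2Space M]

/-- A function-linear operator on smooth fields is determined by its values on frames. -/
lemma tensor_expand {A : Type*} [AddCommGroup A] [Module ℝ A] (Φ : PiField n M → A) {u : TM n M}
    (hadd : ∀ X Y, IsSmoothField X → IsSmoothField Y → Φ (X + Y) = Φ X + Φ Y)
    (hsmul : ∀ f X, IsSmoothFun f → IsSmoothField X → Φ (f • X) = f u • Φ X)
    {x₀ : M} (hx : u.proj ∈ dom n x₀) {X : PiField n M} (hX : IsSmoothField X) :
    Φ X = ∑ i, cofr x₀ i u (X u) • Φ (fr x₀ i) := by
  classical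
  have hsum : ∀ (s : Finset (Fin n)) (Y : Fin n → PiField n M), (∀ i, IsSmoothField (Y i)) →
      Φ (∑ i ∈ s, Y i) = ∑ i ∈ s, Φ (Y i) := by
    intro s Y hY
    induction s using Finset.induction_on with
    | empty =>
      rw [Finset.sum_empty, Finset.sum_empty]
      have := hsmul (fun _ => 0) X (IsSmoothFun.const 0) hX
      have e : (fun _ : TM n M => (0 : ℝ)) • X = 0 := by
        funext v; exact zero_smul ℝ (X v)
      rwa [e, zero_smul] at this
    | insert a s ha ih =>
      rw [Finset.sum_insert ha, Finset.sum_insert ha,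
        hadd _ _ (hY a) (IsSmoothField.sum' fun i _ => hY i), ih]
  have hψ : IsSmoothFun (fun v : TM n M => cutoff n x₀ v.proj ^ 2) :=
    IsSmoothFun.comp_proj ((cutoff n x₀).contMDiff.pow 2)
  have h1 := hsmul _ X hψ hX
  rw [cutoff_eq_one hx, one_pow, one_smul] at h1
  rw [← h1, cutoff_sq_smul, hsum _ _ fun i =>
    (isSmoothField_fr x₀ i).smul (isSmoothFun_cofr x₀ i hX)]
  exact Finset.sum_congr rfl fun i _ => hsmul _ _ (isSmoothFun_cofr x₀ i hX) (isSmoothField_fr x₀ i)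

lemma hlift_add (X Y : PiField n M) : hlift D (X + Y) = hlift D X + hlift D Y := by
  funext u; exact map_add (beta D u) _ _

lemma hlift_smul (f : TM n M → ℝ) (X : PiField n M) : hlift D (f • X) = f • hlift D X := by
  funext u; exact map_smul (beta D u) _ _

lemma isTensorField_curvR (hD : IsLinearConnection D) (hr : IsRegular D) :
    IsTensorField (curvR D) where
  smooth X Y Z hX hY hZ := hZ.classicalCurvature hD (hX.hlift hD hr) (hY.hlift hD hr)
  add₁ X X' Y Z hX hX' hY hZ u hu := by
    rw [curvR, hlift_add]
    exact classicalCurvature_add_left hD hZ (hX.hlift hD hr) (hX'.hlift hD hr) hu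
  add₂ X Y Y' Z hX hY hY' hZ u hu := by
    rw [curvR, curvR, curvR, hlift_add, classicalCurvature_swap,
      classicalCurvature_add_left hD hZ (hY.hlift hD hr) (hY'.hlift hD hr) hu, neg_add,
      ← classicalCurvature_swap, ← classicalCurvature_swap]
  add₃ X Y Z Z' hX hY hZ hZ' u hu :=
    classicalCurvature_add hD hZ hZ' (hX.hlift hD hr) (hY.hlift hD hr) hu
  smul₁ f X Y Z hf hX hY hZ u hu := by
    rw [curvR, hlift_smul]
    exact classicalCurvature_smul_left hD hf hZ (hX.hlift hD hr) hu
  smul₂ f X Y Z hf hX hY hZ u hu := by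
    rw [curvR, curvR, hlift_smul, classicalCurvature_swap,
      classicalCurvature_smul_left hD hf hZ (hY.hlift hD hr) hu, ← smul_neg,
      ← classicalCurvature_swap]
  smul₃ f X Y Z hf hX hY hZ u hu := by
    refine classicalCurvature_smul hD hf hZ (hX.hlift hD hr) (hY.hlift hD hr)
      (isSmoothField_eta.hlift hD hr) hu fun h => hu ?_
    have h1 := rho_beta hr hu (eta u)
    have h2 := (congrArg (rho u) h).symm.trans h1
    rw [map_zero] at h2
    exact h2.symm

lemma curvR_congr (hD : IsLinearConnection D) (hr : IsRegular D) {X Y Z X' Y' Z' : PiField n M}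
    (hX : IsSmoothField X) (hY : IsSmoothField Y) (hZ : IsSmoothField Z) {u : TM n M}
    (hu : u ∈ slit n M) (hXe : ∀ᶠ v in 𝓝 u, X' v = X v) (hYe : ∀ᶠ v in 𝓝 u, Y' v = Y v)
    (hZe : ∀ᶠ v in 𝓝 u, Z' v = Z v) : curvR D X' Y' Z' u = curvR D X Y Z u :=
  classicalCurvature_congr hD hZ (hX.hlift hD hr) (hY.hlift hD hr) hu hZe
    (by filter_upwards [hXe] with v hv; exact congrArg (beta D v) hv)
    (by filter_upwards [hYe] with v hv; exact congrArg (beta D v) hv)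

/-- The curvature of homogeneous fields is homogeneous. -/
lemma curvR_dil (hL : IsFinsler L) (hC : IsCartanConnection L D) {X Y Z : PiField n M}
    (hX : IsSmoothField X) (hY : IsSmoothField Y) (hZ : IsSmoothField Z) {c : ℝ} (hc : 0 < c)
    (hXc : ∀ v ∈ slit n M, (fib (dil c v)).symm (X (dil c v)) = (fib v).symm (X v))
    (hYc : ∀ v ∈ slit n M, (fib (dil c v)).symm (Y (dil c v)) = (fib v).symm (Y v))
    (hZc : ∀ v ∈ slit n M, (fib (dil c v)).symm (Z (dil c v)) = (fib v).symm (Z v))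
    {u : TM n M} (hu : u ∈ slit n M) :
    (fib (dil c u)).symm (curvR D X Y Z (dil c u)) = (fib u).symm (curvR D X Y Z u) := by
  have hu' := dil_mem_slit hc.ne' hu
  have hD := hC.linear
  have hr := hC.regular
  have hl : ∀ {X : PiField n M},
      (∀ v ∈ slit n M, (fib (dil c v)).symm (X (dil c v)) = (fib v).symm (X v)) →
      ∀ v ∈ slit n M, hlift D X (dil c v) = ddil c v (hlift D X v) := by
    intro X hXc v hv
    refine Eq.trans ?_ (beta_dil hL hC hc hv (X v))
    exact congrArg (fun w : EuclideanSpace ℝ (Fin n) => beta D (dil c v) w) (hXc v hv)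
  have hd : ∀ {Z : PiField n M}, IsSmoothField Z →
      (∀ v ∈ slit n M, (fib (dil c v)).symm (Z (dil c v)) = (fib v).symm (Z v)) →
      ∀ v ∈ slit n M, ∀ w,
        (fib (dil c v)).symm (D Z (dil c v) (ddil c v w)) = (fib v).symm (D Z v w) := by
    intro Z hZ hZc v hv w
    rw [conn_dil hL hC hZ (k := 1) hc (fun v hv => by rw [one_smul]; exact hZc v hv) hv, one_smul]
  have hDh : ∀ {X : PiField n M},
      (∀ v ∈ slit n M, (fib (dil c v)).symm (X (dil c v)) = (fib v).symm (X v)) →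
      ∀ v ∈ slit n M, (fib (dil c v)).symm ((fun v => D Z v (hlift D X v)) (dil c v)) =
        (fib v).symm ((fun v => D Z v (hlift D X v)) v) := by
    intro X hXc v hv
    change (fib (dil c v)).symm (D Z (dil c v) (hlift D X (dil c v))) = _
    rw [hl hXc v hv]
    exact hd hZ hZc v hv _
  have hb : (VectorField.mlieBracket (𝓡 n).tangent (hlift D X) (hlift D Y)) (dil c u) = ddil c u ((VectorField.mlieBracket (𝓡 n).tangent (hlift D X) (hlift D Y)) u) := by
    have : IsManifold (𝓡 n).tangent 2 (TM n M) :=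
      IsManifold.of_le (n := ∞) (WithTop.coe_le_coe.2 (le_top : (2 : ℕ∞) ≤ ⊤))
    exact (mfderiv_mlieBracket_of_related (I := (𝓡 n).tangent) (I' := (𝓡 n).tangent)
      (f := dil c) (x := u)
      ((contMDiff_dil c u).of_le (WithTop.coe_le_coe.2 (le_top : (2 : ℕ∞) ≤ ⊤)))
      ((hX.hlift hD hr).mdiffAt hu) ((hY.hlift hD hr).mdiffAt hu)
      ((hX.hlift hD hr).mdiffAt hu') ((hY.hlift hD hr).mdiffAt hu')
      (by filter_upwards [slit_mem_nhds hu] with v hv using (hl hXc v hv).symm)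
      (by filter_upwards [slit_mem_nhds hu] with v hv using (hl hYc v hv).symm)).symm
  rw [curvR, classicalCurvature, hb, hl hXc u hu, hl hYc u hu, map_add, map_add, map_neg,
    hd hZ hZc u hu, hd (hZ.conn hD (hX.hlift hD hr)) (hDh hXc) u hu,
    hd (hZ.conn hD (hY.hlift hD hr)) (hDh hYc) u hu]
  rfl

end

end Finsler
end

noncomputable section
namespace Finsler

variable {n : ℕ} {M : Type*} [TopologicalSpace M] [ChartedSpace (EuclideanSpace ℝ (Fin n)) M]
  [IsManifold (𝓡 n) ∞ M]

/-! ### Tensors of type `(0,2)` -/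

/-- A tensor field of type `(0,2)`, as an operator on π-vector fields. -/
structure IsBilinField (S : PiField n M → PiField n M → TM n M → ℝ) : Prop where
  smooth : ∀ X Y, IsSmoothField X → IsSmoothField Y → IsSmoothFun (S X Y)
  add₁ : ∀ X X' Y, IsSmoothField X → IsSmoothField X' → IsSmoothField Y →
    ∀ u ∈ slit n M, S (X + X') Y u = S X Y u + S X' Y u
  add₂ : ∀ X Y Y', IsSmoothField X → IsSmoothField Y → IsSmoothField Y' →
    ∀ u ∈ slit n M, S X (Y + Y') u = S X Y u + S X Y' u
  smul₁ : ∀ f X Y, IsSmoothFun f → IsSmoothField X → IsSmoothField Y →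
    ∀ u ∈ slit n M, S (f • X) Y u = f u * S X Y u
  smul₂ : ∀ f X Y, IsSmoothFun f → IsSmoothField X → IsSmoothField Y →
    ∀ u ∈ slit n M, S X (f • Y) u = f u * S X Y u

section

variable [T2Space M]

lemma IsBilinField.expand {S : PiField n M → PiField n M → TM n M → ℝ} (hS : IsBilinField S)
    {x₀ : M} {u : TM n M} (hu : u ∈ slit n M) (hx : u.proj ∈ dom n x₀) {X Y : PiField n M}
    (hX : IsSmoothField X) (hY : IsSmoothField Y) :
    S X Y u = ∑ i, ∑ j, cofr x₀ i u (X u) * (cofr x₀ j u (Y u) * S (fr x₀ i) (fr x₀ j) u) := by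
  rw [tensor_expand (fun X => S X Y u) (fun X X' hX hX' => hS.add₁ X X' Y hX hX' hY u hu)
    (fun f X hf hX => hS.smul₁ f X Y hf hX hY u hu) hx hX]
  refine Finset.sum_congr rfl fun i _ => ?_
  rw [tensor_expand (fun Y => S (fr x₀ i) Y u)
    (fun Y Y' hY hY' => hS.add₂ _ Y Y' (isSmoothField_fr x₀ i) hY hY' u hu)
    (fun f Y hf hY => hS.smul₂ f _ Y hf (isSmoothField_fr x₀ i) hY u hu) hx hY, Finset.smul_sum]
  rfl

/-- The π-form defined by an operator on π-vector fields. -/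
def toTwoForm (S : PiField n M → PiField n M → TM n M → ℝ) : TwoForm n M := fun u =>
  ∑ i, ∑ j, S (fr u.proj i) (fr u.proj j) u • (cofr u.proj i u).smulRight (cofr u.proj j u)

lemma toTwoForm_eq (S : PiField n M → PiField n M → TM n M → ℝ) (u : TM n M) (v w : PB n M u) :
    toTwoForm S u v w = ∑ i, ∑ j, cofr u.proj i u v * (cofr u.proj j u w *
      S (fr u.proj i) (fr u.proj j) u) := by
  simp only [toTwoForm, sum_apply, smul_apply, ContinuousLinearMap.smulRight_apply, smul_eq_mul]
  refine Finset.sum_congr rfl fun i _ => Finset.sum_congr rfl fun j _ => ?_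
  ring

lemma IsBilinField.toTwoForm_apply {S : PiField n M → PiField n M → TM n M → ℝ}
    (hS : IsBilinField S) {u : TM n M} (hu : u ∈ slit n M) {X Y : PiField n M}
    (hX : IsSmoothField X) (hY : IsSmoothField Y) : toTwoForm S u (X u) (Y u) = S X Y u := by
  rw [toTwoForm_eq, hS.expand hu (mem_dom u.proj) hX hY]

lemma IsBilinField.isTwoForm {S : PiField n M → PiField n M → TM n M → ℝ} (hS : IsBilinField S)
    (hom : ∀ X Y : Π x : M, TangentSpace (𝓡 n) x, IsSmoothBase X → IsSmoothBase Y →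
      ∀ u ∈ slit n M, ∀ c : ℝ, 0 < c → S (basic X) (basic Y) (dil c u) = S (basic X) (basic Y) u) :
    IsTwoForm (toTwoForm S) where
  smooth X Y hX hY := (hS.smooth X Y hX hY).congr fun u hu => hS.toTwoForm_apply hu hX hY
  homogeneous x y c hc hy v w := by
    let u : TM n M := ⟨x, y⟩
    have h1 := toTwoForm_eq S u v w
    have h2 := toTwoForm_eq S (dil c u) v w
    refine h2.trans (Eq.trans ?_ h1.symm)
    refine Finset.sum_congr rfl fun i _ => Finset.sum_congr rfl fun j _ => ?_
    have h3 := hom _ _ (contMDiff_baseFrame x i) (contMDiff_baseFrame x j) u hy c hc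
    exact congrArg (fun a => cofr x i u v * (cofr x j u w * a)) h3

end

/-! ### The preferred frames -/

variable {L : TM n M → ℝ} {D : Conn n M}

lemma frame_self (u : TM n M) (i : Fin n) :
    frame u i u = fib u (EuclideanSpace.single i (1 : ℝ)) := FiberBundle.extend_apply_self _ _

lemma sum_coord_smul (u : TM n M) (w : PB n M u) :
    w = ∑ i, coord u i w • fib u (EuclideanSpace.single i (1 : ℝ)) := by
  have := (EuclideanSpace.basisFun (Fin n) ℝ).sum_repr ((fib u).symm w)
  simp only [EuclideanSpace.basisFun_repr, EuclideanSpace.basisFun_apply] at this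
  exact this.symm

section

variable [T2Space M]

lemma exists_frame_eq (u : TM n M) (i : Fin n) :
    ∃ F : PiField n M, IsSmoothField F ∧ ∀ᶠ v in 𝓝 u, frame u i v = F v := by
  let t := trivializationAt (EuclideanSpace ℝ (Fin n)) (TangentSpace (𝓡 n) : M → Type _) u.proj
  let t' := trivializationAt (EuclideanSpace ℝ (Fin n)) (PB n M) u
  let w : EuclideanSpace ℝ (Fin n) := (t' ⟨u, fib u (EuclideanSpace.single i (1 : ℝ))⟩).2
  refine ⟨fun v => ∑ k, w k • fr u.proj k v, ?_, ?_⟩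
  · exact IsSmoothField.sum fun k _ => (isSmoothField_fr u.proj k).smul (IsSmoothFun.const (w k))
  · filter_upwards [eventually_dom (mem_dom (n := n) u.proj)] with v hv
    have hb : v.proj ∈ t.baseSet := dom_subset u.proj hv
    have hb' : v ∈ t'.baseSet := hb
    have h1 : (t (⟨v.proj, frame u i v⟩ : TM n M)).2 = w := by
      have h0 := congrArg Prod.snd (t'.apply_mk_symm hb' w)
      exact h0
    have h2 : Trivialization.continuousLinearMapAt ℝ t v.proj (frame u i v) = w :=
      (t.continuousLinearMapAt_apply_of_mem (R := ℝ) hb _).trans h1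
    have h3 : ∀ k, cofr u.proj k v (frame u i v) = w k := fun k => by
      rw [cofr_apply, cutoff_eq_one hv, one_mul]
      exact congrArg (fun a : EuclideanSpace ℝ (Fin n) => a k) h2
    rw [sum_cofr_smul_fr hv (frame u i v)]
    simp only [h3]

/-! ### The horizontal Ricci tensor -/

lemma ricci_congr (hD : IsLinearConnection D) (hr : IsRegular D) {X Y X' Y' : PiField n M}
    (hX : IsSmoothField X) (hY : IsSmoothField Y) {u : TM n M}
    (hu : u ∈ slit n M) (hXe : ∀ᶠ v in 𝓝 u, X' v = X v) (hYe : ∀ᶠ v in 𝓝 u, Y' v = Y v) :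
    ricci D X' Y' u = ricci D X Y u := by
  refine Finset.sum_congr rfl fun i _ => ?_
  obtain ⟨F, hF, hFe⟩ := exists_frame_eq u i
  rw [curvR_congr hD hr hX hF hY hu hXe hFe hYe,
    curvR_congr hD hr hX hF hY hu (Filter.Eventually.of_forall fun _ => rfl) hFe
      (Filter.Eventually.of_forall fun _ => rfl)]

lemma curvR_expand (hD : IsLinearConnection D) (hr : IsRegular D) {X Z Y : PiField n M}
    (hX : IsSmoothField X) (hZ : IsSmoothField Z) (hY : IsSmoothField Y) {x₀ : M} {u : TM n M}
    (hu : u ∈ slit n M) (hx : u.proj ∈ dom n x₀) :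
    curvR D X Z Y u = ∑ m, cofr x₀ m u (Z u) • curvR D X (fr x₀ m) Y u :=
  have hT := isTensorField_curvR hD hr
  tensor_expand (fun Z => curvR D X Z Y u) (fun Z Z' hZ hZ' => hT.add₂ X Z Z' Y hX hZ hZ' hY u hu)
    (fun f Z hf hZ => hT.smul₂ f X Z Y hf hX hZ hY u hu) hx hZ

lemma ricci_eq (hD : IsLinearConnection D) (hr : IsRegular D) {X Y : PiField n M}
    (hX : IsSmoothField X) (hY : IsSmoothField Y) {x₀ : M} {u : TM n M}
    (hu : u ∈ slit n M) (hx : u.proj ∈ dom n x₀) :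
    ricci D X Y u = ∑ l, cofr x₀ l u (curvR D X (fr x₀ l) Y u) := by
  have h1 : ∀ i, coord u i (curvR D X (frame u i) Y u) =
      ∑ m, cofr x₀ m u (fib u (EuclideanSpace.single i (1 : ℝ))) *
        coord u i (curvR D X (fr x₀ m) Y u) := by
    intro i
    obtain ⟨F, hF, hFe⟩ := exists_frame_eq u i
    rw [curvR_congr hD hr hX hF hY hu (Filter.Eventually.of_forall fun _ => rfl) hFe
      (Filter.Eventually.of_forall fun _ => rfl), curvR_expand hD hr hX hF hY hu hx,
      ← hFe.self_of_nhds, frame_self]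
    let T : PB n M u →ₗ[ℝ] ℝ :=
      ((EuclideanSpace.proj i : EuclideanSpace ℝ (Fin n) →L[ℝ] ℝ).comp
        ((fib u).symm : PB n M u →L[ℝ] EuclideanSpace ℝ (Fin n))).toLinearMap
    refine (map_sum T (fun m => cofr x₀ m u (fib u (EuclideanSpace.single i (1 : ℝ))) •
      curvR D X (fr x₀ m) Y u) Finset.univ).trans ?_
    exact Finset.sum_congr rfl fun m _ =>
      map_smul T (cofr x₀ m u (fib u (EuclideanSpace.single i (1 : ℝ)))) (curvR D X (fr x₀ m) Y u)
  rw [ricci]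
  simp only [h1]
  rw [Finset.sum_comm]
  refine Finset.sum_congr rfl fun m _ => ?_
  have h2 := congrArg (cofr x₀ m u) (sum_coord_smul u (curvR D X (fr x₀ m) Y u))
  rw [map_sum] at h2
  rw [h2]
  refine Finset.sum_congr rfl fun i _ => ?_
  rw [map_smul, smul_eq_mul, mul_comm]

lemma isBilinField_ricci (hD : IsLinearConnection D) (hr : IsRegular D) :
    IsBilinField (ricci D) := by
  have hT := isTensorField_curvR hD hr
  have hfr := fun (x₀ : M) (i : Fin n) => isSmoothField_fr (n := n) x₀ i
  refine ⟨?_, ?_, ?_, ?_, ?_⟩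
  · intro X Y hX hY
    refine isSmoothFun_of_local fun u hu => ⟨fun v => ∑ l, cofr u.proj l v
      (curvR D X (fr u.proj l) Y v), ?_, ?_⟩
    · exact IsSmoothFun.sum fun l _ => isSmoothFun_cofr _ _ (hT.smooth _ _ _ hX (hfr _ l) hY)
    · filter_upwards [slit_mem_nhds hu, eventually_dom (mem_dom (n := n) u.proj)] with v hv hx
      exact ricci_eq hD hr hX hY hv hx
  · intro X X' Y hX hX' hY u hu
    have hx := mem_dom (n := n) u.proj
    rw [ricci_eq hD hr (hX.add hX') hY hu hx, ricci_eq hD hr hX hY hu hx,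
      ricci_eq hD hr hX' hY hu hx, ← Finset.sum_add_distrib]
    exact Finset.sum_congr rfl fun l _ => by
      rw [hT.add₁ _ _ _ _ hX hX' (hfr _ _) hY u hu, map_add]
  · intro X Y Y' hX hY hY' u hu
    have hx := mem_dom (n := n) u.proj
    rw [ricci_eq hD hr hX (hY.add hY') hu hx, ricci_eq hD hr hX hY hu hx,
      ricci_eq hD hr hX hY' hu hx, ← Finset.sum_add_distrib]
    exact Finset.sum_congr rfl fun l _ => by
      rw [hT.add₃ _ _ _ _ hX (hfr _ _) hY hY' u hu, map_add]
  · intro f X Y hf hX hY u hu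
    have hx := mem_dom (n := n) u.proj
    rw [ricci_eq hD hr (hX.smul hf) hY hu hx, ricci_eq hD hr hX hY hu hx, Finset.mul_sum]
    exact Finset.sum_congr rfl fun l _ => by
      rw [hT.smul₁ _ _ _ _ hf hX (hfr _ _) hY u hu, map_smul, smul_eq_mul]
  · intro f X Y hf hX hY u hu
    have hx := mem_dom (n := n) u.proj
    rw [ricci_eq hD hr hX (hY.smul hf) hu hx, ricci_eq hD hr hX hY hu hx, Finset.mul_sum]
    exact Finset.sum_congr rfl fun l _ => by
      rw [hT.smul₃ _ _ _ _ hf hX (hfr _ _) hY u hu, map_smul, smul_eq_mul]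

lemma isBilinField_metric (hL : IsFinsler L) :
    IsBilinField (fun X Y u => metric L u (X u) (Y u)) where
  smooth _ _ hX hY := isSmoothFun_metric hL hX hY
  add₁ _ _ _ _ _ _ u _ := metric_add_left u _ _ _
  add₂ _ _ _ _ _ _ u _ := metric_add_right u _ _ _
  smul₁ _ _ _ _ _ _ u _ := metric_smul_left u _ _ _
  smul₂ _ _ _ _ _ _ u _ := metric_smul_right u _ _ _

lemma ricci_basic_dil (hL : IsFinsler L) (hC : IsCartanConnection L D)
    {X Y : Π x : M, TangentSpace (𝓡 n) x} (hX : IsSmoothBase X) (hY : IsSmoothBase Y)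
    {u : TM n M} (hu : u ∈ slit n M) {c : ℝ} (hc : 0 < c) :
    ricci D (basic X) (basic Y) (dil c u) = ricci D (basic X) (basic Y) u := by
  have hu' := dil_mem_slit hc.ne' hu
  have hx := mem_dom (n := n) u.proj
  have hXs := isSmoothField_basic hX
  have hYs := isSmoothField_basic hY
  rw [ricci_eq hC.linear hC.regular hXs hYs hu' (x₀ := u.proj) hx,
    ricci_eq hC.linear hC.regular hXs hYs hu hx]
  refine Finset.sum_congr rfl fun l _ => ?_
  have h := curvR_dil hL hC hXs (isSmoothField_fr u.proj l) hYs hc (fun _ _ => rfl)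
    (fun _ _ => rfl) (fun _ _ => rfl) hu
  exact congrArg (fun w : EuclideanSpace ℝ (Fin n) => cofr u.proj l u w) h

/-! ### The horizontal scalar curvature -/

/-- The matrix of a tensor of type `(0,2)` in a coordinate frame. -/
def frameMatrix (S : PiField n M → PiField n M → TM n M → ℝ) (x₀ : M) (u : TM n M) :
    Matrix (Fin n) (Fin n) ℝ := Matrix.of fun i j => S (fr x₀ i) (fr x₀ j) u

lemma scalarCurv_eq (hL : IsFinsler L) (hD : IsLinearConnection D) (hr : IsRegular D) {x₀ : M}
    {u : TM n M} (hu : u ∈ slit n M) (hx : u.proj ∈ dom n x₀) :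
    scalarCurv L D u = ((frameMatrix (fun X Y u => metric L u (X u) (Y u)) x₀ u)⁻¹ *
      frameMatrix (ricci D) x₀ u).trace := by
  choose F hF hFe using exists_frame_eq (n := n) u
  let P : Matrix (Fin n) (Fin n) ℝ := Matrix.of fun i m => cofr x₀ m u (F i u)
  have key : ∀ {S : PiField n M → PiField n M → TM n M → ℝ}, IsBilinField S →
      (Matrix.of fun i j : Fin n => S (F i) (F j) u) = P * frameMatrix S x₀ u * P.transpose := by
    intro S hS
    ext i j
    simp only [Matrix.of_apply, Matrix.mul_apply, Matrix.transpose_apply, P, frameMatrix]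
    rw [hS.expand hu hx (hF i) (hF j), Finset.sum_comm]
    refine Finset.sum_congr rfl fun k _ => ?_
    rw [Finset.sum_mul]
    exact Finset.sum_congr rfl fun l _ => by ring
  have hP : P * (Matrix.of fun m j => coord u j (fr x₀ m u)) = 1 := by
    ext i j
    simp only [Matrix.mul_apply, P, Matrix.of_apply]
    let T : PB n M u →ₗ[ℝ] ℝ :=
      ((EuclideanSpace.proj j : EuclideanSpace ℝ (Fin n) →L[ℝ] ℝ).comp
        ((fib u).symm : PB n M u →L[ℝ] EuclideanSpace ℝ (Fin n))).toLinearMap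
    have h := congrArg T (sum_cofr_smul_fr hx (F i u))
    rw [map_sum] at h
    have h2 : T (F i u) = (1 : Matrix (Fin n) (Fin n) ℝ) i j := by
      rw [← (hFe i).self_of_nhds, frame_self]
      change (EuclideanSpace.single i (1 : ℝ) : EuclideanSpace ℝ (Fin n)) j = _
      simp [Matrix.one_apply, eq_comm]
    rw [← h2, h]
    exact Finset.sum_congr rfl fun m _ =>
      (map_smul T (cofr x₀ m u (F i u)) (fr x₀ m u)).symm
  have hPu : IsUnit P.det := by
    rw [← Matrix.isUnit_iff_isUnit_det]
    exact IsUnit.of_mul_eq_one _ hP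
  have e1 : (Matrix.of fun i j : Fin n => metric L u (frame u i u) (frame u j u)) =
      P * frameMatrix (fun X Y u => metric L u (X u) (Y u)) x₀ u * P.transpose := by
    rw [← key (isBilinField_metric hL)]
    ext i j
    simp only [Matrix.of_apply]
    rw [(hFe i).self_of_nhds, (hFe j).self_of_nhds]
  have e2 : (Matrix.of fun i j : Fin n => ricci D (frame u i) (frame u j) u) =
      P * frameMatrix (ricci D) x₀ u * P.transpose := by
    rw [← key (isBilinField_ricci hD hr)]
    ext i j
    simp only [Matrix.of_apply]
    exact ricci_congr hD hr (hF i) (hF j) hu (hFe i) (hFe j)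
  rw [scalarCurv, e1, e2]
  generalize frameMatrix (fun X Y u => metric L u (X u) (Y u)) x₀ u = G
  generalize frameMatrix (ricci D) x₀ u = R
  have hPt : IsUnit P.transpose.det := by rwa [Matrix.det_transpose]
  rw [Matrix.mul_inv_rev, Matrix.mul_inv_rev]
  have e3 : (P.transpose)⁻¹ * (G⁻¹ * P⁻¹) * (P * R * P.transpose) =
      (P.transpose)⁻¹ * (G⁻¹ * R * P.transpose) := by
    have : P⁻¹ * (P * R * P.transpose) = R * P.transpose := by
      rw [mul_assoc P, Matrix.nonsing_inv_mul_cancel_left _ _ hPu]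
    rw [mul_assoc, mul_assoc G⁻¹, this, ← mul_assoc G⁻¹]
  rw [e3, Matrix.trace_mul_comm, mul_assoc, Matrix.mul_nonsing_inv _ hPt, mul_one]

lemma det_frameMatrix_metric_ne_zero (hL : IsFinsler L) {x₀ : M} {u : TM n M} (hu : u ∈ slit n M)
    (hx : u.proj ∈ dom n x₀) :
    (frameMatrix (fun X Y u => metric L u (X u) (Y u)) x₀ u).det ≠ 0 := by
  intro h0
  obtain ⟨c, hc, h⟩ := Matrix.exists_mulVec_eq_zero_iff.2 h0
  apply hc
  have h1 : ∀ i, metric L u (fr x₀ i u) (∑ j, c j • fr x₀ j u) = 0 := by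
    intro i
    have := congrFun h i
    simp only [Matrix.mulVec, dotProduct, frameMatrix, Matrix.of_apply, Pi.zero_apply] at this
    rw [← this]
    refine (map_sum (metricLin L u (fr x₀ i u)) _ _).trans ?_
    exact Finset.sum_congr rfl fun j _ => (metric_smul_right u _ _ _).trans (mul_comm _ _)
  have h2 : ∑ j, c j • fr x₀ j u = 0 := by
    refine eq_zero_of_metric hL hu fun Y => ?_
    rw [metric_symm hL hu, sum_cofr_smul_fr hx Y]
    have e := congrArg (fun T => T (∑ j, c j • fr x₀ j u))
      (map_sum (metricLin L u) (fun i => cofr x₀ i u Y • fr x₀ i u) Finset.univ)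
    refine e.trans ?_
    rw [LinearMap.sum_apply]
    refine Finset.sum_eq_zero fun i _ => ?_
    refine (metric_smul_left u _ _ _).trans ?_
    exact (congrArg (cofr x₀ i u Y * ·) (h1 i)).trans (mul_zero _)
  funext i
  have h3 := congrArg (cofr x₀ i u) h2
  rw [map_sum, map_zero] at h3
  simp only [map_smul, cofr_fr hx, smul_eq_mul, mul_ite, mul_one, mul_zero, Finset.sum_ite_eq,
    Finset.mem_univ, if_true] at h3
  exact h3

lemma isSmoothFun_scalarCurv (hL : IsFinsler L) (hD : IsLinearConnection D) (hr : IsRegular D) :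
    IsSmoothFun (scalarCurv L D) := by
  intro u hu
  refine ContMDiffAt.contMDiffWithinAt ?_
  have hx := mem_dom (n := n) u.proj
  have hg := fun i j => (isBilinField_metric hL).smooth _ _ (isSmoothField_fr u.proj i)
    (isSmoothField_fr u.proj j)
  have hR := fun i j => (isBilinField_ricci hD hr).smooth _ _ (isSmoothField_fr u.proj i)
    (isSmoothField_fr u.proj j)
  have hinv := contMDiffAt_matrix_inv (P := frameMatrix (fun X Y u => metric L u (X u) (Y u)) u.proj)
    (fun i j => (hg i j).contMDiffAt hu) (det_frameMatrix_metric_ne_zero hL hu hx)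
  have h : ContMDiffAt (𝓡 n).tangent 𝓘(ℝ, ℝ) ∞ (fun v => ∑ i, ∑ j,
      (frameMatrix (fun X Y u => metric L u (X u) (Y u)) u.proj v)⁻¹ i j *
        ricci D (fr u.proj j) (fr u.proj i) v) u :=
    contMDiffAt_finsetSum fun i _ => contMDiffAt_finsetSum fun j _ =>
      (hinv i j).mul ((hR j i).contMDiffAt hu)
  refine h.congr_of_eventuallyEq ?_
  filter_upwards [slit_mem_nhds hu, eventually_dom hx] with v hv hvx
  rw [scalarCurv_eq hL hD hr hv hvx]
  rfl

lemma scalarCurv_dil (hL : IsFinsler L) (hC : IsCartanConnection L D) {u : TM n M}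
    (hu : u ∈ slit n M) {c : ℝ} (hc : 0 < c) : scalarCurv L D (dil c u) = scalarCurv L D u := by
  have hu' := dil_mem_slit hc.ne' hu
  have hx := mem_dom (n := n) u.proj
  rw [scalarCurv_eq hL hC.linear hC.regular hu' (x₀ := u.proj) hx,
    scalarCurv_eq hL hC.linear hC.regular hu hx]
  have e1 : frameMatrix (fun X Y u => metric L u (X u) (Y u)) u.proj (dil c u) =
      frameMatrix (fun X Y u => metric L u (X u) (Y u)) u.proj u := by
    ext i j; exact metric_dil hL hc u _ _
  have e2 : frameMatrix (ricci D) u.proj (dil c u) = frameMatrix (ricci D) u.proj u := by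
    ext i j
    exact ricci_basic_dil hL hC (contMDiff_baseFrame u.proj i) (contMDiff_baseFrame u.proj j) hu hc
  rw [e1, e2]

end

end Finsler
end

noncomputable section
namespace Finsler

variable {n : ℕ} {M : Type*} [TopologicalSpace M] [ChartedSpace (EuclideanSpace ℝ (Fin n)) M]
  [IsManifold (𝓡 n) ∞ M]

/-! ### Covariant derivatives of forms -/

variable {L : TM n M → ℝ} {D : Conn n M}

lemma mvfderiv_add_apply {f g : TM n M → ℝ} {u : TM n M} (hf : IsSmoothFun f) (hg : IsSmoothFun g)
    (hu : u ∈ slit n M) (w : TangentSpace (𝓡 n).tangent u) :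
    mvfderiv (𝓡 n).tangent (fun v => f v + g v) u w =
      mvfderiv (𝓡 n).tangent f u w + mvfderiv (𝓡 n).tangent g u w :=
  congrArg (fun T => T w) (mvfderiv_add (hf.mdiffAt hu) (hg.mdiffAt hu))

lemma mvfderiv_sum_apply {ι : Type*} {s : Finset ι} {f : ι → TM n M → ℝ} {u : TM n M}
    (hf : ∀ i, IsSmoothFun (f i)) (hu : u ∈ slit n M) (w : TangentSpace (𝓡 n).tangent u) :
    mvfderiv (𝓡 n).tangent (fun v => ∑ i ∈ s, f i v) u w =
      ∑ i ∈ s, mvfderiv (𝓡 n).tangent (f i) u w := by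
  classical
  induction s using Finset.induction_on with
  | empty =>
    simp only [Finset.sum_empty]
    exact congrArg (fun T => T w) (mvfderiv_const (0 : ℝ))
  | insert a s ha ih =>
    simp only [Finset.sum_insert ha]
    rw [mvfderiv_add_apply (hf a) (IsSmoothFun.sum fun i _ => hf i) hu, ih]

lemma IsBilinField.add {S S' : PiField n M → PiField n M → TM n M → ℝ} (hS : IsBilinField S)
    (hS' : IsBilinField S') : IsBilinField (fun V W u => S V W u + S' V W u) where
  smooth V W hV hW := (hS.smooth V W hV hW).add (hS'.smooth V W hV hW)
  add₁ V V' W hV hV' hW u hu := by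
    rw [hS.add₁ V V' W hV hV' hW u hu, hS'.add₁ V V' W hV hV' hW u hu]; ring
  add₂ V W W' hV hW hW' u hu := by
    rw [hS.add₂ V W W' hV hW hW' u hu, hS'.add₂ V W W' hV hW hW' u hu]; ring
  smul₁ f V W hf hV hW u hu := by
    rw [hS.smul₁ f V W hf hV hW u hu, hS'.smul₁ f V W hf hV hW u hu]; ring
  smul₂ f V W hf hV hW u hu := by
    rw [hS.smul₂ f V W hf hV hW u hu, hS'.smul₂ f V W hf hV hW u hu]; ring

lemma isBilinField_mul {A B : OneForm n M} (hA : IsOneForm A) (hB : IsOneForm B) :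
    IsBilinField (fun V W u => A u (V u) * B u (W u)) where
  smooth V W hV hW := (hA.smooth V hV).mul (hB.smooth W hW)
  add₁ V V' W _ _ _ u _ := by
    rw [← add_mul, ← map_add]; rfl
  add₂ V W W' _ _ _ u _ := by
    rw [← mul_add, ← map_add]; rfl
  smul₁ f V W _ _ _ u _ := by
    rw [← mul_assoc, ← smul_eq_mul (f u), ← map_smul]; rfl
  smul₂ f V W _ _ _ u _ := by
    rw [mul_left_comm, ← smul_eq_mul (f u), ← map_smul]; rfl

section

variable [T2Space M]

lemma IsSmoothField.nabla (hD : IsLinearConnection D) (hr : IsRegular D) {W X : PiField n M}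
    (hW : IsSmoothField W) (hX : IsSmoothField X) : IsSmoothField (Finsler.hD D W X) :=
  hX.conn hD (hW.hlift hD hr)

lemma isBilinField_hDOneForm (hD : IsLinearConnection D) (hr : IsRegular D) {A : OneForm n M}
    (hA : IsOneForm A) : IsBilinField (hDOneForm D A) where
  smooth V W hV hW := ((hA.smooth W hW).mvfderiv (hV.hlift hD hr)).sub
    (hA.smooth _ (hV.nabla hD hr hW))
  add₁ V V' W hV hV' hW u hu := by
    have e1 : Finsler.hD D (V + V') W u = Finsler.hD D V W u + Finsler.hD D V' W u := by
      simp only [Finsler.hD, hlift_add]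
      exact map_add (D W u) _ _
    have e2 : hDFun D (fun v => A v (W v)) u ((V + V') u) = hDFun D (fun v => A v (W v)) u (V u) +
      hDFun D (fun v => A v (W v)) u (V' u) := map_add _ _ _
    rw [hDOneForm, hDOneForm, hDOneForm, e1, e2, map_add]
    ring
  add₂ V W W' hV hW hW' u hu := by
    have e1 : Finsler.hD D V (W + W') u = Finsler.hD D V W u + Finsler.hD D V W' u :=
      conn_add hD hW hW' hu _
    have e2 : hDFun D (fun v => A v ((W + W') v)) u (V u) = hDFun D (fun v => A v (W v)) u (V u) +
        hDFun D (fun v => A v (W' v)) u (V u) := by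
      have : (fun v => A v ((W + W') v)) = fun v => A v (W v) + A v (W' v) := by
        funext v; exact map_add (A v) _ _
      rw [this]
      exact mvfderiv_add_apply (hA.smooth W hW) (hA.smooth W' hW') hu _
    rw [hDOneForm, hDOneForm, hDOneForm, e1, e2, map_add]
    ring
  smul₁ f V W hf hV hW u hu := by
    have e1 : Finsler.hD D (f • V) W u = f u • Finsler.hD D V W u := by
      simp only [Finsler.hD, hlift_smul]
      exact map_smul (D W u) _ _
    have e2 : hDFun D (fun v => A v (W v)) u ((f • V) u) = f u * hDFun D (fun v => A v (W v)) u (V u) :=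
      map_smul (hDFun D (fun v => A v (W v)) u) (f u) (V u)
    rw [hDOneForm, hDOneForm, e1, e2, map_smul, smul_eq_mul]
    ring
  smul₂ f V W hf hV hW u hu := by
    have e1 : Finsler.hD D V (f • W) u = f u • Finsler.hD D V W u +
        mvfderiv (𝓡 n).tangent f u (hlift D V u) • W u := conn_smul hD hf hW hu _
    have e2 : hDFun D (fun v => A v ((f • W) v)) u (V u) = f u * hDFun D (fun v => A v (W v)) u (V u)
        + A u (W u) * mvfderiv (𝓡 n).tangent f u (hlift D V u) := by
      have : (fun v => A v ((f • W) v)) = fun v => f v * A v (W v) := by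
        funext v; exact map_smul (A v) _ _
      rw [this]
      exact mvfderiv_mul_apply hf (hA.smooth W hW) hu _
    rw [hDOneForm, hDOneForm, e1, e2, map_add, map_smul, map_smul, smul_eq_mul, smul_eq_mul]
    ring

lemma IsOneForm.apply_dil {A : OneForm n M} (hA : IsOneForm A) {u : TM n M} (hu : u ∈ slit n M) {c : ℝ}
    (hc : 0 < c) (w : EuclideanSpace ℝ (Fin n)) : A (dil c u) w = A u w :=
  hA.homogeneous u.proj u.snd c hc hu w

lemma hDFun_dil (hL : IsFinsler L) (hC : IsCartanConnection L D) {f : TM n M → ℝ}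
    (hf : IsSmoothFun f) {c : ℝ} (hc : 0 < c) (hfc : ∀ v ∈ slit n M, f (dil c v) = f v)
    {u : TM n M} (hu : u ∈ slit n M) (w : EuclideanSpace ℝ (Fin n)) :
    hDFun D f (dil c u) w = hDFun D f u w := by
  have hu' := dil_mem_slit hc.ne' hu
  change mvfderiv (𝓡 n).tangent f (dil c u) (beta D (dil c u) w) =
    mvfderiv (𝓡 n).tangent f u (beta D u w)
  have h1 : beta D (dil c u) w = ddil c u (beta D u w) := beta_dil hL hC hc hu w
  rw [h1, mvfderiv_dil (hf.mdiffAt hu')]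
  refine congrArg (fun T => T (beta D u w)) (mvfderiv_congr ?_)
  filter_upwards [slit_mem_nhds hu] with v hv using hfc v hv

lemma hDOneForm_basic_dil (hL : IsFinsler L) (hC : IsCartanConnection L D) {A : OneForm n M}
    (hA : IsOneForm A) {X Y : Π x : M, TangentSpace (𝓡 n) x} (hX : IsSmoothBase X)
    (hY : IsSmoothBase Y) {u : TM n M} (hu : u ∈ slit n M) {c : ℝ} (hc : 0 < c) :
    hDOneForm D A (basic X) (basic Y) (dil c u) = hDOneForm D A (basic X) (basic Y) u := by
  have hXs := isSmoothField_basic hX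
  have hYs := isSmoothField_basic hY
  have e1 := hDFun_dil hL hC (hA.smooth _ hYs) hc (fun v hv => hA.apply_dil hv hc (basic Y v)) hu
    (basic X u)
  have h1 : hlift D (basic X) (dil c u) = ddil c u (hlift D (basic X) u) :=
    beta_dil hL hC hc hu (basic X u)
  have h2 := conn_dil hL hC hYs (k := 1) hc (fun v _ => (one_smul ℝ _).symm) hu
    (hlift D (basic X) u)
  rw [one_smul, ← h1] at h2
  have e2 : A (dil c u) (hD D (basic X) (basic Y) (dil c u)) =
      A u (hD D (basic X) (basic Y) u) :=
    (congrArg (fun w : EuclideanSpace ℝ (Fin n) => A (dil c u) w) h2).trans (hA.apply_dil hu hc _)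
  exact congrArg₂ (fun a b : ℝ => a - b) e1 e2

lemma isBilinField_formAlpha (hD : IsLinearConnection D) (hr : IsRegular D) {A : OneForm n M}
    (hA : IsOneForm A) : IsBilinField (formAlpha D A) :=
  (isBilinField_hDOneForm hD hr hA).add (isBilinField_mul hA hA)

lemma isBilinField_formMu (hD : IsLinearConnection D) (hr : IsRegular D) {A B : OneForm n M}
    (hA : IsOneForm A) (hB : IsOneForm B) : IsBilinField (formMu D A B) := by
  have h := (isBilinField_hDOneForm hD hr hB).add (isBilinField_mul hB hA)
  have e : formMu D A B = fun V W u => hDOneForm D B V W u + B u (V u) * A u (W u) := by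
    funext V W u
    rw [formMu, mul_comm]
  rwa [e]

lemma isTwoForm_formAlpha (hL : IsFinsler L) (hC : IsCartanConnection L D) {A : OneForm n M}
    (hA : IsOneForm A) : IsTwoForm (toTwoForm (formAlpha D A)) :=
  (isBilinField_formAlpha hC.linear hC.regular hA).isTwoForm fun X Y hX hY u hu c hc => by
    have h1 : A (dil c u) (basic X (dil c u)) = A u (basic X u) := hA.apply_dil hu hc (basic X u)
    have h2 : A (dil c u) (basic Y (dil c u)) = A u (basic Y u) := hA.apply_dil hu hc (basic Y u)
    rw [formAlpha, formAlpha, hDOneForm_basic_dil hL hC hA hX hY hu hc, h1, h2]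

lemma isTwoForm_formMu (hL : IsFinsler L) (hC : IsCartanConnection L D) {A B : OneForm n M}
    (hA : IsOneForm A) (hB : IsOneForm B) : IsTwoForm (toTwoForm (formMu D A B)) :=
  (isBilinField_formMu hC.linear hC.regular hA hB).isTwoForm fun X Y hX hY u hu c hc => by
    have h1 : B (dil c u) (basic X (dil c u)) = B u (basic X u) := hB.apply_dil hu hc (basic X u)
    have h2 : A (dil c u) (basic Y (dil c u)) = A u (basic Y u) := hA.apply_dil hu hc (basic Y u)
    rw [formMu, formMu, hDOneForm_basic_dil hL hC hB hX hY hu hc, h1, h2]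

lemma toTwoForm_nonZero {S : PiField n M → PiField n M → TM n M → ℝ} (hS : IsBilinField S)
    (h : BilinNonZero S) : (toTwoForm S).NonZero := by
  obtain ⟨X, Y, hX, hY, u, hu, hne⟩ := h
  refine ⟨u, hu, fun h0 => hne ?_⟩
  rw [← hS.toTwoForm_apply hu hX hY, h0]
  rfl

lemma isOneForm_formB₁ (hL : IsFinsler L) (hC : IsCartanConnection L D) {A B : OneForm n M}
    (hA : IsOneForm A) (hB : IsOneForm B) : IsOneForm (formB₁ L D A B) where
  smooth X hX := by
    have hs := isSmoothFun_scalarCurv hL hC.linear hC.regular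
    have h := ((hB.smooth X hX).sub
      ((hs.mul (IsSmoothFun.const ((n : ℝ) * ((n : ℝ) - 1))⁻¹)).mul (hA.smooth X hX))).add
      ((IsSmoothFun.const (1 / ((n : ℝ) * ((n : ℝ) - 1)))).mul
        (hs.mvfderiv (hX.hlift hC.linear hC.regular)))
    exact h
  homogeneous x y c hc hy v := by
    let u : TM n M := ⟨x, y⟩
    have hu : u ∈ slit n M := hy
    have e1 := hDFun_dil hL hC (isSmoothFun_scalarCurv hL hC.linear hC.regular) hc
      (fun w hw => scalarCurv_dil hL hC hw hc) hu v
    have e2 := scalarCurv_dil hL hC hu hc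
    have e3 := hA.apply_dil hu hc v
    have e4 := hB.apply_dil hu hc v
    change B (dil c u) v - (scalarCurv L D (dil c u) / ((n : ℝ) * ((n : ℝ) - 1))) * A (dil c u) v
      + (1 / ((n : ℝ) * ((n : ℝ) - 1))) * hDFun D (scalarCurv L D) (dil c u) v =
      B u v - (scalarCurv L D u / ((n : ℝ) * ((n : ℝ) - 1))) * A u v
      + (1 / ((n : ℝ) * ((n : ℝ) - 1))) * hDFun D (scalarCurv L D) u v
    rw [e1, e2, e3, e4]

/-! ### Recurrence of the curvature -/

lemma IsSmoothField.tensorG (hL : IsFinsler L) {X Y Z : PiField n M} (hX : IsSmoothField X)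
    (hY : IsSmoothField Y) (hZ : IsSmoothField Z) : IsSmoothField (tensorG L X Y Z) :=
  (hY.smul (isSmoothFun_metric hL hX hZ)).sub (hX.smul (isSmoothFun_metric hL hY hZ))

lemma hDTensor_tensorG (hL : IsFinsler L) (hC : IsCartanConnection L D) {W X Y Z : PiField n M}
    (hX : IsSmoothField X) (hY : IsSmoothField Y)
    (hZ : IsSmoothField Z) {u : TM n M} (hu : u ∈ slit n M) :
    hDTensor D (tensorG L) W X Y Z u = 0 := by
  have h1 : D (tensorG L X Y Z) u (hlift D W u) = _ :=
    conn_sub hC.linear (hY.smul (isSmoothFun_metric hL hX hZ))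
      (hX.smul (isSmoothFun_metric hL hY hZ)) hu (hlift D W u)
  rw [conn_smul hC.linear (isSmoothFun_metric hL hX hZ) hY hu,
    conn_smul hC.linear (isSmoothFun_metric hL hY hZ) hX hu,
    hC.metric X Z hX hZ u hu, hC.metric Y Z hY hZ u hu] at h1
  have h2 : hDTensor D (tensorG L) W X Y Z u = D (tensorG L X Y Z) u (hlift D W u)
      - (metric L u (D X u (hlift D W u)) (Z u) • Y u - metric L u (Y u) (Z u) • D X u (hlift D W u))
      - (metric L u (X u) (Z u) • D Y u (hlift D W u) - metric L u (D Y u (hlift D W u)) (Z u) • X u)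
      - (metric L u (X u) (D Z u (hlift D W u)) • Y u -
          metric L u (Y u) (D Z u (hlift D W u)) • X u) := rfl
  rw [h2, h1]
  generalize D X u (hlift D W u) = x
  generalize D Y u (hlift D W u) = y
  module

lemma isSmoothField_concircular (hL : IsFinsler L) (hC : IsCartanConnection L D)
    {X Y Z : PiField n M} (hX : IsSmoothField X) (hY : IsSmoothField Y) (hZ : IsSmoothField Z) :
    IsSmoothField (concircular L D X Y Z) := by
  have hs := (isSmoothFun_scalarCurv hL hC.linear hC.regular).mul
    (IsSmoothFun.const ((n : ℝ) * ((n : ℝ) - 1))⁻¹)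
  exact ((isTensorField_curvR hC.linear hC.regular).smooth X Y Z hX hY hZ).sub
    ((hX.tensorG hL hY hZ).smul hs)

lemma twoRecurrenceEq_of_recurrenceEq (hL : IsFinsler L) (hC : IsCartanConnection L D)
    {T : PiField n M → PiField n M → PiField n M → PiField n M}
    (hT : ∀ X Y Z, IsSmoothField X → IsSmoothField Y → IsSmoothField Z → IsSmoothField (T X Y Z))
    {A B : OneForm n M} (hA : IsOneForm A) (hB : IsOneForm B) (h : RecurrenceEq L D T A B) :
    TwoRecurrenceEq L D T (formAlpha D A) (formMu D A B) := by
  intro V W X Y Z hV hW hX hY hZ u hu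
  have hD := hC.linear
  have hr := hC.regular
  have hTs := hT X Y Z hX hY hZ
  have hGs := hX.tensorG hL hY hZ
  have hAs := hA.smooth W hW
  have hBs := hB.smooth W hW
  have h1 : D (hDTensor D T W X Y Z) u =
      D ((fun v => A v (W v)) • T X Y Z + (fun v => B v (W v)) • tensorG L X Y Z) u := by
    refine conn_congr hD ((hTs.smul hAs).add (hGs.smul hBs)) hu ?_
    filter_upwards [slit_mem_nhds hu] with v hv using h W X Y Z hW hX hY hZ v hv
  have h2 := h V X Y Z hV hX hY hZ u hu
  have h3 := hDTensor_tensorG hL hC (W := V) hX hY hZ hu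
  have e1 := h _ X Y Z (hV.nabla hD hr hW) hX hY hZ u hu
  have e2 := h W _ Y Z hW (hV.nabla hD hr hX) hY hZ u hu
  have e3 := h W X _ Z hW hX (hV.nabla hD hr hY) hZ u hu
  have e4 := h W X Y _ hW hX hY (hV.nabla hD hr hZ) u hu
  rw [hDTensor₂, e1, e2, e3, e4]
  rw [hDTensor] at h2 h3
  have h4 : Finsler.hD D V (hDTensor D T W X Y Z) u =
      A u (W u) • Finsler.hD D V (T X Y Z) u + hDFun D (fun v => A v (W v)) u (V u) • T X Y Z u +
      (B u (W u) • Finsler.hD D V (tensorG L X Y Z) u +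
        hDFun D (fun v => B v (W v)) u (V u) • tensorG L X Y Z u) := by
    change D (hDTensor D T W X Y Z) u (hlift D V u) = _
    rw [h1, conn_add hD (hTs.smul hAs) (hGs.smul hBs) hu, conn_smul hD hAs hTs hu,
      conn_smul hD hBs hGs hu]
    rfl
  rw [h4, formAlpha, formMu, hDOneForm, hDOneForm]
  generalize Finsler.hD D V (T X Y Z) u = t at *
  generalize Finsler.hD D V (tensorG L X Y Z) u = g at *
  have h2' : t = A u (V u) • T X Y Z u + B u (V u) • tensorG L X Y Z u
      + T (Finsler.hD D V X) Y Z u + T X (Finsler.hD D V Y) Z u + T X Y (Finsler.hD D V Z) u := by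
    rw [← h2]; abel
  have h3' : g = tensorG L (Finsler.hD D V X) Y Z u + tensorG L X (Finsler.hD D V Y) Z u +
      tensorG L X Y (Finsler.hD D V Z) u := by
    rw [← sub_eq_zero, ← h3]; abel
  rw [h2', h3']
  module

lemma recurrenceEq_curvR (hL : IsFinsler L) (hC : IsCartanConnection L D) {A B : OneForm n M}
    (h : RecurrenceEq L D (concircular L D) A B) :
    RecurrenceEq L D (curvR D) A (formB₁ L D A B) := by
  intro W X Y Z hW hX hY hZ u hu
  have hD := hC.linear
  let s : TM n M → ℝ := fun v => (1 / ((n : ℝ) * ((n : ℝ) - 1))) * scalarCurv L D v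
  have hrs := isSmoothFun_scalarCurv hL hC.linear hC.regular
  have hs : IsSmoothFun s := (IsSmoothFun.const _).mul hrs
  have hcs := isSmoothField_concircular hL hC hX hY hZ
  have hGs := hX.tensorG hL hY hZ
  have hs' : ∀ v, scalarCurv L D v / ((n : ℝ) * ((n : ℝ) - 1)) = s v := fun v => by
    rw [div_eq_inv_mul, ← one_div]
  have hR : ∀ X Y Z v, curvR D X Y Z v = concircular L D X Y Z v + s v • tensorG L X Y Z v := by
    intro X Y Z v
    rw [concircular, hs', sub_add_cancel]
  have h1 : Finsler.hD D W (curvR D X Y Z) u = Finsler.hD D W (concircular L D X Y Z) u +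
      (s u • Finsler.hD D W (tensorG L X Y Z) u +
        (1 / ((n : ℝ) * ((n : ℝ) - 1)) * hDFun D (scalarCurv L D) u (W u)) • tensorG L X Y Z u) := by
    have e : curvR D X Y Z = concircular L D X Y Z + s • tensorG L X Y Z := funext (hR X Y Z)
    change D (curvR D X Y Z) u (hlift D W u) = _
    rw [e, conn_add hD hcs (hGs.smul hs) hu, conn_smul hD hs hGs hu, mvfderiv_const_mul hrs _ hu]
    rfl
  have h2 := h W X Y Z hW hX hY hZ u hu
  have h3 := hDTensor_tensorG hL hC (W := W) hX hY hZ hu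
  rw [hDTensor] at h2 h3 ⊢
  rw [h1, hR, hR, hR, hR X Y Z]
  have e5 : formB₁ L D A B u (W u) = B u (W u) - s u * A u (W u) +
      1 / ((n : ℝ) * ((n : ℝ) - 1)) * hDFun D (scalarCurv L D) u (W u) := by
    rw [← hs']; rfl
  rw [e5]
  generalize Finsler.hD D W (concircular L D X Y Z) u = t at *
  generalize Finsler.hD D W (tensorG L X Y Z) u = g at *
  have h2' : t = A u (W u) • concircular L D X Y Z u + B u (W u) • tensorG L X Y Z u
      + concircular L D (Finsler.hD D W X) Y Z u + concircular L D X (Finsler.hD D W Y) Z u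
      + concircular L D X Y (Finsler.hD D W Z) u := by
    rw [← h2]; abel
  have h3' : g = tensorG L (Finsler.hD D W X) Y Z u + tensorG L X (Finsler.hD D W Y) Z u +
      tensorG L X Y (Finsler.hD D W Z) u := by
    rw [← sub_eq_zero, ← h3]; abel
  rw [h2', h3']
  module

lemma mvfderiv_cofr (hD : IsLinearConnection D) {Z : PiField n M} (hZ : IsSmoothField Z) {x₀ : M}
    {u : TM n M} (hu : u ∈ slit n M) (hx : u.proj ∈ dom n x₀)
    (w : TangentSpace (𝓡 n).tangent u) (l : Fin n) :
    mvfderiv (𝓡 n).tangent (fun v => cofr x₀ l v (Z v)) u w = cofr x₀ l u (D Z u w) -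
      ∑ m, cofr x₀ m u (Z u) * cofr x₀ l u (D (fr x₀ m) u w) := by
  have h := congrArg (cofr x₀ l u) (conn_expand hD hZ hu hx w)
  rw [Finset.sum_add_distrib, map_add, map_sum, map_sum] at h
  simp only [map_smul, cofr_fr hx, smul_eq_mul, mul_ite, mul_one, mul_zero, Finset.sum_ite_eq,
    Finset.mem_univ, if_true] at h
  rw [h, add_sub_cancel_left]

lemma sum_cofr_tensorG {x₀ : M} {u : TM n M} (hx : u.proj ∈ dom n x₀) (X Y : PiField n M) :
    ∑ l, cofr x₀ l u (tensorG L X (fr x₀ l) Y u) = ((n : ℝ) - 1) * metric L u (X u) (Y u) := by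
  have h1 : ∀ l, cofr x₀ l u (tensorG L X (fr x₀ l) Y u) =
      metric L u (X u) (Y u) - metric L u (fr x₀ l u) (Y u) * cofr x₀ l u (X u) := by
    intro l
    rw [tensorG, map_sub, map_smul, map_smul, cofr_fr hx, if_pos rfl, smul_eq_mul, mul_one,
      smul_eq_mul]
  have h2 : ∑ l, metric L u (fr x₀ l u) (Y u) * cofr x₀ l u (X u) = metric L u (X u) (Y u) := by
    have e := congrArg (fun w => metricLin L u w (Y u)) (sum_cofr_smul_fr hx (X u))
    simp only [map_sum, LinearMap.sum_apply, map_smul, LinearMap.smul_apply, smul_eq_mul] at e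
    exact Eq.trans (Finset.sum_congr rfl fun l _ => mul_comm _ _) e.symm
  simp only [h1]
  rw [Finset.sum_sub_distrib, h2, Finset.sum_const, Finset.card_univ, Fintype.card_fin, nsmul_eq_mul]
  ring

lemma ricciRecurrenceEq_of_recurrenceEq (hD : IsLinearConnection D) (hr : IsRegular D)
    {A B : OneForm n M} (h : RecurrenceEq L D (curvR D) A B) :
    RicciRecurrenceEq L D A (((n : ℝ) - 1) • B) := by
  intro W X Y hW hX hY u hu
  have hx := mem_dom (n := n) u.proj
  have hT := isTensorField_curvR hD hr
  have hfr := fun i => isSmoothField_fr (n := n) u.proj i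
  have hRs := fun l => hT.smooth X _ Y hX (hfr l) hY
  have hWX := hW.nabla hD hr hX
  have hWY := hW.nabla hD hr hY
  have h1 : hDFun D (ricci D X Y) u (W u) = ∑ l, mvfderiv (𝓡 n).tangent
      (fun v => cofr u.proj l v (curvR D X (fr u.proj l) Y v)) u (hlift D W u) := by
    rw [← mvfderiv_sum_apply (fun l => isSmoothFun_cofr u.proj l (hRs l)) hu]
    refine congrArg (fun T => T (hlift D W u)) (mvfderiv_congr ?_)
    filter_upwards [slit_mem_nhds hu, eventually_dom hx] with v hv hvx
    exact ricci_eq hD hr hX hY hv hvx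
  have h2 : ∀ l, cofr u.proj l u (D (curvR D X (fr u.proj l) Y) u (hlift D W u)) =
      (A u (W u) * cofr u.proj l u (curvR D X (fr u.proj l) Y u) +
        B u (W u) * cofr u.proj l u (tensorG L X (fr u.proj l) Y u)) +
      cofr u.proj l u (curvR D (Finsler.hD D W X) (fr u.proj l) Y u) +
      (∑ m, cofr u.proj m u (D (fr u.proj l) u (hlift D W u)) *
        cofr u.proj l u (curvR D X (fr u.proj m) Y u)) +
      cofr u.proj l u (curvR D X (fr u.proj l) (Finsler.hD D W Y) u) := by
    intro l
    have e1 := h W X (fr u.proj l) Y hW hX (hfr l) hY u hu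
    rw [hDTensor] at e1
    have e2 : D (curvR D X (fr u.proj l) Y) u (hlift D W u) =
        (A u (W u) • curvR D X (fr u.proj l) Y u + B u (W u) • tensorG L X (fr u.proj l) Y u) +
        curvR D (Finsler.hD D W X) (fr u.proj l) Y u +
        curvR D X (Finsler.hD D W (fr u.proj l)) Y u +
        curvR D X (fr u.proj l) (Finsler.hD D W Y) u := by
      rw [← e1]
      change Finsler.hD D W (curvR D X (fr u.proj l) Y) u = _
      abel
    have e3 := congrArg (cofr u.proj l u)
      (curvR_expand hD hr hX (hW.nabla hD hr (hfr l)) hY hu hx)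
    rw [map_sum] at e3
    rw [e2, map_add, map_add, map_add, map_add, e3]
    simp only [map_smul, smul_eq_mul]
    rfl
  have h3 : ∑ l, ∑ m, cofr u.proj m u (curvR D X (fr u.proj l) Y u) *
        cofr u.proj l u (D (fr u.proj m) u (hlift D W u)) =
      ∑ l, ∑ m, cofr u.proj m u (D (fr u.proj l) u (hlift D W u)) *
        cofr u.proj l u (curvR D X (fr u.proj m) Y u) := by
    rw [Finset.sum_comm]
    exact Finset.sum_congr rfl fun l _ => Finset.sum_congr rfl fun m _ => mul_comm _ _
  rw [hDBilin, h1]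
  simp only [mvfderiv_cofr hD (hRs _) hu hx, h2]
  rw [ricci_eq hD hr hWX hY hu hx, ricci_eq hD hr hX hWY hu hx, ricci_eq hD hr hX hY hu hx]
  simp only [Finset.sum_sub_distrib, Finset.sum_add_distrib, ← Finset.mul_sum]
  rw [sum_cofr_tensorG hx, h3]
  change _ = _ + (((n : ℝ) - 1) * B u (W u)) * metric L u (X u) (Y u)
  ring

/-! ### Nonvanishing of the curvature -/

lemma OneForm.NonZero.exists_base {B : OneForm n M} (hB : B.NonZero) :
    ∃ u ∈ slit n M, ∃ W : PiField n M, IsSmoothField W ∧ B u (W u) ≠ 0 := by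
  obtain ⟨u, hu, hne⟩ := hB
  by_contra! hcon
  refine hne (ContinuousLinearMap.ext fun w => ?_)
  obtain ⟨W, hW, rfl⟩ := Finsler.exists_base u w
  exact hcon u hu _ (isSmoothField_basic hW)

lemma metric_fr_pos (hL : IsFinsler L) {u : TM n M} (hu : u ∈ slit n M) (i : Fin n) :
    0 < metric L u (fr u.proj i u) (fr u.proj i u) := by
  refine hL.posDef u hu _ fun h0 => ?_
  have h := cofr_fr (n := n) (mem_dom u.proj) i i
  rw [h0, map_zero, if_pos rfl] at h
  exact zero_ne_one h

lemma curvR_nonZero (hL : IsFinsler L) (hC : IsCartanConnection L D) (hn : 2 ≤ n)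
    {A B : OneForm n M} (hB : B.NonZero) (h : RecurrenceEq L D (curvR D) A B) :
    TensorNonZero (curvR D) := by
  by_contra hcon
  have h0 : ∀ X Y Z : PiField n M, IsSmoothField X → IsSmoothField Y → IsSmoothField Z →
      ∀ u ∈ slit n M, curvR D X Y Z u = 0 := by
    intro X Y Z hX hY hZ u hu
    by_contra hne
    exact hcon ⟨X, Y, Z, hX, hY, hZ, u, hu, hne⟩
  obtain ⟨u, hu, W, hW, hne⟩ := hB.exists_base
  have hD := hC.linear
  have hr := hC.regular
  let i : Fin n := ⟨0, by omega⟩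
  let j : Fin n := ⟨1, by omega⟩
  have hi := isSmoothField_fr (n := n) u.proj i
  have hj := isSmoothField_fr (n := n) u.proj j
  have h1 := h W _ _ _ hW hi hj hi u hu
  have h2 : Finsler.hD D W (curvR D (fr u.proj i) (fr u.proj j) (fr u.proj i)) u = 0 := by
    have : D (curvR D (fr u.proj i) (fr u.proj j) (fr u.proj i)) u = D 0 u := by
      refine conn_congr hD IsSmoothField.zero hu ?_
      filter_upwards [slit_mem_nhds hu] with v hv using h0 _ _ _ hi hj hi v hv
    rw [Finsler.hD, this, conn_zero hD hu]
  rw [hDTensor, h2, h0 _ _ _ (hW.nabla hD hr hi) hj hi u hu,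
    h0 _ _ _ hi (hW.nabla hD hr hj) hi u hu, h0 _ _ _ hi hj (hW.nabla hD hr hi) u hu,
    h0 _ _ _ hi hj hi u hu, sub_zero, sub_zero, sub_zero, smul_zero, zero_add] at h1
  have h3 := (smul_eq_zero.1 h1.symm).resolve_left hne
  have h4 := congrArg (cofr u.proj j u) h3
  have hij : j ≠ i := by simp [i, j]
  rw [tensorG, map_sub, map_smul, map_smul, cofr_fr (mem_dom u.proj), cofr_fr (mem_dom u.proj),
    if_pos rfl, if_neg hij, map_zero, smul_zero, sub_zero, smul_eq_mul, mul_one] at h4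
  exact (metric_fr_pos hL hu i).ne' h4

lemma ricci_nonZero (hL : IsFinsler L) (hC : IsCartanConnection L D) (hn : 0 < n)
    {A B : OneForm n M} (hB : B.NonZero) (h : RicciRecurrenceEq L D A B) :
    BilinNonZero (ricci D) := by
  by_contra hcon
  have h0 : ∀ X Y : PiField n M, IsSmoothField X → IsSmoothField Y →
      ∀ u ∈ slit n M, ricci D X Y u = 0 := by
    intro X Y hX hY u hu
    by_contra hne
    exact hcon ⟨X, Y, hX, hY, u, hu, hne⟩
  obtain ⟨u, hu, W, hW, hne⟩ := hB.exists_base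
  have hD := hC.linear
  have hr := hC.regular
  let i : Fin n := ⟨0, hn⟩
  have hi := isSmoothField_fr (n := n) u.proj i
  have h1 := h W _ _ hW hi hi u hu
  have h2 : hDFun D (ricci D (fr u.proj i) (fr u.proj i)) u (W u) = 0 := by
    have : mvfderiv (𝓡 n).tangent (ricci D (fr u.proj i) (fr u.proj i)) u =
        mvfderiv (𝓡 n).tangent (fun _ => (0 : ℝ)) u := by
      refine mvfderiv_congr ?_
      filter_upwards [slit_mem_nhds hu] with v hv using h0 _ _ hi hi v hv
    rw [mvfderiv_const] at this
    exact congrArg (fun T => T (hlift D W u)) this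
  rw [hDBilin, h2, h0 _ _ (hW.nabla hD hr hi) hi u hu, h0 _ _ hi (hW.nabla hD hr hi) u hu,
    h0 _ _ hi hi u hu, sub_zero, sub_zero, mul_zero, zero_add] at h1
  exact (mul_ne_zero hne (metric_fr_pos hL hu i).ne') h1.symm

lemma IsOneForm.const_smul {A : OneForm n M} (hA : IsOneForm A) (c : ℝ) : IsOneForm (c • A) where
  smooth X hX := (IsSmoothFun.const c).mul (hA.smooth X hX)
  homogeneous x y a ha hy v := congrArg (c * ·) (hA.homogeneous x y a ha hy v)

end

end Finsler
end

theorem mainTheorem2 {n : ℕ} (hn : 3 ≤ n) {M : Type*} [TopologicalSpace M] [T2Space M]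
    [ChartedSpace (EuclideanSpace ℝ (Fin n)) M] [IsManifold (𝓡 n) ∞ M]
    (L : Finsler.TM n M → ℝ) (hL : Finsler.IsFinsler L)
    (D : Finsler.Conn n M) (hD : Finsler.IsCartanConnection L D)
    (A B : Finsler.OneForm n M) (hA : Finsler.IsOneForm A) (hA₀ : A.NonZero)
    (hB : Finsler.IsOneForm B)
    (hC : Finsler.TensorNonZero (Finsler.concircular L D))
    (hrec : Finsler.RecurrenceEq L D (Finsler.concircular L D) A B) :
    (Finsler.TwoRecurrenceEq L D (Finsler.concircular L D)
        (Finsler.formAlpha D A) (Finsler.formMu D A B) ∧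
      (Finsler.BilinNonZero (Finsler.formAlpha D A) →
        Finsler.BilinNonZero (Finsler.formMu D A B) →
        ∃ α μ : Finsler.TwoForm n M,
          (∀ V W : Finsler.PiField n M, Finsler.IsSmoothField V → Finsler.IsSmoothField W →
            ∀ u ∈ Finsler.slit n M,
              α u (V u) (W u) = Finsler.formAlpha D A V W u ∧
              μ u (V u) (W u) = Finsler.formMu D A B V W u) ∧
          Finsler.IsGeneralized2ConcircularlyRecurrent L D α μ)) ∧
    (Finsler.RecurrenceEq L D (Finsler.curvR D) A (Finsler.formB₁ L D A B) ∧
      Finsler.RicciRecurrenceEq L D A (((n : ℝ) - 1) • Finsler.formB₁ L D A B) ∧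
      ((Finsler.formB₁ L D A B).NonZero →
        Finsler.IsGeneralizedRecurrent L D A (Finsler.formB₁ L D A B) ∧
        Finsler.IsGeneralizedRicciRecurrent L D A
          (((n : ℝ) - 1) • Finsler.formB₁ L D A B))) := by
  have h1 := Finsler.recurrenceEq_curvR hL hD hrec
  have h2 := Finsler.ricciRecurrenceEq_of_recurrenceEq hD.linear hD.regular h1
  have h3 := Finsler.twoRecurrenceEq_of_recurrenceEq hL hD
    (fun _ _ _ => Finsler.isSmoothField_concircular hL hD) hA hB hrec
  have hα := Finsler.isBilinField_formAlpha hD.linear hD.regular hA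
  have hμ := Finsler.isBilinField_formMu hD.linear hD.regular hA hB
  refine ⟨⟨h3, fun hα₀ hμ₀ => ⟨Finsler.toTwoForm (Finsler.formAlpha D A),
    Finsler.toTwoForm (Finsler.formMu D A B),
    fun V W hV hW u hu => ⟨hα.toTwoForm_apply hu hV hW, hμ.toTwoForm_apply hu hV hW⟩,
    ⟨hC, Finsler.isTwoForm_formAlpha hL hD hA, Finsler.isTwoForm_formMu hL hD hA hB,
      Finsler.toTwoForm_nonZero hα hα₀, Finsler.toTwoForm_nonZero hμ hμ₀, ?_⟩⟩⟩,
    h1, h2, fun hB₁ => ?_⟩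
  · intro V W X Y Z hV hW hX hY hZ u hu
    beta_reduce
    rw [hα.toTwoForm_apply hu hV hW, hμ.toTwoForm_apply hu hV hW]
    exact h3 V W X Y Z hV hW hX hY hZ u hu
  · have hform := Finsler.isOneForm_formB₁ hL hD hA hB
    have hn1 : (n : ℝ) - 1 ≠ 0 := by
      have : (3 : ℝ) ≤ n := by exact_mod_cast hn
      linarith
    have hne : (((n : ℝ) - 1) • Finsler.formB₁ L D A B).NonZero := by
      obtain ⟨u, hu, h⟩ := hB₁
      exact ⟨u, hu, smul_ne_zero hn1 h⟩
    exact ⟨⟨Finsler.curvR_nonZero hL hD (by omega) hB₁ h1, hA, hform, hA₀, hB₁, h1⟩,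
      ⟨Finsler.ricci_nonZero hL hD (by omega) hne h2, hA, hform.const_smul _, hA₀, hne, h2⟩⟩
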